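/- Let $\mathcal M$ be a nonzero von Neumann algebra, with center $\mathcal Z(\mathcal M)$, predual $\mathcal M_*$ and closed unit ball $\mathcal M_{\le 1}$. Let $\mathrm{gen}(\mathcal M)$ be the minimal cardinality of a subset that generates $\mathcal M$ as a (unital) von Neumann algebra, with the convention $\mathrm{gen}(\mathbb C)=1$. Let $\mathrm{dec}(\mathcal M)$ be the supremum of the cardinalities of sets of pairwise orthogonal nonzero projections in $\mathcal M$. Let $\chi_r(\mathcal M)$ be the minimal (orthonormal) dimension of a Hilbert space on which $\mathcal M$ has a faithful normal representation. Let $\mathrm{dens}$ denote the norm density character of a Banach space and let $s\text{-}\mathrm{dens}$ denote the density character (minimal cardinality of a dense subset) for the $\sigma$-strong topology. Write $\mathfrak c=2^{\aleph_0}$ and let $|S|$ be the cardinality of a set $S$. 1. There are nonzero von Neumann algebras $(\mathcal M_i)_{i\in I}$ such that $\mathcal M\simeq\sum^{\oplus}_{i\in I}\mathcal M_i$ (the von Neumann algebra direct sum of norm-bounded families), where $|I|\le \mathrm{dec}(\mathcal Z(\mathcal M))\le\mathrm{dec}(\mathcal M)$ and, for each $i\in I$, $$\chi_r(\mathcal M_i)\le\aleph_0\cdot\mathrm{gen}(\mathcal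 M)=s\text{-}\mathrm{dens}(\mathcal M)=s\text{-}\mathrm{dens}(\mathcal M_{\le 1}).$$ 2. The following relations hold: $$\mathrm{gen}(\mathcal M)\cdot\mathrm{dec}(\mathcal M)=\chi_r(\mathcal M)\le\aleph_0\cdot\chi_r(\mathcal M)=\mathrm{dens}(\mathcal M_*)\le|\mathcal M_*|=\mathfrak c\cdot\chi_r(\mathcal M)^{\aleph_0}\le\mathfrak c^{\mathrm{gen}(\mathcal M)}.$$ Thus $\mathrm{gen}(\mathcal M)$ and $\mathrm{dec}(\mathcal M)$ together determine $s\text{-}\mathrm{dens}(\mathcal M)$, $\chi_r(\mathcal M)$, $\mathrm{dens}(\mathcal M_*)$ and $|\mathcal M_*|$. -/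

import Mathlib

open Cardinal
open scoped ENNReal Cardinal InnerProductSpace

universe u

namespace VNSize

/-- The density character of a topological space: the minimal cardinality of a dense subset. -/
noncomputable def densityChar (X : Type u) (t : TopologicalSpace X) : Cardinal.{u} :=
  sInf {c | ∃ s : Set X, @Dense X t s ∧ #s = c}

section Hilbert

variable (H : Type u) [NormedAddCommGroup H] [InnerProductSpace ℂ H] [CompleteSpace H]

/-- The Hilbert space `ℓ²(ℕ, H)` of square-summable sequences in `H`. -/
abbrev SqSum : Type u := lp (fun _ : ℕ => H) 2

variable {H} in
/-- The operator on `ℓ²(ℕ, H)` that applies `x` in every coordinate. -/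
noncomputable def amplify (x : H →L[ℂ] H) : SqSum H →L[ℂ] SqSum H :=
  lp.mapCLM 2 (fun _ : ℕ => x) (norm_nonneg x) (fun _ => le_rfl)

/-- The `σ`-strong topology of `B(H)`: the coarsest topology for which all maps
`x ↦ (x ξ₀, x ξ₁, …) ∈ ℓ²(ℕ, H)`, with `ξ` a square-summable sequence in `H`, are continuous.
These maps are linear, so this is the topology of the seminorms `x ↦ (∑ₙ ‖x ξₙ‖²)^{1/2}`. -/
@[reducible] noncomputable def sigmaStrong : TopologicalSpace (H →L[ℂ] H) :=
  ⨅ ξ : SqSum H, TopologicalSpace.induced (fun x => amplify x ξ) inferInstance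

/-- The `σ`-weak topology of `B(H)`: the coarsest topology for which all functionals
`x ↦ ∑ₙ ⟪ηₙ, x ξₙ⟫`, with `ξ`, `η` square-summable sequences in `H`, are continuous. -/
@[reducible] noncomputable def sigmaWeak : TopologicalSpace (H →L[ℂ] H) :=
  ⨅ p : SqSum H × SqSum H,
    TopologicalSpace.induced (fun x => ⟪p.1, amplify x p.2⟫_ℂ) inferInstance

end Hilbert

variable {H : Type u} [NormedAddCommGroup H] [InnerProductSpace ℂ H] [CompleteSpace H]

/-- The elements of a von Neumann algebra, with the operator norm, as a normed `*`-algebra. -/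
abbrev Elt (M : VonNeumannAlgebra H) : Type u := M.toStarSubalgebra

/-- The center of a von Neumann algebra. -/
noncomputable def center (M : VonNeumannAlgebra H) : VonNeumannAlgebra H where
  toStarSubalgebra := M.toStarSubalgebra ⊓ M.commutant.toStarSubalgebra
  centralizer_centralizer' := by
    refine Set.Subset.antisymm ?_ Set.subset_centralizer_centralizer
    intro x hx
    have h1 : x ∈ Set.centralizer (Set.centralizer (M : Set (H →L[ℂ] H))) :=
      Set.centralizer_subset (Set.centralizer_subset (fun y hy => hy.1)) hx
    have h2 : x ∈ Set.centralizer (Set.centralizer (M.commutant : Set (H →L[ℂ] H))) :=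
      Set.centralizer_subset (Set.centralizer_subset (fun y hy => hy.2)) hx
    rw [VonNeumannAlgebra.centralizer_centralizer] at h1 h2
    exact ⟨h1, h2⟩

/-- The `σ`-strong topology of a von Neumann algebra. -/
@[reducible] noncomputable def sStrong (M : VonNeumannAlgebra H) : TopologicalSpace (Elt M) :=
  TopologicalSpace.induced Subtype.val (sigmaStrong H)

/-- The `σ`-weak topology of a von Neumann algebra. -/
@[reducible] noncomputable def sWeak (M : VonNeumannAlgebra H) : TopologicalSpace (Elt M) :=
  TopologicalSpace.induced Subtype.val (sigmaWeak H)

/-- The `σ`-strong density character of `M`. -/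
noncomputable def sDens (M : VonNeumannAlgebra H) : Cardinal.{u} :=
  densityChar (Elt M) (sStrong M)

/-- The closed unit ball of `M`. -/
abbrev UnitBall (M : VonNeumannAlgebra H) : Type u := {x : Elt M // ‖x‖ ≤ 1}

/-- The `σ`-strong density character of the closed unit ball of `M`. -/
noncomputable def sDensBall (M : VonNeumannAlgebra H) : Cardinal.{u} :=
  densityChar (UnitBall M) (TopologicalSpace.induced Subtype.val (sStrong M))

/-- The predual `M_*`: the Banach space of `σ`-weakly continuous linear functionals on `M`,
with the norm of functionals. -/
noncomputable def Predual (M : VonNeumannAlgebra H) : Submodule ℂ (StrongDual ℂ (Elt M)) where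
  carrier := {φ | @Continuous _ _ (sWeak M) _ (fun x => φ x)}
  add_mem' := fun {φ ψ} hφ hψ => by
    let _ := sWeak M
    exact Continuous.add hφ hψ
  zero_mem' := by
    let _ := sWeak M
    exact continuous_const (y := (0 : ℂ))
  smul_mem' := fun c φ hφ => by
    let _ := sWeak M
    exact Continuous.const_smul hφ c

/-- The norm density character of the predual of `M`. -/
noncomputable def densPredual (M : VonNeumannAlgebra H) : Cardinal.{u} :=
  densityChar (Predual M) inferInstance

/-- `S` generates `M`: `M` is the smallest von Neumann algebra that contains `S`. -/
def Generates (M : VonNeumannAlgebra H) (S : Set (H →L[ℂ] H)) : Prop :=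
  S ⊆ M ∧ ∀ N : VonNeumannAlgebra H, S ⊆ N → M ≤ N

open scoped Classical in
/-- The minimal cardinality of a generating set of `M`; it is set to `1` if `M` consists of
the scalar operators. -/
noncomputable def gen (M : VonNeumannAlgebra H) : Cardinal.{u} :=
  if ∀ x ∈ M, ∃ c : ℂ, x = c • (1 : H →L[ℂ] H) then 1
  else sInf {c | ∃ S : Set (H →L[ℂ] H), Generates M S ∧ #S = c}

/-- A set of pairwise orthogonal nonzero projections in `M`. -/
def IsOrthoFamily (M : VonNeumannAlgebra H) (S : Set (H →L[ℂ] H)) : Prop :=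
  (∀ p ∈ S, p ∈ M ∧ IsStarProjection p ∧ p ≠ 0) ∧ S.Pairwise fun p q => p * q = 0

/-- The decomposability number: the supremum of the cardinalities of the sets of pairwise
orthogonal nonzero projections in `M`. -/
noncomputable def dec (M : VonNeumannAlgebra H) : Cardinal.{u} :=
  ⨆ S : {S : Set (H →L[ℂ] H) // IsOrthoFamily M S}, #S.1

/-- A faithful normal representation of `M` on the Hilbert space `K`: an injective unital
`*`-homomorphism `M → B(K)` that is continuous for the `σ`-weak topologies. -/
structure IsFaithfulNormalRep (M : VonNeumannAlgebra H) {K : Type u} [NormedAddCommGroup K]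
    [InnerProductSpace ℂ K] [CompleteSpace K] (π : Elt M →⋆ₐ[ℂ] (K →L[ℂ] K)) : Prop where
  injective : Function.Injective π
  normal : @Continuous _ _ (sWeak M) (sigmaWeak K) π

/-- The Hilbert space dimension: the cardinality of an orthonormal (Hilbert) basis. -/
noncomputable def hilbertDim (K : Type u) [NormedAddCommGroup K] [InnerProductSpace ℂ K] :
    Cardinal.{u} :=
  sInf {c | ∃ (ι : Type u) (_ : HilbertBasis ι ℂ K), #ι = c}

/-- The representation density: the minimal dimension of a Hilbert space on which `M` acts
faithfully (and normally). -/
noncomputable def repDensity (M : VonNeumannAlgebra H) : Cardinal.{u} :=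
  sInf {c | ∃ (K : Type u) (_ : NormedAddCommGroup K) (_ : InnerProductSpace ℂ K)
    (_ : CompleteSpace K) (π : Elt M →⋆ₐ[ℂ] (K →L[ℂ] K)),
      IsFaithfulNormalRep M π ∧ hilbertDim K = c}

section DirectSum

variable {I : Type u} {E : I → Type u} [∀ i, NormedAddCommGroup (E i)]
    [∀ i, InnerProductSpace ℂ (E i)] [∀ i, CompleteSpace (E i)]

/-- The direct sum of a family of von Neumann algebras: the `*`-algebra of norm-bounded families
`(xᵢ)` with `xᵢ ∈ Mᵢ`, with coordinatewise operations. -/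
def DirectSum (N : ∀ i, VonNeumannAlgebra (E i)) : Type u :=
  lp (fun i => Elt (N i)) ∞

variable (N : ∀ i, VonNeumannAlgebra (E i))

noncomputable instance : NonUnitalNormedRing (DirectSum N) :=
  inferInstanceAs (NonUnitalNormedRing (lp (fun i => Elt (N i)) ∞))

noncomputable instance : Module ℂ (DirectSum N) :=
  inferInstanceAs (Module ℂ (lp (fun i => Elt (N i)) ∞))

noncomputable instance : StarRing (DirectSum N) :=
  inferInstanceAs (StarRing (lp (fun i => Elt (N i)) ∞))

end DirectSum

end VNSize

/-! Fix a generating set S with at most gen(M) elements and put κ = ℵ₀·gen(M). There are at most κ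
words in S and its adjoints. By Zorn's lemma there is a maximal set V of nonzero vectors ξ such that
the closed spans of the vectors y(wξ), with y in the commutant M' and w a word, are pairwise
orthogonal. Each such span is invariant under M and M', so its projection is central: M is the
direct sum of its reductions to these blocks, and |V| ≤ dec(Z(M)). Within a block the words alone
carry ξ to a space of dimension at most κ; M acts faithfully on it because M' spreads it over the
block. Distinct ξ have distinct vector states on the words, hence also |V| ≤ 2^κ
(`IsCyclicDecomposition.mk_le_two_power`).

For the σ-strong density of the unit ball, choose κ approximants in each block and glue them along
functions from V to an index set Λ of cardinality κ. As |V| ≤ 2^κ, the Hewitt–Marczewski–Pondiczery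
argument gives κ functions that realize every finite pattern (`sDensBall_le`). Conversely a
σ-strongly dense subset generates M and is infinite.

Every bounded functional on the predual is evaluation at an element of M (`exists_eq_eval`), so by
Hahn–Banach a separating set of normal functionals has dense span. Matrix coefficients of a faithful
normal representation form such a set, which gives dens(M_*) ≤ ℵ₀·χ_r. Approximating the unit ball
on a set with dense span gives a generating set, so gen ≤ dens(M_*) and gen ≤ ℵ₀·χ_r; orthogonal
projections give dec ≤ χ_r and dec ≤ dens(M_*). With χ_r ≤ |V|·κ this settles gen·dec = χ_r when dec
is infinite. When dec is finite, a maximal orthogonal family consists of minimal projections and M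
behaves like a finite sum of matrix algebras: it has a single generator and a faithful
representation of dimension dec.

Limits of sequences bound |M_*| from above. For the lower bound, sequences in a maximal separated
set of vector functionals are coded injectively by series with weights 16⁻ⁿ. The final estimate is
χ_r ≤ 2^κ. -/

namespace VNSize

/-! ### Density, approximation and cardinality -/

section Topology

theorem dense_iInf_induced_iff {X ι : Type*} {Y : ι → Type*} [∀ i, PseudoMetricSpace (Y i)]
    (f : ∀ i, X → Y i) (s : Set X) :
    @Dense X (⨅ i, TopologicalSpace.induced (f i) inferInstance) s ↔
      ∀ x, ∀ F : Finset ι, ∀ ε > 0, ∃ d ∈ s, ∀ i ∈ F, dist (f i d) (f i x) < ε := by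
  let t : TopologicalSpace X := ⨅ i, TopologicalSpace.induced (f i) inferInstance
  have hb : ∀ x : X, nhds x = ⨅ i, Filter.comap (f i) (nhds (f i x)) := by
    intro x
    simp only [t, nhds_iInf, nhds_induced]
  constructor
  · intro hs x F ε hε
    have hU : (⋂ i ∈ F, {y | dist (f i y) (f i x) < ε}) ∈ nhds x := by
      rw [Filter.biInter_finset_mem]
      intro i _
      rw [hb]
      exact Filter.mem_iInf_of_mem i ⟨_, Metric.ball_mem_nhds _ hε, fun y hy => hy⟩
    obtain ⟨d, hd1, hd2⟩ := hs.inter_nhds_nonempty hU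
    exact ⟨d, hd1, by simpa using hd2⟩
  · intro h x
    rw [mem_closure_iff_nhds]
    intro U hU
    rw [hb, Filter.mem_iInf] at hU
    obtain ⟨I, hI, V, hV, rfl⟩ := hU
    have h1 : ∀ i : I, ∃ ε > 0, ∀ y, dist (f i y) (f i x) < ε → y ∈ V i := by
      intro i
      obtain ⟨W, hW, hWV⟩ := hV i
      obtain ⟨ε, hε, hb⟩ := Metric.mem_nhds_iff.1 hW
      exact ⟨ε, hε, fun y hy => hWV (hb hy)⟩
    choose e he hev using h1
    have := hI.fintype
    obtain ⟨ε, hε, hεe⟩ : ∃ ε > 0, ∀ i : I, ε ≤ e i := by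
      by_cases hne : Nonempty I
      · obtain ⟨i, hi⟩ := Finite.exists_min e
        exact ⟨e i, he i, hi⟩
      · exact ⟨1, one_pos, fun i => (hne ⟨i⟩).elim⟩
    obtain ⟨d, hd, hdF⟩ := h x hI.toFinset ε hε
    refine ⟨d, Set.mem_iInter.2 fun i => hev i d ?_, hd⟩
    exact (hdF i (by simp)).trans_le (hεe i)

theorem densityChar_le {X : Type u} {t : TopologicalSpace X} {s : Set X} (hs : @Dense X t s) :
    densityChar X t ≤ #s :=
  csInf_le' ⟨s, hs, rfl⟩

theorem exists_dense_mk_eq_densityChar (X : Type u) (t : TopologicalSpace X) :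
    ∃ s : Set X, @Dense X t s ∧ #s = densityChar X t :=
  csInf_mem (s := {c | ∃ s : Set X, @Dense X t s ∧ #s = c}) ⟨_, Set.univ, dense_univ, rfl⟩

/-- Balls of radius δ/2 around separated points are disjoint, so distinct points have distinct
approximants. This is the source of the lower bounds on densities. -/
theorem mk_le_of_separated {ι X : Type u} [PseudoMetricSpace X] (f : ι → X) {δ : ℝ}
    (hf : Pairwise fun i j => δ ≤ dist (f i) (f j)) (D : Set X)
    (hD : ∀ i, ∃ d ∈ D, dist (f i) d < δ / 2) : #ι ≤ #D := by
  choose g hg hgd using hD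
  refine mk_le_of_injective (f := fun i => (⟨g i, hg i⟩ : D)) fun i j hij => ?_
  by_contra hne
  have h1 := hf hne
  have h2 : g i = g j := congrArg Subtype.val hij
  have h3 := dist_triangle_right (f i) (f j) (g i)
  have h4 := hgd i
  have h5 := hgd j
  rw [← h2] at h5
  linarith

/-- Density does not pass to subspaces in general, so the approximants must be found inside `X`. A
code is a finite list of pairs (map, target in `D`) with a tolerance 1/(n+1); there are at most κ
codes, and one point of `X` is chosen for each code that is met. -/
theorem exists_approx_of_maps {X J D : Type u} {Y : Type*} [PseudoMetricSpace Y]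
    (f : J → X → Y) (e : D → Y) (hD : ∀ j x, f j x ∈ closure (Set.range e)) {κ : Cardinal.{u}}
    (hκ : ℵ₀ ≤ κ) (hJ : #J ≤ κ) (hDκ : #D ≤ κ) :
    ∃ s : Set X, #s ≤ κ ∧ ∀ x, ∀ F : Finset J, ∀ ε > 0, ∃ y ∈ s,
      ∀ j ∈ F, dist (f j y) (f j x) < ε := by
  classical
  let P : List (J × D) × ℕ → X → Prop := fun p x =>
    ∀ q ∈ p.1, dist (f q.1 x) (e q.2) < 1 / ((p.2 : ℝ) + 1)
  let s : Set X := Set.range fun p : {p // ∃ x, P p x} => p.2.choose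
  refine ⟨s, ?_, ?_⟩
  · refine mk_range_le.trans ((mk_subtype_le _).trans ?_)
    have h1 : #(J × D) ≤ κ := by
      rw [mk_prod, lift_id, lift_id]
      exact (mul_le_mul' hJ hDκ).trans (mul_eq_self hκ).le
    rw [mk_prod, mk_nat, lift_aleph0, lift_uzero]
    refine (mul_le_mul' ((mk_list_le_max _).trans (max_le hκ h1)) hκ).trans (mul_eq_self hκ).le
  · intro x F ε hε
    obtain ⟨n, hn⟩ := exists_nat_one_div_lt (half_pos hε)
    have h1 : ∀ j, ∃ d : D, dist (f j x) (e d) < 1 / ((n : ℝ) + 1) := by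
      intro j
      obtain ⟨_, ⟨d, rfl⟩, hdx⟩ := Metric.mem_closure_iff.1 (hD j x) _
        (Nat.one_div_pos_of_nat (n := n))
      exact ⟨d, hdx⟩
    choose d hd using h1
    let p : List (J × D) × ℕ := (F.toList.map fun j => (j, d j), n)
    have hp : ∃ x, P p x := by
      refine ⟨x, fun q hq => ?_⟩
      obtain ⟨j, -, rfl⟩ := List.mem_map.1 hq
      exact hd j
    refine ⟨hp.choose, ⟨⟨p, hp⟩, rfl⟩, fun j hj => ?_⟩
    have h2 : dist (f j hp.choose) (e (d j)) < 1 / ((n : ℝ) + 1) :=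
      hp.choose_spec (j, d j) (List.mem_map.2 ⟨j, Finset.mem_toList.2 hj, rfl⟩)
    have h3 := dist_triangle_right (f j hp.choose) (f j x) (e (d j))
    linarith [hd j]

/-- A combinatorial form of the Hewitt–Marczewski–Pondiczery theorem. -/
theorem exists_small_set_of_functions {I Λ : Type u} [Infinite Λ] (hI : #I ≤ 2 ^ #Λ) :
    ∃ G : Set (I → Λ), #G ≤ #Λ ∧ ∀ (F : Finset I) (g : I → Λ), ∃ h ∈ G, ∀ i ∈ F, h i = g i := by
  classical
  rw [← mk_set] at hI
  obtain ⟨c⟩ := hI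
  let o : Λ := Classical.arbitrary Λ
  -- An index `i` is coded by the subset `c i` of Λ. A list is a chain of tests: a triple (A, B,
  -- value) fires at `i` when `c i` meets `A` exactly in `B`.
  let h : List (Finset Λ × Finset Λ × Λ) → I → Λ := fun l i =>
    l.foldr (fun p r => if p.1.filter (· ∈ c i) = p.2.1 then p.2.2 else r) o
  refine ⟨Set.range h, ?_, ?_⟩
  · refine mk_range_le.trans ((mk_list_le_max _).trans (max_le (aleph0_le_mk Λ) ?_))
    simp only [mk_prod, lift_id, mk_finset_of_infinite, mul_mk_eq_max, max_self, le_refl]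
  · intro F g
    induction F using Finset.induction_on with
    | empty => exact ⟨h [], ⟨_, rfl⟩, by simp⟩
    | insert a F ha ih =>
      obtain ⟨_, ⟨l, rfl⟩, hl⟩ := ih
      have h1 : ∀ j : F, ∃ e : Λ, ¬ (e ∈ c j ↔ e ∈ c a) := by
        intro j
        by_contra! hcon
        have : (j : I) = a := c.injective (Set.ext hcon)
        exact ha (this ▸ j.2)
      choose e he using h1
      -- `A` contains a point telling `c a` from each `c j` with `j ∈ F`, so the new test fires at
      -- `a` and at no index of `F`.
      let A : Finset Λ := Finset.univ.image e
      refine ⟨h ((A, A.filter (· ∈ c a), g a) :: l), ⟨_, rfl⟩, fun i hi => ?_⟩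
      have hcons : h ((A, A.filter (· ∈ c a), g a) :: l) i =
          if A.filter (· ∈ c i) = A.filter (· ∈ c a) then g a else h l i := rfl
      rw [hcons]
      rcases Finset.mem_insert.1 hi with rfl | hi
      · simp
      · rw [if_neg, hl i hi]
        intro hA
        have h2 := Finset.ext_iff.1 hA (e ⟨i, hi⟩)
        simp only [Finset.mem_filter, A, Finset.mem_image, Finset.mem_univ, true_and] at h2
        have h3 := he ⟨i, hi⟩
        exact h3 (by simpa using h2)

theorem exists_dense_subset_span {E : Type u} [NormedAddCommGroup E] [NormedSpace ℂ E]
    (T : Set E) : ∃ D : Set E, #D ≤ max ℵ₀ #T ∧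
      closure (Submodule.span ℂ T : Set E) ⊆ closure D := by
  obtain ⟨C, hC, hCd⟩ := TopologicalSpace.exists_countable_dense ℂ
  let f : List (C × T) → E := fun l => (l.map fun p => (p.1 : ℂ) • (p.2 : E)).sum
  refine ⟨Set.range f, ?_, closure_minimal ?_ isClosed_closure⟩
  · have hCc : #C ≤ ℵ₀ := hC.le_aleph0
    have h0 : #(List (C × T)) ≤ max ℵ₀ #T := by
      refine (mk_list_le_max _).trans (max_le (le_max_left _ _) ?_)
      rw [mk_prod, lift_uzero, ]
      refine (mul_le_mul' (lift_le_aleph0.2 hCc) le_rfl).trans ?_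
      refine (mul_le_max _ _).trans ?_
      simp
    exact mk_range_le.trans h0
  · have hadd : ∀ x ∈ closure (Set.range f), ∀ y ∈ closure (Set.range f),
        x + y ∈ closure (Set.range f) := by
      intro x hx y hy
      refine map_mem_closure₂ continuous_add hx hy ?_
      rintro _ ⟨l, rfl⟩ _ ⟨m, rfl⟩
      exact ⟨l ++ m, by simp [f]⟩
    intro x hx
    induction hx using Submodule.span_induction with
    | mem x hx =>
      have h1 : Continuous fun c : ℂ => c • x := by fun_prop
      have h2 : (1 : ℂ) • x ∈ closure (Set.range f) := by
        refine map_mem_closure (f := fun c : ℂ => c • x) h1 (hCd 1) ?_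
        intro c hc
        exact ⟨[(⟨c, hc⟩, ⟨x, hx⟩)], by simp [f]⟩
      simpa using h2
    | zero => exact subset_closure ⟨[], by simp [f]⟩
    | add x y _ _ hx hy => exact hadd x hx y hy
    | smul a x _ hx =>
      have h1 : Continuous fun c : ℂ × E => c.1 • c.2 := by fun_prop
      have key : ∀ l, a • f l ∈ closure (Set.range f) := by
        intro l
        induction l with
        | nil => exact subset_closure ⟨[], by simp [f]⟩
        | cons p l ih =>
          have h3 : a • f (p :: l) = (a * p.1) • (p.2 : E) + a • f l := by
            simp [f, mul_smul]
          rw [h3]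
          refine hadd _ ?_ _ ih
          have h4 : Continuous fun c : ℂ => c • (p.2 : E) := by fun_prop
          refine map_mem_closure (f := fun c : ℂ => c • (p.2 : E)) h4 (hCd _) ?_
          intro c hc
          exact ⟨[(⟨c, hc⟩, p.2)], by simp [f]⟩
      have h5 : Continuous fun x : E => a • x := by fun_prop
      -- Multiples of finite sums are only limits of sums with coefficients in `C`, hence the second
      -- closure.
      rw [← closure_closure]
      refine map_mem_closure h5 hx ?_
      rintro _ ⟨l, rfl⟩
      exact key l

theorem exists_dual_vanishing {E : Type*} [NormedAddCommGroup E] [NormedSpace ℂ E]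
    {T : Set E} {x : E} (hx : x ∉ closure (Submodule.span ℂ T : Set E)) :
    ∃ f : StrongDual ℂ E, (∀ t ∈ T, f t = 0) ∧ f x ≠ 0 := by
  let U := (Submodule.span ℂ T).topologicalClosure
  have hU : IsClosed (U : Set E) := Submodule.isClosed_topologicalClosure _
  obtain ⟨f, u, hf, hu⟩ := RCLike.geometric_hahn_banach_closed_point (𝕜 := ℂ) (s := (U : Set E))
    (x := x) (U.restrictScalars ℝ).convex hU hx
  have hu0 : 0 < u := by simpa using hf 0 U.zero_mem
  refine ⟨f, fun t ht => ?_, fun h => ?_⟩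
  · by_contra h
    -- A functional bounded above on a subspace vanishes there: this multiple of `t` has value
    -- exactly `u`, against the strict bound.
    have h1 := hf (((u : ℂ) / f t) • t)
      (U.smul_mem _ (Submodule.le_topologicalClosure _ (Submodule.subset_span ht)))
    rw [map_smul, smul_eq_mul, div_mul_cancel₀ _ h] at h1
    simp at h1
  · rw [h, map_zero] at hu
    exact hu.not_gt hu0

/-- A bounded family of linear maps that is small on sufficiently many elements of `T` is small
at any given point of the closed linear span of `T`. -/
theorem exists_finset_bound {E F : Type*} [NormedAddCommGroup E] [NormedSpace ℂ E]
    [NormedAddCommGroup F] [NormedSpace ℂ F] {T : Set E} {e : E}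
    (he : e ∈ closure (Submodule.span ℂ T : Set E)) {C ε : ℝ} (hC : 0 < C) (hε : 0 < ε) :
    ∃ s : Finset T, ∃ δ > 0, ∀ z : E →ₗ[ℂ] F, (∀ e, ‖z e‖ ≤ C * ‖e‖) →
      (∀ t ∈ s, ‖z t‖ < δ) → ‖z e‖ < ε := by
  classical
  have key : ∀ e ∈ Submodule.span ℂ T, ∀ ε > 0, ∃ s : Finset T, ∃ δ > 0, ∀ z : E →ₗ[ℂ] F,
      (∀ t ∈ s, ‖z t‖ < δ) → ‖z e‖ < ε := by
    intro e he
    induction he using Submodule.span_induction with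
    | mem e he =>
      exact fun ε hε => ⟨{⟨e, he⟩}, ε, hε, fun z hz => hz _ (Finset.mem_singleton_self _)⟩
    | zero => exact fun ε hε => ⟨∅, 1, one_pos, fun z _ => by simpa using hε⟩
    | add a b _ _ ha hb =>
      intro ε hε
      obtain ⟨s, δ, hδ, h⟩ := ha (ε / 2) (half_pos hε)
      obtain ⟨s', δ', hδ', h'⟩ := hb (ε / 2) (half_pos hε)
      refine ⟨s ∪ s', min δ δ', lt_min hδ hδ', fun z hz => ?_⟩
      have h1 := h z fun l hl => (hz l (Finset.mem_union_left _ hl)).trans_le (min_le_left _ _)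
      have h2 := h' z fun l hl => (hz l (Finset.mem_union_right _ hl)).trans_le (min_le_right _ _)
      rw [map_add]
      exact (norm_add_le _ _).trans_lt (by linarith)
    | smul c a _ ha =>
      intro ε hε
      obtain ⟨s, δ, hδ, h⟩ := ha (ε / (‖c‖ + 1)) (by positivity)
      refine ⟨s, δ, hδ, fun z hz => ?_⟩
      have h1 := h z hz
      rw [map_smul, norm_smul]
      rw [lt_div_iff₀ (by positivity)] at h1
      nlinarith [norm_nonneg (z a)]
  obtain ⟨a, ha, hea⟩ := Metric.mem_closure_iff.1 he (ε / (2 * C)) (by positivity)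
  obtain ⟨s, δ, hδ, h⟩ := key a ha (ε / 2) (half_pos hε)
  refine ⟨s, δ, hδ, fun z hz hs => ?_⟩
  have h1 := h z hs
  have h2 : z e = z (e - a) + z a := by rw [map_sub, sub_add_cancel]
  have h3 := hz (e - a)
  rw [dist_eq_norm, lt_div_iff₀ (by positivity)] at hea
  rw [h2]
  exact (norm_add_le _ _).trans_lt (by linarith)

end Topology

/-! ### Hilbert space dimension -/

section HilbertDimension

variable {K : Type u} [NormedAddCommGroup K] [InnerProductSpace ℂ K]

theorem dist_sq_of_orthonormal {ι : Type*} {v : ι → K} (hv : Orthonormal ℂ v) {i j : ι}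
    (hij : i ≠ j) : 1 ≤ dist (v i) (v j) := by
  have h1 := norm_sub_sq (𝕜 := ℂ) (v i) (v j)
  rw [hv.2 hij, map_zero] at h1
  rw [hv.1, hv.1] at h1
  rw [dist_eq_norm]
  nlinarith [norm_nonneg (v i - v j)]

theorem mk_orthonormal_le_of_dense_span {ι : Type u} {v : ι → K} (hv : Orthonormal ℂ v)
    (T : Set K) (hT : ∀ i, v i ∈ closure (Submodule.span ℂ T : Set K)) :
    #ι ≤ max ℵ₀ #T := by
  obtain ⟨D, hD, hTD⟩ := exists_dense_subset_span T
  refine (mk_le_of_separated v (δ := 1) (fun i j hij => dist_sq_of_orthonormal hv hij) D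
    fun i => ?_).trans hD
  exact Metric.mem_closure_iff.1 (hTD (hT i)) _ (by norm_num)

/-- Separation compares cardinals only up to ℵ₀; a finite basis is handled by linear independence.
-/
theorem mk_orthonormal_le_mk_hilbertBasis {ι J : Type u} {v : J → K} (hv : Orthonormal ℂ v)
    (b : HilbertBasis ι ℂ K) : #J ≤ #ι := by
  have hd : ∀ x : K, x ∈ closure (Submodule.span ℂ (Set.range b) : Set K) := by
    intro x
    have := b.dense_span
    rw [← Submodule.topologicalClosure_coe, this]
    trivial
  by_cases hι : ℵ₀ ≤ #ι
  · refine (mk_orthonormal_le_of_dense_span hv (Set.range b) fun i => hd _).trans ?_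
    exact max_le hι mk_range_le
  · have : Finite ι := by
      rwa [not_le, lt_aleph0_iff_finite] at hι
    have : Fintype ι := Fintype.ofFinite ι
    have := b.toOrthonormalBasis.toBasis
    have h1 := hv.linearIndependent.cardinal_le_rank
    rwa [this.mk_eq_rank''.symm] at h1

theorem hilbertDim_le_mk {ι : Type u} (b : HilbertBasis ι ℂ K) : hilbertDim K ≤ #ι :=
  csInf_le' ⟨ι, b, rfl⟩

variable [CompleteSpace K]

variable (K) in
theorem exists_hilbertBasis_mk_eq : ∃ (ι : Type u) (_ : HilbertBasis ι ℂ K), #ι = hilbertDim K := by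
  obtain ⟨w, b, -⟩ := exists_hilbertBasis ℂ K
  exact csInf_mem (s := {c | ∃ (ι : Type u) (_ : HilbertBasis ι ℂ K), #ι = c}) ⟨_, w, b, rfl⟩

theorem mk_orthonormal_le_hilbertDim {J : Type u} {v : J → K} (hv : Orthonormal ℂ v) :
    #J ≤ hilbertDim K := by
  obtain ⟨ι, b, h⟩ := exists_hilbertBasis_mk_eq K
  exact h ▸ mk_orthonormal_le_mk_hilbertBasis hv b

theorem hilbertDim_le_of_isometry {E : Type u} [NormedAddCommGroup E] [InnerProductSpace ℂ E]
    (f : K →ₗᵢ[ℂ] E) (T : Set E) (hT : ∀ x, f x ∈ closure (Submodule.span ℂ T : Set E)) :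
    hilbertDim K ≤ max ℵ₀ #T := by
  obtain ⟨w, b, -⟩ := exists_hilbertBasis ℂ K
  exact (hilbertDim_le_mk b).trans
    (mk_orthonormal_le_of_dense_span (b.orthonormal.comp_linearIsometry f) T fun i => hT _)

variable (K) in
theorem hilbertDim_le_rank : hilbertDim K ≤ Module.rank ℂ K := by
  obtain ⟨w, b, -⟩ := exists_hilbertBasis ℂ K
  exact (hilbertDim_le_mk b).trans b.orthonormal.linearIndependent.cardinal_le_rank

end HilbertDimension

/-! ### Commutants, words and generators -/

section Operators

variable {H : Type u} [NormedAddCommGroup H] [InnerProductSpace ℂ H] [CompleteSpace H]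

theorem star_inner_left (x : H →L[ℂ] H) (h k : H) : ⟪star x h, k⟫_ℂ = ⟪h, x k⟫_ℂ := by
  rw [ContinuousLinearMap.star_eq_adjoint, ContinuousLinearMap.adjoint_inner_left]

theorem inner_star_right (x : H →L[ℂ] H) (h k : H) : ⟪h, star x k⟫_ℂ = ⟪x h, k⟫_ℂ := by
  rw [ContinuousLinearMap.star_eq_adjoint, ContinuousLinearMap.adjoint_inner_right]

theorem map_mem_of_mem_closure_span {E F : Type*} [NormedAddCommGroup E] [NormedSpace ℂ E]
    [NormedAddCommGroup F] [NormedSpace ℂ F] (f : E →L[ℂ] F) {T : Set E} {U : Submodule ℂ F}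
    (hU : IsClosed (U : Set F)) (h : ∀ t ∈ T, f t ∈ U) {x : E}
    (hx : x ∈ (Submodule.span ℂ T).topologicalClosure) : f x ∈ U := by
  have : (Submodule.span ℂ T).topologicalClosure ≤ U.comap (f : E →ₗ[ℂ] F) :=
    Submodule.topologicalClosure_minimal _ (Submodule.span_le.2 h) (hU.preimage f.continuous)
  exact this hx

theorem starProjection_comm_of_invariant (K : Submodule ℂ H) [K.HasOrthogonalProjection]
    (y : H →L[ℂ] H) (h : ∀ k ∈ K, y k ∈ K) (h' : ∀ k ∈ K, star y k ∈ K) :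
    y * K.starProjection = K.starProjection * y := by
  ext v
  refine (Submodule.eq_starProjection_of_mem_of_inner_eq_zero
    (h _ (K.starProjection_apply_mem v)) fun w hw => ?_).symm
  change ⟪y v - y (K.starProjection v), w⟫_ℂ = 0
  rw [← map_sub, ← inner_star_right]
  exact K.starProjection_inner_eq_zero v _ (h' w hw)

/-- The von Neumann algebra of operators that commute with `R` and with the adjoints of `R`. -/
noncomputable def ofCentralizer (R : Set (H →L[ℂ] H)) : VonNeumannAlgebra H where
  toStarSubalgebra := StarSubalgebra.centralizer ℂ R
  centralizer_centralizer' := by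
    change Set.centralizer (Set.centralizer
      ((StarSubalgebra.centralizer ℂ R : StarSubalgebra ℂ (H →L[ℂ] H)) : Set (H →L[ℂ] H))) =
      ((StarSubalgebra.centralizer ℂ R : StarSubalgebra ℂ (H →L[ℂ] H)) : Set (H →L[ℂ] H))
    simp

theorem mem_ofCentralizer {R : Set (H →L[ℂ] H)} {x : H →L[ℂ] H} :
    x ∈ ofCentralizer R ↔ ∀ g ∈ R, g * x = x * g ∧ star g * x = x * star g :=
  StarSubalgebra.mem_centralizer_iff ℂ

variable (M : VonNeumannAlgebra H)

theorem mem_of_forall_commutant {x : H →L[ℂ] H} (h : ∀ y ∈ M.commutant, y * x = x * y) :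
    x ∈ M := by
  rw [← M.commutant_commutant]
  exact VonNeumannAlgebra.mem_commutant_iff.2 h

variable {M} in
theorem commutant_comm {x y : H →L[ℂ] H} (hx : x ∈ M) (hy : y ∈ M.commutant) : x * y = y * x :=
  VonNeumannAlgebra.mem_commutant_iff.1 hy x hx

variable {M} in
theorem commutant_comm_apply {x y : H →L[ℂ] H} (hx : x ∈ M) (hy : y ∈ M.commutant) (h : H) :
    x (y h) = y (x h) :=
  congrArg (fun z : H →L[ℂ] H => z h) (commutant_comm hx hy)

variable {M} in
theorem smul_mem' {x : H →L[ℂ] H} (c : ℂ) (hx : x ∈ M) : c • x ∈ M :=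
  M.toStarSubalgebra.toSubalgebra.smul_mem hx c

/-- Commutation of `x` with `y` in the commutant, tested on a pair of vectors, involves just two
matrix coefficients of `x`. This is why two coefficients are to be approximated simultaneously. -/
theorem mem_of_forall_approx {x : H →L[ℂ] H} (h : ∀ h k h' k' : H, ∀ ε > 0, ∃ d ∈ M,
    ‖⟪h, (d - x) k⟫_ℂ‖ < ε ∧ ‖⟪h', (d - x) k'⟫_ℂ‖ < ε) : x ∈ M := by
  refine mem_of_forall_commutant M fun y hy => ?_
  refine ContinuousLinearMap.ext fun k => ext_inner_left ℂ fun v => ?_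
  rw [← sub_eq_zero, ← norm_eq_zero]
  refine le_antisymm (le_of_forall_pos_le_add fun ε hε => ?_) (norm_nonneg _)
  obtain ⟨d, hd, h1, h2⟩ := h (star y v) k v (y k) (ε / 2) (half_pos hε)
  have h3 : ⟪star y v, (d - x) k⟫_ℂ = ⟪v, y (d k)⟫_ℂ - ⟪v, y (x k)⟫_ℂ := by
    rw [star_inner_left]
    simp
  have h4 : ⟪v, (d - x) (y k)⟫_ℂ = ⟪v, y (d k)⟫_ℂ - ⟪v, x (y k)⟫_ℂ := by
    rw [← commutant_comm_apply hd hy]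
    simp
  have h5 : ⟪v, (y * x) k⟫_ℂ - ⟪v, (x * y) k⟫_ℂ =
      ⟪v, (d - x) (y k)⟫_ℂ - ⟪star y v, (d - x) k⟫_ℂ := by
    rw [h3, h4]
    simp
  rw [h5]
  exact (norm_sub_le _ _).trans (by linarith)

section Words

/-- The monoid of words in the elements of `S` and their adjoints. -/
def words (S : Set (H →L[ℂ] H)) : Submonoid (H →L[ℂ] H) :=
  Submonoid.closure (S ∪ {x | star x ∈ S})

theorem subset_words (S : Set (H →L[ℂ] H)) : S ⊆ words S :=
  fun _ hx => Submonoid.subset_closure (Or.inl hx)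

theorem star_mem_words {S : Set (H →L[ℂ] H)} {w : H →L[ℂ] H} (hw : w ∈ words S) :
    star w ∈ words S := by
  induction hw using Submonoid.closure_induction with
  | mem x hx =>
    refine Submonoid.subset_closure ?_
    rcases hx with hx | hx
    · exact Or.inr (by simp [hx])
    · exact Or.inl hx
  | one => simp
  | mul x y _ _ hx hy => simpa using (words S).mul_mem hy hx

theorem mk_words_le (S : Set (H →L[ℂ] H)) : #(words S) ≤ max ℵ₀ #S := by
  have h1 : #(S ∪ {x | star x ∈ S} : Set (H →L[ℂ] H)) ≤ max ℵ₀ #S := by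
    refine (mk_union_le _ _).trans ?_
    have : #{x : H →L[ℂ] H | star x ∈ S} ≤ #S :=
      mk_le_of_injective (f := fun x => (⟨star x.1, x.2⟩ : S)) fun x y hxy =>
        Subtype.ext (star_injective (Subtype.mk.inj hxy))
    refine (add_le_add_right this _).trans ?_
    exact (add_le_add (le_max_right ℵ₀ _) (le_max_right ℵ₀ _)).trans
      (add_eq_self (le_max_left _ _)).le
  have h2 : (words S : Set (H →L[ℂ] H)) = Set.range
      (FreeMonoid.lift ((↑) : (S ∪ {x | star x ∈ S} : Set (H →L[ℂ] H)) → H →L[ℂ] H)) := by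
    rw [words, Submonoid.closure_eq_mrange]
    rfl
  have h3 : #(words S) = #(words S : Set (H →L[ℂ] H)) := rfl
  rw [h3, h2]
  refine mk_range_le.trans ((mk_list_le_max _).trans (max_le (le_max_left _ _) h1))

variable {M} {S : Set (H →L[ℂ] H)}

theorem words_le (hS : S ⊆ M) {w : H →L[ℂ] H} (hw : w ∈ words S) : w ∈ M := by
  induction hw using Submonoid.closure_induction with
  | mem x hx =>
    rcases hx with hx | hx
    · exact hS hx
    · rw [← star_star x]
      exact star_mem (hS hx)
  | one => exact one_mem M
  | mul x y _ _ hx hy => exact mul_mem hx hy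

/-- The operators commuting with `y` and `star y` form a von Neumann algebra. It contains `S`, since
words are stable under adjoints, and hence `M`. -/
theorem Generates.mem_commutant (hS : Generates M S) {y : H →L[ℂ] H}
    (hy : ∀ w ∈ words S, w * y = y * w) : y ∈ M.commutant := by
  rw [VonNeumannAlgebra.mem_commutant_iff]
  intro x hx
  have h1 : S ⊆ ofCentralizer {y} := by
    intro s hs
    refine mem_ofCentralizer.2 fun g hg => ?_
    rw [Set.mem_singleton_iff.1 hg]
    refine ⟨(hy s (subset_words S hs)).symm, ?_⟩
    have := congrArg star (hy _ (star_mem_words (subset_words S hs)))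
    simpa using this
  exact ((mem_ofCentralizer.1 (hS.2 _ h1 hx)) y rfl).1.symm

theorem generates_of_forall_mem_commutant (hS : S ⊆ M)
    (h : ∀ y, (∀ s ∈ S, s * y = y * s) → (∀ s ∈ S, star s * y = y * star s) → y ∈ M.commutant) :
    Generates M S := by
  refine ⟨hS, fun N hN x hx => mem_of_forall_commutant N fun y hy => ?_⟩
  refine (commutant_comm hx (h y (fun s hs => ?_) fun s hs => ?_)).symm
  · exact commutant_comm (hN hs) hy
  · exact commutant_comm (star_mem (hN hs)) hy

theorem generates_self (M : VonNeumannAlgebra H) : Generates M (M : Set (H →L[ℂ] H)) :=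
  ⟨subset_rfl, fun _ h => h⟩

/-- Equality can fail: the scalars are generated by the empty set, while `gen` is 1 by convention.
-/
theorem exists_generates_mk_le_gen (M : VonNeumannAlgebra H) :
    ∃ S : Set (H →L[ℂ] H), Generates M S ∧ #S ≤ gen M := by
  by_cases h : ∀ x ∈ M, ∃ c : ℂ, x = c • (1 : H →L[ℂ] H)
  · refine ⟨∅, ⟨Set.empty_subset _, fun N _ x hx => ?_⟩, by simp⟩
    obtain ⟨c, rfl⟩ := h x hx
    exact smul_mem' c (one_mem N)
  · rw [gen, if_neg h]
    obtain ⟨S, hS, hc⟩ := csInf_mem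
      (s := {c | ∃ S : Set (H →L[ℂ] H), Generates M S ∧ #S = c}) ⟨_, _, generates_self M, rfl⟩
    exact ⟨S, hS, hc.le⟩

theorem Generates.gen_le (hS : Generates M S) (h1 : 1 ≤ #S) : gen M ≤ #S := by
  rw [gen]
  split_ifs with h
  · exact h1
  · exact csInf_le' ⟨S, hS, rfl⟩

theorem one_le_gen (M : VonNeumannAlgebra H) : 1 ≤ gen M := by
  rw [gen]
  split_ifs with h
  · exact le_rfl
  · refine le_csInf ⟨_, _, generates_self M, rfl⟩ ?_
    rintro _ ⟨S, hS, rfl⟩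
    rw [Cardinal.one_le_iff_ne_zero, mk_ne_zero_iff, Set.nonempty_coe_sort]
    by_contra hne
    rw [Set.not_nonempty_iff_eq_empty] at hne
    refine h fun x hx => ?_
    have h2 : M ≤ ofCentralizer Set.univ := hS.2 _ (by simp [hne])
    have h3 : x ∈ Set.center (H →L[ℂ] H) := by
      rw [Semigroup.mem_center_iff]
      exact fun g => ((mem_ofCentralizer.1 (h2 hx)) g trivial).1
    by_cases hH : ∃ v : H, v ≠ 0
    · obtain ⟨v, hv⟩ := hH
      refine ⟨⟪v, x v⟫_ℂ / (‖v‖ : ℂ) ^ 2, ContinuousLinearMap.ext fun k => ?_⟩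
      -- If the empty set generates, `x` commutes with every operator. For the rank-one operator
      -- sending `v` to a multiple of `k`, evaluation at `v` gives ⟪v, x v⟫ k = ‖v‖² x k.
      have h4 := ((mem_ofCentralizer.1 (h2 hx)) (InnerProductSpace.rankOne ℂ k v) trivial).1
      have h5 := congrArg (fun z : H →L[ℂ] H => z v) h4
      simp only [mul_apply_eq_comp, InnerProductSpace.rankOne_apply, map_smul] at h5
      have h6 : (‖v‖ : ℂ) ^ 2 ≠ 0 := by simpa using hv
      have h7 : ⟪v, v⟫_ℂ = (‖v‖ : ℂ) ^ 2 := inner_self_eq_norm_sq_to_K v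
      rw [h7] at h5
      rw [smul_apply, one_apply_eq_self, div_eq_inv_mul, mul_smul, h5, smul_smul,
        inv_mul_cancel₀ h6, one_smul]
    · push Not at hH
      exact ⟨0, ContinuousLinearMap.ext fun v => by simp [hH v]⟩

end Words

end Operators

/-! ### Amplification to ℓ²(ℕ, H) and the double commutant theorem -/

section Amplification

variable {H : Type u} [NormedAddCommGroup H] [InnerProductSpace ℂ H]

@[simp]
theorem amplify_apply (x : H →L[ℂ] H) (ξ : SqSum H) (n : ℕ) : amplify x ξ n = x (ξ n) := rfl

theorem norm_amplify_apply_le (x : H →L[ℂ] H) (ξ : SqSum H) : ‖amplify x ξ‖ ≤ ‖x‖ * ‖ξ‖ :=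
  (amplify x).le_of_opNorm_le (lp.norm_mapCLM_le _ _ _ _) ξ

theorem amplify_add (x y : H →L[ℂ] H) : amplify (x + y) = amplify x + amplify y := by
  ext ξ n
  simp

theorem amplify_sub (x y : H →L[ℂ] H) : amplify (x - y) = amplify x - amplify y := by
  ext ξ n
  simp

theorem amplify_smul (c : ℂ) (x : H →L[ℂ] H) : amplify (c • x) = c • amplify x := by
  ext ξ n
  simp

theorem amplify_mul (x y : H →L[ℂ] H) : amplify (x * y) = amplify x * amplify y := by
  ext ξ n
  simp

theorem amplify_single (x : H →L[ℂ] H) (n : ℕ) (h : H) :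
    amplify x (lp.single 2 n h) = lp.single 2 n (x h) := by
  ext m
  by_cases hm : m = n
  · subst hm
    simp
  · simp [Pi.single_eq_of_ne hm]

variable [CompleteSpace H]

theorem amplify_star (x : H →L[ℂ] H) : amplify (star x) = star (amplify x) := by
  rw [ContinuousLinearMap.star_eq_adjoint (amplify x), ContinuousLinearMap.eq_adjoint_iff]
  intro ξ η
  rw [lp.inner_eq_tsum, lp.inner_eq_tsum]
  simp [star_inner_left]

variable {M : VonNeumannAlgebra H} {S : Set (H →L[ℂ] H)}

/-- The double commutant theorem, for the amplification of an algebra. -/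
theorem Generates.amplify_mem_closure (hS : Generates M S) {x : H →L[ℂ] H} (hx : x ∈ M)
    (ζ : SqSum H) : amplify x ζ ∈
      (Submodule.span ℂ {v | ∃ w ∈ words S, v = amplify w ζ}).topologicalClosure := by
  set G := (Submodule.span ℂ {v | ∃ w ∈ words S, v = amplify w ζ}).topologicalClosure with hG
  have hGc : IsClosed (G : Set (SqSum H)) := Submodule.isClosed_topologicalClosure _
  have : CompleteSpace G := hGc.completeSpace_coe
  have hinv : ∀ w ∈ words S, ∀ g ∈ G, amplify w g ∈ G := by
    intro w hw g hg
    refine map_mem_of_mem_closure_span (amplify w) hGc ?_ hg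
    rintro _ ⟨w', hw', rfl⟩
    refine Submodule.le_topologicalClosure _ (Submodule.subset_span ⟨w * w', mul_mem hw hw', ?_⟩)
    rw [amplify_mul]
    rfl
  let P := G.starProjection
  have hcomm : ∀ w ∈ words S, amplify w * P = P * amplify w := fun w hw =>
    starProjection_comm_of_invariant G _ (hinv w hw) fun k hk => by
      rw [← amplify_star]
      exact hinv _ (star_mem_words hw) k hk
  -- These are the matrix entries of `P`. As `P` commutes with all amplified words, they lie in the
  -- commutant of `M`; thus they commute with `x`, and `P` commutes with its amplification.
  let p : ℕ → ℕ → H →L[ℂ] H := fun m n =>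
    (lp.evalCLM ℂ (fun _ : ℕ => H) 2 m).comp
      (P.comp (lp.singleContinuousLinearMap ℂ (fun _ : ℕ => H) 2 n))
  have hp : ∀ m n h, p m n h = P (lp.single 2 n h) m := fun m n h => rfl
  have hpM : ∀ m n, p m n ∈ M.commutant := by
    refine fun m n => hS.mem_commutant fun w hw => ContinuousLinearMap.ext fun h => ?_
    change w (p m n h) = p m n (w h)
    rw [hp, hp, ← amplify_single, ← amplify_apply]
    exact congrArg (fun z : SqSum H →L[ℂ] SqSum H => z (lp.single 2 n h) m) (hcomm w hw)
  have hxP : amplify x * P = P * amplify x := by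
    refine lp.ext_continuousLinearMap (by norm_num) fun n => ContinuousLinearMap.ext fun h => ?_
    ext m
    change x (P (lp.single 2 n h) m) = P (amplify x (lp.single 2 n h)) m
    rw [amplify_single, ← hp, ← hp]
    exact commutant_comm_apply hx (hpM m n) h
  have hζ : ζ ∈ G := by
    refine Submodule.le_topologicalClosure _ (Submodule.subset_span ⟨1, one_mem _, ?_⟩)
    ext n
    simp
  have h1 : P ζ = ζ := Submodule.starProjection_eq_self_iff.2 hζ
  have h2 : amplify x (P ζ) = P (amplify x ζ) :=
    congrArg (fun z : SqSum H →L[ℂ] SqSum H => z ζ) hxP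
  rw [← h1, h2]
  exact Submodule.starProjection_apply_mem _ _

end Amplification

/-! ### The predual and its dual -/

section Predual

variable {H : Type u} [NormedAddCommGroup H] [InnerProductSpace ℂ H] [CompleteSpace H]

theorem sStrong_eq (M : VonNeumannAlgebra H) : sStrong M =
    ⨅ ξ : SqSum H, TopologicalSpace.induced (fun x : Elt M => amplify x.1 ξ) inferInstance := by
  rw [sStrong, sigmaStrong, induced_iInf]
  simp only [induced_compose]
  rfl

theorem sWeak_eq (M : VonNeumannAlgebra H) : sWeak M = ⨅ p : SqSum H × SqSum H,
    TopologicalSpace.induced (fun x : Elt M => ⟪p.1, amplify x.1 p.2⟫_ℂ) inferInstance := by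
  rw [sWeak, sigmaWeak, induced_iInf]
  simp only [induced_compose]
  rfl

variable (M : VonNeumannAlgebra H)

/-- The functional `x ↦ ∑ₙ ⟪ηₙ, x ξₙ⟫` as a linear map. -/
noncomputable def vecFunₗ (η ξ : SqSum H) : Elt M →ₗ[ℂ] ℂ where
  toFun x := ⟪η, amplify x.1 ξ⟫_ℂ
  map_add' x y := by
    change ⟪η, amplify (x.1 + y.1) ξ⟫_ℂ = _
    rw [amplify_add, add_apply, inner_add_right]
  map_smul' c x := by
    change ⟪η, amplify (c • x.1) ξ⟫_ℂ = _
    rw [amplify_smul, smul_apply, inner_smul_right]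
    rfl

theorem norm_vecFunₗ_le (η ξ : SqSum H) (x : Elt M) : ‖vecFunₗ M η ξ x‖ ≤ ‖η‖ * ‖ξ‖ * ‖x‖ := by
  refine (norm_inner_le_norm (𝕜 := ℂ) η (amplify x.1 ξ)).trans ?_
  have h1 := norm_amplify_apply_le x.1 ξ
  have h2 : ‖x.1‖ = ‖x‖ := rfl
  rw [h2] at h1
  exact (mul_le_mul_of_nonneg_left h1 (norm_nonneg η)).trans_eq (by ring)

theorem le_sWeak : (inferInstance : TopologicalSpace (Elt M)) ≤ sWeak M := by
  rw [sWeak_eq]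
  refine le_iInf fun p => continuous_iff_le_induced.1 ?_
  exact ((vecFunₗ M p.1 p.2).mkContinuous _ (norm_vecFunₗ_le M p.1 p.2)).continuous

noncomputable instance : NormedAddCommGroup (Predual M) := inferInstance

noncomputable instance : NormedSpace ℂ (Predual M) := inferInstance

variable {M} in
/-- A `σ`-weakly continuous linear functional, as an element of the predual. -/
noncomputable def Predual.mk (f : Elt M →ₗ[ℂ] ℂ) (hf : @Continuous _ _ (sWeak M) _ f) :
    Predual M :=
  ⟨⟨f, continuous_le_dom (le_sWeak M) hf⟩, hf⟩

/-- The functional `x ↦ ∑ₙ ⟪ηₙ, x ξₙ⟫` as an element of the predual. -/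
noncomputable def vecFun (η ξ : SqSum H) : Predual M :=
  Predual.mk (vecFunₗ M η ξ) (by
    rw [sWeak_eq]
    exact continuous_iInf_dom (i := (η, ξ)) continuous_induced_dom)

@[simp]
theorem vecFun_apply (η ξ : SqSum H) (x : Elt M) :
    (vecFun M η ξ).1 x = ⟪η, amplify x.1 ξ⟫_ℂ := rfl

theorem norm_vecFun_le (η ξ : SqSum H) : ‖vecFun M η ξ‖ ≤ ‖η‖ * ‖ξ‖ :=
  ContinuousLinearMap.opNorm_le_bound _ (by positivity) (norm_vecFunₗ_le M η ξ)

variable {M} in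
theorem Predual.ext {φ ψ : Predual M} (h : ∀ x, φ.1 x = ψ.1 x) : φ = ψ :=
  Subtype.ext (ContinuousLinearMap.ext h)

variable {M} in
theorem Predual.norm_apply_le (φ : Predual M) (x : Elt M) : ‖φ.1 x‖ ≤ ‖φ‖ * ‖x‖ :=
  φ.1.le_opNorm x

theorem vecFun_add_right (η ξ ξ' : SqSum H) :
    vecFun M η (ξ + ξ') = vecFun M η ξ + vecFun M η ξ' :=
  Predual.ext fun x => by simp

theorem vecFun_smul_right (c : ℂ) (η ξ : SqSum H) : vecFun M η (c • ξ) = c • vecFun M η ξ :=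
  Predual.ext fun x => by simp

/-- A linear functional that is continuous for the initial topology of a family of functionals is a
finite combination of them, so the span needs no closure. -/
theorem Predual.span_vecFun : Submodule.span ℂ (Set.range fun p : SqSum H × SqSum H =>
    vecFun M p.1 p.2) = ⊤ := by
  rw [eq_top_iff]
  intro φ _
  have h1 : @Continuous _ _ (⨅ p : SqSum H × SqSum H,
      TopologicalSpace.induced (vecFunₗ M p.1 p.2) inferInstance) _
      (φ.1 : Elt M →ₗ[ℂ] ℂ) := by
    have := φ.2
    change @Continuous _ _ (sWeak M) _ _ at this
    rw [sWeak_eq] at this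
    exact this
  rw [← LinearMap.mem_span_iff_continuous] at h1
  let q : Predual M →ₗ[ℂ] (Elt M →ₗ[ℂ] ℂ) :=
    (ContinuousLinearMap.coeLM ℂ).comp (Predual M).subtype
  have hq : Function.Injective q := fun a b hab => Predual.ext fun x =>
    congrArg (fun z : Elt M →ₗ[ℂ] ℂ => z x) hab
  have h2 : (Set.range fun p : SqSum H × SqSum H => vecFunₗ M p.1 p.2) =
      q '' Set.range fun p : SqSum H × SqSum H => vecFun M p.1 p.2 := by
    rw [← Set.range_comp]
    rfl
  rw [h2, Submodule.span_image] at h1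
  obtain ⟨ψ, hψ, hψφ⟩ := h1
  rwa [← hq (a₁ := ψ) (a₂ := φ) hψφ]

/-- The functional `x ↦ ⟪h, x k⟫` as an element of the predual. -/
noncomputable def coeffFun (h k : H) : Predual M :=
  vecFun M (lp.single 2 0 h) (lp.single 2 0 k)

@[simp]
theorem coeffFun_apply (h k : H) (x : Elt M) : (coeffFun M h k).1 x = ⟪h, x.1 k⟫_ℂ := by
  rw [coeffFun, vecFun_apply, amplify_single, lp.inner_single_left, lp.single_apply_self]

theorem norm_coeffFun_le (h k : H) : ‖coeffFun M h k‖ ≤ ‖h‖ * ‖k‖ := by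
  refine (norm_vecFun_le M _ _).trans ?_
  rw [lp.norm_single (by norm_num), lp.norm_single (by norm_num)]

theorem vecFun_single_right (η : SqSum H) (n : ℕ) (k : H) :
    vecFun M η (lp.single 2 n k) = coeffFun M (η n) k :=
  Predual.ext fun x => by
    rw [vecFun_apply, coeffFun_apply, amplify_single, lp.inner_single_right]

/-- Every bounded functional on the predual is the evaluation at an element of `M`. -/
theorem exists_eq_eval (F : StrongDual ℂ (Predual M)) : ∃ x : Elt M, ∀ φ, F φ = φ.1 x := by
  -- Evaluating `F` on vector functionals gives a bounded sesquilinear form, which is represented by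
  -- an operator `x`.
  let b : H →ₗ⋆[ℂ] H →ₗ[ℂ] ℂ := LinearMap.mk₂'ₛₗ (starRingEnd ℂ) (RingHom.id ℂ)
    (fun h k => F (coeffFun M h k))
    (fun h h' k => by rw [← map_add]; congr 1; exact Predual.ext fun x => by simp)
    (fun c h k => by
      rw [← map_smul]; congr 1; exact Predual.ext fun x => by simp [mul_comm])
    (fun h k k' => by
      rw [← map_add]; congr 1; exact Predual.ext fun x => by simp)
    (fun c h k => by
      rw [RingHom.id_apply, ← map_smul]; congr 1
      exact Predual.ext fun x => by simp)
  have hb : ∀ h k, ‖b h k‖ ≤ ‖F‖ * ‖h‖ * ‖k‖ := by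
    intro h k
    refine (F.le_opNorm _).trans ?_
    rw [mul_assoc]
    exact mul_le_mul_of_nonneg_left (norm_coeffFun_le M h k) (norm_nonneg _)
  let B := b.mkContinuous₂ ‖F‖ hb
  let x : H →L[ℂ] H := star (InnerProductSpace.continuousLinearMapOfBilin B)
  have hx : ∀ h k, ⟪h, x k⟫_ℂ = F (coeffFun M h k) := by
    intro h k
    rw [inner_star_right, InnerProductSpace.continuousLinearMapOfBilin_apply]
    rfl
  have hxM : x ∈ M := by
    refine mem_of_forall_commutant M fun y hy => ?_
    refine ContinuousLinearMap.ext fun k => ext_inner_left ℂ fun h => ?_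
    change ⟪h, y (x k)⟫_ℂ = ⟪h, x (y k)⟫_ℂ
    rw [← star_inner_left, hx, hx]
    congr 1
    -- An operator `y` in the commutant can be moved across: ⟪y* h, z k⟫ = ⟪h, z (y k)⟫ for `z ∈ M`.
    refine Predual.ext fun z => ?_
    rw [coeffFun_apply, coeffFun_apply, star_inner_left, commutant_comm_apply z.2 hy]
  refine ⟨⟨x, hxM⟩, fun φ => ?_⟩
  have hφ : φ ∈ Submodule.span ℂ (Set.range fun p : SqSum H × SqSum H => vecFun M p.1 p.2) := by
    rw [Predual.span_vecFun]
    trivial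
  induction hφ using Submodule.span_induction with
  | mem φ hφ =>
    obtain ⟨⟨η, ξ⟩, rfl⟩ := hφ
    -- For fixed `η` both sides are continuous in `ξ`, so they need be compared only on vectors with
    -- a single nonzero coordinate.
    let A : SqSum H →L[ℂ] ℂ := F.comp
      (LinearMap.mkContinuous
        ({ toFun := vecFun M η
           map_add' := vecFun_add_right M η
           map_smul' := fun c ξ => vecFun_smul_right M c η ξ } : SqSum H →ₗ[ℂ] Predual M)
        ‖η‖ (norm_vecFun_le M η))
    let A' : SqSum H →L[ℂ] ℂ := (innerSL ℂ η).comp (amplify x)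
    have : A = A' := by
      refine lp.ext_continuousLinearMap (by norm_num) fun n => ContinuousLinearMap.ext fun k => ?_
      change F (vecFun M η (lp.single 2 n k)) = ⟪η, amplify x (lp.single 2 n k)⟫_ℂ
      rw [vecFun_single_right, amplify_single, lp.inner_single_right, hx]
    exact congrArg (fun z : SqSum H →L[ℂ] ℂ => z ξ) this
  | zero => simp
  | add φ ψ _ _ hφ hψ => rw [map_add, hφ, hψ]; rfl
  | smul c φ _ hφ => rw [map_smul, hφ]; rfl

/-- A set of normal functionals that separates the points of `M` has dense linear span. -/
theorem span_dense_of_separating (L : Set (Predual M))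
    (hL : ∀ x : Elt M, (∀ φ ∈ L, φ.1 x = 0) → x = 0) (φ : Predual M) :
    φ ∈ closure (Submodule.span ℂ L : Set (Predual M)) := by
  by_contra hφ
  obtain ⟨f, hf, hfφ⟩ := exists_dual_vanishing hφ
  obtain ⟨x, hx⟩ := exists_eq_eval M f
  refine hfφ ?_
  rw [hx, hL x fun ψ hψ => ?_, map_zero]
  rw [← hx, hf ψ hψ]

/-- Evaluation at an element of `M`, as a linear map on the predual. -/
noncomputable def evaluation (x : Elt M) : Predual M →ₗ[ℂ] ℂ where
  toFun φ := φ.1 x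
  map_add' _ _ := rfl
  map_smul' _ _ := rfl

theorem generates_of_unitBall_le {S : Set (H →L[ℂ] H)} (hS : S ⊆ M)
    (h : ∀ N : VonNeumannAlgebra H, S ⊆ N → ∀ x : UnitBall M, x.1.1 ∈ N) : Generates M S := by
  refine ⟨hS, fun N hN x hx => ?_⟩
  by_cases hx0 : x = 0
  · rw [hx0]
    exact zero_mem N
  · have hn : ‖x‖ ≠ 0 := norm_ne_zero_iff.2 hx0
    have h1 : ‖((‖x‖ : ℂ)⁻¹ • x : H →L[ℂ] H)‖ ≤ 1 := by
      rw [norm_smul, norm_inv, Complex.norm_real, norm_norm, inv_mul_cancel₀ hn]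
    have h2 := smul_mem' (‖x‖ : ℂ) (h N hN ⟨⟨(‖x‖ : ℂ)⁻¹ • x, smul_mem' _ hx⟩, h1⟩)
    rwa [smul_smul, mul_inv_cancel₀ (by exact_mod_cast hn), one_smul] at h2

/-- If a set of normal functionals has dense linear span, then its cardinality bounds the number
of generators. -/
theorem gen_le_of_dense_span (L : Set (Predual M))
    (hL : ∀ φ : Predual M, φ ∈ closure (Submodule.span ℂ L : Set (Predual M))) :
    gen M ≤ max ℵ₀ #L := by
  obtain ⟨C, hC, hCd⟩ := TopologicalSpace.exists_countable_dense ℂ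
  obtain ⟨s, hs, hsd⟩ := exists_approx_of_maps (J := L) (D := ULift.{u} C)
    (fun l (x : UnitBall M) => l.1.1 x.1) (fun c => c.down.1)
    (fun j x => by
      have : Set.range (fun c : ULift.{u} C => c.down.1) = C := by
        ext c
        exact ⟨fun ⟨d, hd⟩ => hd ▸ d.down.2, fun hc => ⟨⟨⟨c, hc⟩⟩, rfl⟩⟩
      rw [this]
      exact hCd _) (κ := max ℵ₀ #L) (le_max_left _ _) (le_max_right _ _)
    (by
      rw [mk_uLift]
      exact (lift_le_aleph0.2 hC.le_aleph0).trans (le_max_left _ _))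
  -- The unit is included to keep the set nonempty, as `Generates.gen_le` requires.
  let S : Set (H →L[ℂ] H) := insert 1 ((fun x : UnitBall M => x.1.1) '' s)
  have hSM : S ⊆ M := by
    rintro _ (rfl | ⟨x, -, rfl⟩)
    · exact one_mem M
    · exact x.1.2
  have hG : Generates M S := by
    refine generates_of_unitBall_le M hSM fun N hN x => ?_
    refine mem_of_forall_approx N fun h k h' k' ε hε => ?_
    classical
    obtain ⟨F, δ, hδ, hF⟩ := exists_finset_bound (F := ℂ) (hL (coeffFun M h k)) two_pos hε
    obtain ⟨F', δ', hδ', hF'⟩ := exists_finset_bound (F := ℂ) (hL (coeffFun M h' k')) two_pos hε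
    obtain ⟨y, hy, hyF⟩ := hsd x (F ∪ F') (min δ δ') (lt_min hδ hδ')
    refine ⟨y.1.1, hN (Or.inr ⟨y, hy, rfl⟩), ?_⟩
    -- Differences of elements of the unit ball have norm at most 2; this uniform bound carries the
    -- approximation from `L` to its closed span.
    have hn : ∀ φ : Predual M, ‖evaluation M (y.1 - x.1) φ‖ ≤ 2 * ‖φ‖ := fun φ =>
      (Predual.norm_apply_le φ _).trans ((mul_le_mul_of_nonneg_left ((norm_sub_le _ _).trans
        (add_le_add y.2 x.2)) (norm_nonneg φ)).trans_eq (by ring))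
    have h3 := hF (evaluation M (y.1 - x.1)) hn fun l hl => by
      rw [evaluation, LinearMap.coe_mk, AddHom.coe_mk, map_sub, ← dist_eq_norm]
      exact (hyF l (Finset.mem_union_left _ hl)).trans_le (min_le_left _ _)
    have h4 := hF' (evaluation M (y.1 - x.1)) hn fun l hl => by
      rw [evaluation, LinearMap.coe_mk, AddHom.coe_mk, map_sub, ← dist_eq_norm]
      exact (hyF l (Finset.mem_union_right _ hl)).trans_le (min_le_right _ _)
    rw [evaluation, LinearMap.coe_mk, AddHom.coe_mk, coeffFun_apply] at h3 h4
    exact ⟨h3, h4⟩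
  refine (hG.gen_le ?_).trans (mk_insert_le.trans ?_)
  · rw [Cardinal.one_le_iff_ne_zero, mk_ne_zero_iff]
    exact ⟨⟨1, Or.inl rfl⟩⟩
  · exact (add_le_add (mk_image_le.trans hs) (one_le_aleph0.trans (le_max_left _ _))).trans
      (add_eq_self (le_max_left _ _)).le

end Predual

/-! ### Restriction to invariant subspaces and reduction -/

section Restriction

variable {H : Type u} [NormedAddCommGroup H] [InnerProductSpace ℂ H] [CompleteSpace H]

/-- The restriction of an operator to an invariant subspace. -/
noncomputable def restrictOp (K : Submodule ℂ H) (x : H →L[ℂ] H) (h : ∀ k ∈ K, x k ∈ K) :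
    K →L[ℂ] K :=
  (x.comp K.subtypeL).codRestrict K fun k => h k k.2

omit [CompleteSpace H] in
@[simp]
theorem coe_restrictOp_apply (K : Submodule ℂ H) (x : H →L[ℂ] H) (h : ∀ k ∈ K, x k ∈ K) (k : K) :
    (restrictOp K x h k : H) = x k := rfl

omit [CompleteSpace H] in
theorem norm_restrictOp_le (K : Submodule ℂ H) (x : H →L[ℂ] H) (h : ∀ k ∈ K, x k ∈ K) :
    ‖restrictOp K x h‖ ≤ ‖x‖ :=
  ContinuousLinearMap.opNorm_le_bound _ (norm_nonneg _) fun k => x.le_opNorm k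

theorem star_restrictOp (K : Submodule ℂ H) [CompleteSpace K] (x : H →L[ℂ] H)
    (h : ∀ k ∈ K, x k ∈ K) (h' : ∀ k ∈ K, star x k ∈ K) :
    star (restrictOp K x h) = restrictOp K (star x) h' := by
  refine ContinuousLinearMap.ext fun k => ext_inner_left ℂ fun l => ?_
  rw [inner_star_right, Submodule.coe_inner, Submodule.coe_inner]
  exact (inner_star_right x _ _).symm

variable (M : VonNeumannAlgebra H)

/-- The representation of `M` on an invariant subspace. -/
noncomputable def restrictRep (K : Submodule ℂ H) [CompleteSpace K]
    (hK : ∀ x ∈ M, ∀ k ∈ K, x k ∈ K) : Elt M →⋆ₐ[ℂ] (K →L[ℂ] K) where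
  toFun x := restrictOp K x.1 (hK x.1 x.2)
  map_one' := by ext; rfl
  map_mul' x y := by ext; rfl
  map_zero' := by ext; rfl
  map_add' x y := by ext; rfl
  commutes' c := by ext; rfl
  map_star' x := (star_restrictOp K x.1 _ (hK _ (star_mem x.2))).symm

/-- The inclusion of `ℓ²(ℕ, K)` into `ℓ²(ℕ, H)`. -/
noncomputable def inclSqSum (K : Submodule ℂ H) : SqSum K →L[ℂ] SqSum H :=
  lp.mapCLM 2 (fun _ : ℕ => K.subtypeL) (norm_nonneg K.subtypeL) (fun _ => le_rfl)

variable {M} in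
-- An element of `M` that vanishes on `K` vanishes on the images of `K` under the commutant, and
-- these are total.
theorem eq_zero_of_total {K : Submodule ℂ H}
    (ht : ∀ h : H, (∀ y ∈ M.commutant, ∀ k ∈ K, ⟪y k, h⟫_ℂ = 0) → h = 0) {x : H →L[ℂ] H}
    (hx : x ∈ M) (hxK : ∀ k ∈ K, x k = 0) : x = 0 := by
  rw [← star_eq_zero]
  refine ContinuousLinearMap.ext fun v => ht _ fun y hy k hk => ?_
  rw [inner_star_right, commutant_comm_apply hx hy, hxK k hk, map_zero, inner_zero_left]

theorem isFaithfulNormalRep_restrictRep (K : Submodule ℂ H) [CompleteSpace K]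
    (hK : ∀ x ∈ M, ∀ k ∈ K, x k ∈ K) (ht : ∀ x ∈ M, (∀ k ∈ K, x k = 0) → x = 0) :
    IsFaithfulNormalRep M (restrictRep M K hK) := by
  constructor
  · rw [injective_iff_map_eq_zero]
    intro x hx
    exact Subtype.ext (ht x.1 x.2 fun k hk =>
      congrArg (fun z : K →L[ℂ] K => (z ⟨k, hk⟩ : H)) hx)
  · rw [sWeak_eq]
    refine continuous_iInf_rng.2 fun p => continuous_induced_rng.2 ?_
    refine continuous_iInf_dom (i := (inclSqSum K p.1, inclSqSum K p.2)) ?_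
    have : (fun x => ⟪p.1, amplify x p.2⟫_ℂ) ∘ restrictRep M K hK =
        fun x : Elt M => ⟪inclSqSum K p.1, amplify x.1 (inclSqSum K p.2)⟫_ℂ := by
      ext x
      exact (lp.inner_eq_tsum _ _).trans (lp.inner_eq_tsum _ _).symm
    rw [this]
    exact continuous_induced_dom

theorem repDensity_le_hilbertDim (K : Submodule ℂ H) [CompleteSpace K]
    (hK : ∀ x ∈ M, ∀ k ∈ K, x k ∈ K) (ht : ∀ x ∈ M, (∀ k ∈ K, x k = 0) → x = 0) :
    repDensity M ≤ hilbertDim K :=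
  csInf_le' ⟨K, _, _, _, _, isFaithfulNormalRep_restrictRep M K hK ht, rfl⟩

theorem exists_rep_hilbertDim_eq : ∃ (K : Type u) (_ : NormedAddCommGroup K)
    (_ : InnerProductSpace ℂ K) (_ : CompleteSpace K) (π : Elt M →⋆ₐ[ℂ] (K →L[ℂ] K)),
      IsFaithfulNormalRep M π ∧ hilbertDim K = repDensity M := by
  have : CompleteSpace (⊤ : Submodule ℂ H) := isClosed_univ.completeSpace_coe
  refine csInf_mem (s := {c | ∃ (K : Type u) (_ : NormedAddCommGroup K)
    (_ : InnerProductSpace ℂ K) (_ : CompleteSpace K) (π : Elt M →⋆ₐ[ℂ] (K →L[ℂ] K)),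
      IsFaithfulNormalRep M π ∧ hilbertDim K = c}) ⟨_, (⊤ : Submodule ℂ H), _, _, this, _,
      isFaithfulNormalRep_restrictRep M ⊤ (fun _ _ _ _ => trivial)
      (fun x _ hx => ContinuousLinearMap.ext fun k => hx k trivial), rfl⟩

variable {M} {S : Set (H →L[ℂ] H)}

theorem Generates.starProjection_mem_commutant (hS : Generates M S) (K : Submodule ℂ H)
    [K.HasOrthogonalProjection] (h : ∀ w ∈ words S, ∀ k ∈ K, w k ∈ K) :
    K.starProjection ∈ M.commutant :=
  hS.mem_commutant fun w hw =>
    starProjection_comm_of_invariant K w (h w hw) (h _ (star_mem_words hw))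

theorem starProjection_mem (K : Submodule ℂ H) [K.HasOrthogonalProjection]
    (h : ∀ y ∈ M.commutant, ∀ k ∈ K, y k ∈ K) : K.starProjection ∈ M :=
  mem_of_forall_commutant M fun y hy =>
    starProjection_comm_of_invariant K y (h y hy) (h _ (star_mem hy))

theorem Generates.invariant (hS : Generates M S) (K : Submodule ℂ H)
    [K.HasOrthogonalProjection] (h : ∀ w ∈ words S, ∀ k ∈ K, w k ∈ K) {x : H →L[ℂ] H}
    (hx : x ∈ M) {k : H} (hk : k ∈ K) : x k ∈ K := by
  have h1 := commutant_comm_apply hx (hS.starProjection_mem_commutant K h) k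
  rw [Submodule.starProjection_eq_self_iff.2 hk] at h1
  rw [h1]
  exact Submodule.starProjection_apply_mem _ _

instance (T : Set H) : CompleteSpace (Submodule.span ℂ T).topologicalClosure :=
  (Submodule.isClosed_topologicalClosure _).completeSpace_coe

theorem Generates.span_invariant (hS : Generates M S) {T : Set H}
    (hT : ∀ w ∈ words S, ∀ t ∈ T, w t ∈ T) {x : H →L[ℂ] H} (hx : x ∈ M) {k : H}
    (hk : k ∈ (Submodule.span ℂ T).topologicalClosure) :
    x k ∈ (Submodule.span ℂ T).topologicalClosure :=
  hS.invariant _ (fun w hw _ hk => map_mem_of_mem_closure_span w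
    (Submodule.isClosed_topologicalClosure _) (fun t ht => Submodule.le_topologicalClosure _
      (Submodule.subset_span (hT w hw t ht))) hk) hx hk

/-- The reduction of a von Neumann algebra to a subspace that is invariant under the algebra
and its commutant. -/
noncomputable def reduced (M : VonNeumannAlgebra H) (K : Submodule ℂ H) [CompleteSpace K] :
    VonNeumannAlgebra K :=
  ofCentralizer {t | ∃ y ∈ M.commutant, ∀ k, (t k : H) = y k}

/-- As `reduced` is defined by commutation with the restrictions of the commutant, it has to be
identified with the restrictions of `M`. This is one inclusion; `extendOp_mem` gives the other. -/
theorem restrictOp_mem_reduced (K : Submodule ℂ H) [CompleteSpace K] {x : H →L[ℂ] H}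
    (hx : x ∈ M) (h : ∀ k ∈ K, x k ∈ K) (h' : ∀ k ∈ K, star x k ∈ K) :
    restrictOp K x h ∈ reduced M K := by
  refine mem_ofCentralizer.2 fun t ⟨y, hy, ht⟩ => ⟨?_, ?_⟩
  · ext k
    change (t _ : H) = x (t k)
    rw [ht, ht]
    exact (commutant_comm_apply hx hy k).symm
  · rw [← star_star (restrictOp K x h), ← star_mul, ← star_mul, star_restrictOp K x h h']
    congr 1
    ext k
    change star x (t k) = (t _ : H)
    rw [ht, ht]
    exact commutant_comm_apply (star_mem hx) hy k

theorem restrictOp_mem_commutant_reduced (K : Submodule ℂ H) [CompleteSpace K] {y : H →L[ℂ] H}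
    (hy : y ∈ M.commutant) (h : ∀ k ∈ K, y k ∈ K) :
    restrictOp K y h ∈ (reduced M K).commutant :=
  VonNeumannAlgebra.mem_commutant_iff.2 fun _ ht =>
    ((mem_ofCentralizer.1 ht) _ ⟨y, hy, fun _ => rfl⟩).1.symm

/-- The extension of an operator on a closed subspace by zero on the orthogonal complement. -/
noncomputable def extendOp (K : Submodule ℂ H) [CompleteSpace K] (t : K →L[ℂ] K) : H →L[ℂ] H :=
  K.subtypeL.comp (t.comp K.orthogonalProjectionOnto)

omit [CompleteSpace H] in
theorem extendOp_apply_coe (K : Submodule ℂ H) [CompleteSpace K] (t : K →L[ℂ] K) (k : K) :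
    extendOp K t k = t k := by
  simp [extendOp]

omit [CompleteSpace H] in
theorem norm_extendOp_le (K : Submodule ℂ H) [CompleteSpace K] (t : K →L[ℂ] K) :
    ‖extendOp K t‖ ≤ ‖t‖ := by
  refine ContinuousLinearMap.opNorm_le_bound _ (norm_nonneg t) fun h => ?_
  refine (t.le_opNorm _).trans ?_
  gcongr
  exact K.norm_orthogonalProjectionOnto_apply_le h

theorem extendOp_mem (K : Submodule ℂ H) [CompleteSpace K]
    (hK : ∀ y ∈ M.commutant, ∀ k ∈ K, y k ∈ K) {t : K →L[ℂ] K} (ht : t ∈ reduced M K) :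
    extendOp K t ∈ M := by
  refine mem_of_forall_commutant M fun y hy => ContinuousLinearMap.ext fun h => ?_
  have h1 := congrArg (fun z : H →L[ℂ] H => z h)
    (starProjection_comm_of_invariant K y (hK y hy) (hK _ (star_mem hy)))
  have h2 : K.orthogonalProjectionOnto (y h) =
      restrictOp K y (hK y hy) (K.orthogonalProjectionOnto h) := Subtype.ext h1.symm
  have h3 := congrArg (fun z : K →L[ℂ] K => (z (K.orthogonalProjectionOnto h) : H))
    (commutant_comm ht (restrictOp_mem_commutant_reduced K hy (hK y hy)))
  change y (t (K.orthogonalProjectionOnto h)) = t (K.orthogonalProjectionOnto (y h))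
  rw [h2]
  exact h3.symm

end Restriction

/-! ### Orthogonal decomposition into cyclic blocks -/

section Cyclic

variable {H : Type u} [NormedAddCommGroup H] [InnerProductSpace ℂ H] [CompleteSpace H]

/-- The closed subspace generated by a vector under words in `S` and the commutant of `M`. If `S`
generates `M`, its projection is the central support of the cyclic projection of `ξ`. -/
def cyclicSpace (M : VonNeumannAlgebra H) (S : Set (H →L[ℂ] H)) (ξ : H) : Submodule ℂ H :=
  (Submodule.span ℂ {v | ∃ y ∈ M.commutant, ∃ w ∈ words S, v = y (w ξ)}).topologicalClosure

variable {M : VonNeumannAlgebra H} {S : Set (H →L[ℂ] H)}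

theorem isClosed_cyclicSpace (ξ : H) : IsClosed (cyclicSpace M S ξ : Set H) :=
  Submodule.isClosed_topologicalClosure _

instance (ξ : H) : CompleteSpace (cyclicSpace M S ξ) :=
  (isClosed_cyclicSpace ξ).completeSpace_coe

theorem mem_cyclicSpace {ξ : H} {y w : H →L[ℂ] H} (hy : y ∈ M.commutant) (hw : w ∈ words S) :
    y (w ξ) ∈ cyclicSpace M S ξ :=
  Submodule.le_topologicalClosure _ (Submodule.subset_span ⟨y, hy, w, hw, rfl⟩)

theorem word_mem_cyclicSpace {ξ : H} {w : H →L[ℂ] H} (hw : w ∈ words S) :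
    w ξ ∈ cyclicSpace M S ξ :=
  mem_cyclicSpace (one_mem M.commutant) hw

theorem self_mem_cyclicSpace (ξ : H) : ξ ∈ cyclicSpace M S ξ :=
  word_mem_cyclicSpace (one_mem (words S))

theorem cyclicSpace_invariant_commutant {ξ : H} {y : H →L[ℂ] H} (hy : y ∈ M.commutant) {k : H}
    (hk : k ∈ cyclicSpace M S ξ) : y k ∈ cyclicSpace M S ξ := by
  refine map_mem_of_mem_closure_span y (isClosed_cyclicSpace ξ) ?_ hk
  rintro _ ⟨y', hy', w, hw, rfl⟩
  exact mem_cyclicSpace (mul_mem hy hy') hw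

theorem Generates.cyclicSpace_invariant (hS : Generates M S) {ξ : H} {x : H →L[ℂ] H}
    (hx : x ∈ M) {k : H} (hk : k ∈ cyclicSpace M S ξ) : x k ∈ cyclicSpace M S ξ := by
  refine hS.span_invariant ?_ hx hk
  rintro w hw _ ⟨y, hy, w', hw', rfl⟩
  exact ⟨y, hy, w * w', mul_mem hw hw', commutant_comm_apply (words_le hS.1 hw) hy _⟩

theorem starProjection_cyclicSpace_mem (ξ : H) : (cyclicSpace M S ξ).starProjection ∈ M :=
  starProjection_mem _ fun _ hy _ hk => cyclicSpace_invariant_commutant hy hk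

theorem Generates.starProjection_cyclicSpace_mem_center (hS : Generates M S) (ξ : H) :
    (cyclicSpace M S ξ).starProjection ∈ center M :=
  ⟨starProjection_cyclicSpace_mem ξ, hS.starProjection_mem_commutant _ fun _ hw _ hk =>
    hS.cyclicSpace_invariant (words_le hS.1 hw) hk⟩

theorem Generates.isOrtho_cyclicSpace (hS : Generates M S) {ξ ξ' : H}
    (h : ∀ k ∈ cyclicSpace M S ξ, ⟪k, ξ'⟫_ℂ = 0) :
    cyclicSpace M S ξ ⟂ cyclicSpace M S ξ' := by
  rw [Submodule.isOrtho_comm, Submodule.IsOrtho]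
  refine Submodule.topologicalClosure_minimal _ (Submodule.span_le.2 ?_)
    (Submodule.isClosed_orthogonal _)
  rintro _ ⟨y, hy, w, hw, rfl⟩
  rw [SetLike.mem_coe, Submodule.mem_orthogonal]
  intro k hk
  rw [← star_inner_left, ← star_inner_left]
  exact h _ (hS.cyclicSpace_invariant (words_le hS.1 (star_mem_words hw))
    (cyclicSpace_invariant_commutant (star_mem hy) hk))

/-- A maximal set of nonzero vectors that generate pairwise orthogonal subspaces. -/
structure IsCyclicDecomposition (M : VonNeumannAlgebra H) (S : Set (H →L[ℂ] H)) (V : Set H) :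
    Prop where
  ne_zero : ∀ ξ ∈ V, ξ ≠ 0
  ortho : V.Pairwise fun ξ ξ' => cyclicSpace M S ξ ⟂ cyclicSpace M S ξ'
  total : ∀ h : H, (∀ ξ ∈ V, ∀ k ∈ cyclicSpace M S ξ, ⟪k, h⟫_ℂ = 0) → h = 0

/-- Zorn's lemma: a nonzero vector orthogonal to all the blocks generates a block orthogonal to
them, so it could be added. -/
theorem Generates.exists_isCyclicDecomposition (hS : Generates M S) :
    ∃ V, IsCyclicDecomposition M S V := by
  obtain ⟨V, hV⟩ := zorn_subset {V : Set H | (∀ ξ ∈ V, ξ ≠ 0) ∧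
    V.Pairwise fun ξ ξ' => cyclicSpace M S ξ ⟂ cyclicSpace M S ξ'} (by
      intro c hc hchain
      refine ⟨⋃₀ c, ⟨?_, ?_⟩, fun s hs => Set.subset_sUnion_of_mem hs⟩
      · rintro ξ ⟨s, hs, hξ⟩
        exact (hc hs).1 ξ hξ
      · exact (Set.pairwise_sUnion hchain.directedOn).2 fun s hs => (hc hs).2)
  refine ⟨V, hV.prop.1, hV.prop.2, fun h hh => ?_⟩
  by_contra h0
  have h1 : insert h V ∈ {V : Set H | (∀ ξ ∈ V, ξ ≠ 0) ∧
      V.Pairwise fun ξ ξ' => cyclicSpace M S ξ ⟂ cyclicSpace M S ξ'} := by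
    refine ⟨?_, ?_⟩
    · rintro ξ (rfl | hξ)
      · exact h0
      · exact hV.prop.1 ξ hξ
    · refine hV.prop.2.insert fun ξ hξ _ => ?_
      have := hS.isOrtho_cyclicSpace (hh ξ hξ)
      exact ⟨this.symm, this⟩
  have h2 : h ∈ V := hV.le_of_ge h1 (Set.subset_insert _ _) (Set.mem_insert _ _)
  exact h0 (inner_self_eq_zero.1 (hh h h2 h (self_mem_cyclicSpace h)))

end Cyclic

/-! ### Cardinal bounds and the direct sum -/

variable {H : Type u} [NormedAddCommGroup H] [InnerProductSpace ℂ H] [CompleteSpace H]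
  {M : VonNeumannAlgebra H} {S : Set (H →L[ℂ] H)} {V : Set H}

theorem IsOrthoFamily.mk_le_dec {P : Set (H →L[ℂ] H)} (hP : IsOrthoFamily M P) : #P ≤ dec M :=
  le_ciSup (f := fun S : {S : Set (H →L[ℂ] H) // IsOrthoFamily M S} => #S.1) bddAbove_of_small
    ⟨P, hP⟩

theorem mk_le_dec {ι : Type u} (p : ι → H →L[ℂ] H) (hpM : ∀ i, p i ∈ M)
    (hp : ∀ i, IsStarProjection (p i)) (hp0 : ∀ i, p i ≠ 0)
    (hpp : ∀ i j, i ≠ j → p i * p j = 0) : #ι ≤ dec M := by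
  have hinj : Function.Injective p := by
    intro i j h
    by_contra hne
    have h1 := hpp i j hne
    rw [← h, (hp i).isIdempotentElem.eq] at h1
    exact hp0 i h1
  rw [← mk_range_eq p hinj]
  refine IsOrthoFamily.mk_le_dec ⟨?_, ?_⟩
  · rintro _ ⟨i, rfl⟩
    exact ⟨hpM i, hp i, hp0 i⟩
  · rintro _ ⟨i, rfl⟩ _ ⟨j, rfl⟩ hne
    exact hpp i j fun h => hne (h ▸ rfl)

theorem mk_words_le_of_mk_le {κ : Cardinal.{u}} (hκ : ℵ₀ ≤ κ) (hSκ : #S ≤ κ) : #(words S) ≤ κ :=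
  (mk_words_le S).trans (max_le hκ hSκ)

namespace IsCyclicDecomposition

theorem mk_le_dec_center (hV : IsCyclicDecomposition M S V) (hS : Generates M S) :
    #V ≤ dec (center M) := by
  refine mk_le_dec (fun ξ : V => (cyclicSpace M S ξ.1).starProjection)
    (fun ξ => hS.starProjection_cyclicSpace_mem_center ξ.1)
    (fun _ => isStarProjection_starProjection) (fun ξ h => hV.ne_zero _ ξ.2 ?_) fun ξ ξ' hne =>
      (hV.ortho ξ.2 ξ'.2 fun h => hne (Subtype.ext h)).starProjection_comp_starProjection
  rw [← Submodule.starProjection_eq_self_iff.2 (self_mem_cyclicSpace (M := M) (S := S) ξ.1), h]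
  rfl

/-- If the vector states of `ξ` and `ξ'` agreed on the words, they would agree on `M` by the double
commutant theorem. But the projection onto the block of `ξ` fixes `ξ` and kills `ξ'`. So `V` injects
into the functions from words to ℂ, of which there are at most 𝔠^κ = 2^κ. -/
theorem mk_le_two_power (hV : IsCyclicDecomposition M S V) (hS : Generates M S)
    {κ : Cardinal.{u}} (hκ : ℵ₀ ≤ κ) (hSκ : #S ≤ κ) : #V ≤ 2 ^ κ := by
  let f : V → words S → ℂ := fun ξ w => ⟪ξ.1, w.1 ξ.1⟫_ℂ
  have hf : Function.Injective f := by
    intro ξ ξ' h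
    by_contra hne
    have hzM : (cyclicSpace M S ξ.1).starProjection ∈ M := starProjection_cyclicSpace_mem ξ.1
    set z := (cyclicSpace M S ξ.1).starProjection
    have h1 := hS.amplify_mem_closure hzM (lp.single 2 0 ξ.1 + lp.single 2 1 ξ'.1)
    -- Pairing the amplification at (ξ, ξ') with (ξ, -ξ') turns the difference of the two states
    -- into one continuous functional.
    have key : ∀ x : H →L[ℂ] H, ⟪(lp.single 2 0 ξ.1 - lp.single 2 1 ξ'.1 : SqSum H),
        amplify x (lp.single 2 0 ξ.1 + lp.single 2 1 ξ'.1)⟫_ℂ =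
        ⟪ξ.1, x ξ.1⟫_ℂ - ⟪ξ'.1, x ξ'.1⟫_ℂ := by
      intro x
      rw [map_add, amplify_single, amplify_single, inner_sub_left, inner_add_right,
        inner_add_right]
      simp only [lp.inner_single_left, lp.single_apply_self]
      rw [lp.single_apply_ne (hij := by norm_num), lp.single_apply_ne (hij := by norm_num)]
      simp
    have h2 := map_mem_of_mem_closure_span (U := (⊥ : Submodule ℂ ℂ))
      (innerSL ℂ (lp.single 2 0 ξ.1 - lp.single 2 1 ξ'.1 : SqSum H)) (by simp) (by
        rintro _ ⟨w, hw, rfl⟩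
        rw [innerSL_apply_apply, key, Submodule.mem_bot, sub_eq_zero]
        exact congrFun h ⟨w, hw⟩) h1
    rw [innerSL_apply_apply, key, Submodule.mem_bot] at h2
    have h3 : z ξ.1 = ξ.1 := Submodule.starProjection_eq_self_iff.2 (self_mem_cyclicSpace ξ.1)
    have h4 : ⟪ξ'.1, z ξ'.1⟫_ℂ = 0 :=
      (hV.ortho ξ.2 ξ'.2 fun h => hne (Subtype.ext h)).symm.inner_eq
        (self_mem_cyclicSpace ξ'.1) (Submodule.starProjection_apply_mem _ _)
    rw [h3, h4, sub_zero, inner_self_eq_zero] at h2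
    exact hV.ne_zero _ ξ.2 h2
  refine (mk_le_of_injective hf).trans ?_
  rw [mk_arrow, mk_complex, lift_continuum, lift_uzero, ← two_power_aleph0, ← power_mul]
  refine power_le_power_left two_ne_zero ?_
  exact (mul_le_mul' hκ (mk_words_le_of_mk_le hκ hSκ)).trans (mul_eq_self hκ).le

/-- The vectors `w ξ` span an `M`-invariant space. The commutant moves it onto a total set, so `M`
is faithful on it. -/
theorem repDensity_le [Nontrivial H] (hV : IsCyclicDecomposition M S V) (hS : Generates M S)
    {κ : Cardinal.{u}} (hκ : ℵ₀ ≤ κ) (hSκ : #S ≤ κ) : repDensity M ≤ #V * κ := by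
  let T : Set H := Set.range fun p : V × words S => p.2.1 p.1.1
  have hT : ∀ w ∈ words S, ∀ t ∈ T, w t ∈ T := by
    rintro w hw _ ⟨⟨ξ, w'⟩, rfl⟩
    exact ⟨⟨ξ, ⟨w * w', mul_mem hw w'.2⟩⟩, rfl⟩
  have h1 := repDensity_le_hilbertDim M (Submodule.span ℂ T).topologicalClosure
    (fun x hx k hk => hS.span_invariant hT hx hk) fun x => eq_zero_of_total fun h hh =>
      hV.total h fun ξ hξ k hk => by
      rw [← inner_conj_symm, ← innerSL_apply_apply]
      have := map_mem_of_mem_closure_span (U := (⊥ : Submodule ℂ ℂ)) (innerSL ℂ h) (by simp) (by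
        rintro _ ⟨y, hy, w, hw, rfl⟩
        rw [innerSL_apply_apply, Submodule.mem_bot, ← inner_conj_symm, hh y hy (w ξ)
          (Submodule.le_topologicalClosure _
            (Submodule.subset_span ⟨⟨⟨ξ, hξ⟩, ⟨w, hw⟩⟩, rfl⟩)), map_zero]) hk
      rw [(Submodule.mem_bot ℂ).1 this, map_zero]
  refine h1.trans ((hilbertDim_le_of_isometry (Submodule.subtypeₗᵢ _) T fun x => x.2).trans ?_)
  have hT2 : #T ≤ #V * κ := by
    refine mk_range_le.trans ?_
    rw [mk_prod, lift_id, lift_id]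
    exact mul_le_mul_right (mk_words_le_of_mk_le hκ hSκ) _
  by_cases hne : #V = 0
  · obtain ⟨h, h0⟩ := exists_ne (0 : H)
    exact (h0 (hV.total h fun ξ hξ => ((mk_eq_zero_iff.1 hne).false ⟨ξ, hξ⟩).elim)).elim
  · refine max_le (hκ.trans ?_) hT2
    exact le_mul_of_one_le_left' (Cardinal.one_le_iff_ne_zero.2 hne)

theorem repDensity_reduced_le (hS : Generates M S)
    {κ : Cardinal.{u}} (hκ : ℵ₀ ≤ κ) (hSκ : #S ≤ κ) (ξ : H) :
    repDensity (reduced M (cyclicSpace M S ξ)) ≤ κ := by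
  let T : Set H := Set.range fun w : words S => w.1 ξ
  have hT : ∀ w ∈ words S, ∀ t ∈ T, w t ∈ T := by
    rintro w hw _ ⟨w', rfl⟩
    exact ⟨⟨w * w', mul_mem hw w'.2⟩, rfl⟩
  let C := cyclicSpace M S ξ
  let K : Submodule ℂ C := (Submodule.span ℂ T).topologicalClosure.comap C.subtype
  have hK : IsClosed (K : Set C) :=
    (Submodule.isClosed_topologicalClosure _).preimage continuous_subtype_val
  have : CompleteSpace K := hK.completeSpace_coe
  have h1 := repDensity_le_hilbertDim (reduced M C) K (fun t ht k hk => by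
      have h2 := hS.span_invariant hT
        (extendOp_mem C (fun y hy k hk => cyclicSpace_invariant_commutant hy hk) ht) hk
      rw [Submodule.subtype_apply, extendOp_apply_coe] at h2
      exact h2) fun x => eq_zero_of_total fun h hh => by
    refine Subtype.ext (inner_self_eq_zero (𝕜 := ℂ).1 ?_)
    have := map_mem_of_mem_closure_span (U := (⊥ : Submodule ℂ ℂ)) (innerSL ℂ (h : H)) (by simp) (by
      rintro _ ⟨y, hy, w, hw, rfl⟩
      have h3 := hh _ (restrictOp_mem_commutant_reduced C hy
        (fun k hk => cyclicSpace_invariant_commutant hy hk)) ⟨w ξ, word_mem_cyclicSpace hw⟩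
        (Submodule.le_topologicalClosure _ (Submodule.subset_span ⟨⟨w, hw⟩, rfl⟩))
      rw [Submodule.coe_inner, coe_restrictOp_apply] at h3
      rw [innerSL_apply_apply, Submodule.mem_bot, ← inner_conj_symm, h3, map_zero]) h.2
    exact this
  refine h1.trans ((hilbertDim_le_of_isometry (C.subtypeₗᵢ.comp K.subtypeₗᵢ) T fun x => x.2).trans
    (max_le hκ (mk_range_le.trans (mk_words_le_of_mk_le hκ hSκ))))

/-- The direct sum of a bounded family of operators. -/
theorem exists_sum (hV : IsCyclicDecomposition M S V) (hS : Generates M S)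
    (y : V → H →L[ℂ] H) (hy : ∀ ξ, y ξ ∈ M) {C : ℝ} (hC : 0 ≤ C) (hyC : ∀ ξ, ‖y ξ‖ ≤ C) :
    ∃ x ∈ M, ‖x‖ ≤ C ∧ ∀ ξ : V, ∀ k ∈ cyclicSpace M S ξ.1, x k = y ξ k := by
  classical
  have hO : OrthogonalFamily ℂ (fun ξ : V => cyclicSpace M S ξ.1)
      fun ξ => (cyclicSpace M S ξ.1).subtypeₗᵢ := by
    intro ξ ξ' hne a b
    exact (hV.ortho ξ.2 ξ'.2 fun h => hne (Subtype.ext h)).inner_eq a.2 b.2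
  have htop : (⨆ ξ : V, cyclicSpace M S ξ.1).topologicalClosure = ⊤ := by
    rw [Submodule.topologicalClosure_eq_top_iff, Submodule.eq_bot_iff]
    intro h hh
    refine hV.total h fun ξ hξ k hk => ?_
    exact (Submodule.mem_orthogonal _ _).1 hh k
      (Submodule.mem_iSup_of_mem (p := fun ξ : V => cyclicSpace M S ξ.1) ⟨ξ, hξ⟩ hk)
  have hH := IsHilbertSum.mkInternal _ hO htop.ge
  let U := hH.linearIsometryEquiv
  have hinv : ∀ ξ : V, ∀ k ∈ cyclicSpace M S ξ.1, y ξ k ∈ cyclicSpace M S ξ.1 :=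
    fun ξ k hk => hS.cyclicSpace_invariant (hy ξ) hk
  -- In the Hilbert sum of the blocks the required operator is diagonal.
  let D := lp.mapCLM 2 (fun ξ : V => restrictOp (cyclicSpace M S ξ.1) (y ξ) (hinv ξ)) hC
    fun ξ => (norm_restrictOp_le _ _ _).trans (hyC ξ)
  let x : H →L[ℂ] H := (U.symm : _ →L[ℂ] H).comp (D.comp (U : H →L[ℂ] _))
  have hx : ∀ ξ : V, ∀ k ∈ cyclicSpace M S ξ.1, x k = y ξ k := by
    intro ξ k hk
    have h1 : U.symm (lp.single 2 ξ ⟨k, hk⟩) = k :=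
      hH.linearIsometryEquiv_symm_apply_single _
    have h2 : U k = lp.single 2 ξ ⟨k, hk⟩ := by rw [← U.apply_symm_apply (lp.single 2 ξ _), h1]
    have h3 : D (lp.single 2 ξ ⟨k, hk⟩) = lp.single 2 ξ ⟨y ξ k, hinv ξ k hk⟩ := by
      refine lp.ext (funext fun ξ' => ?_)
      rw [lp.mapCLM_apply_coe]
      by_cases h : ξ' = ξ
      · subst h
        rw [lp.single_apply_self, lp.single_apply_self]
        rfl
      · rw [lp.single_apply_ne (hij := h), lp.single_apply_ne (hij := h), map_zero]
    change U.symm (D (U k)) = y ξ k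
    rw [h2, h3]
    exact hH.linearIsometryEquiv_symm_apply_single _
  refine ⟨x, ?_, ?_, hx⟩
  · refine mem_of_forall_commutant M fun z hz => ?_
    rw [← sub_eq_zero]
    refine ContinuousLinearMap.ext fun h => ?_
    have h1 : h ∈ (⨆ ξ : V, cyclicSpace M S ξ.1).topologicalClosure := htop ▸ Submodule.mem_top
    have h2 : (⨆ ξ : V, cyclicSpace M S ξ.1).topologicalClosure ≤
        (z * x - x * z : H →L[ℂ] H).ker := by
      refine Submodule.topologicalClosure_minimal _ (iSup_le fun ξ k hk => ?_)
        (ContinuousLinearMap.isClosed_ker _)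
      change z (x k) - x (z k) = 0
      rw [hx ξ k hk, hx ξ _ (cyclicSpace_invariant_commutant hz hk), sub_eq_zero]
      exact (commutant_comm_apply (hy ξ) hz k).symm
    exact h2 h1
  · refine ContinuousLinearMap.opNorm_le_bound _ hC fun h => ?_
    change ‖U.symm (D (U h))‖ ≤ _
    rw [U.symm.norm_map]
    refine (D.le_of_opNorm_le (lp.norm_mapCLM_le _ _ _ _) _).trans ?_
    rw [U.norm_map]

theorem ext_of_forall (hV : IsCyclicDecomposition M S V) {x y : H →L[ℂ] H}
    (h : ∀ ξ ∈ V, ∀ k ∈ cyclicSpace M S ξ, x k = y k) : x = y := by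
  rw [← sub_eq_zero, ← star_eq_zero]
  refine ContinuousLinearMap.ext fun v => hV.total _ fun ξ hξ k hk => ?_
  rw [inner_star_right, sub_apply, h ξ hξ k hk, sub_self, inner_zero_left]

/-- Restriction to the blocks is injective because the blocks are total, and surjective by
`exists_sum` applied to the extensions by zero. -/
theorem nonempty_starAlgEquiv (hV : IsCyclicDecomposition M S V) (hS : Generates M S) :
    Nonempty (Elt M ≃⋆ₐ[ℂ] DirectSum fun ξ : V => reduced M (cyclicSpace M S ξ.1)) := by
  have hinv : ∀ x ∈ M, ∀ ξ : V, ∀ k ∈ cyclicSpace M S ξ.1, x k ∈ cyclicSpace M S ξ.1 :=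
    fun x hx ξ k hk => hS.cyclicSpace_invariant hx hk
  let c : Elt M → ∀ ξ : V, Elt (reduced M (cyclicSpace M S ξ.1)) := fun x ξ =>
    ⟨restrictOp _ x.1 (hinv _ x.2 ξ),
      restrictOp_mem_reduced _ x.2 _ (hinv _ (star_mem x.2) ξ)⟩
  have hc : ∀ x, Memℓp (c x) ∞ := by
    intro x
    refine memℓp_infty ⟨‖x‖, ?_⟩
    rintro _ ⟨ξ, rfl⟩
    exact norm_restrictOp_le _ x.1 (hinv _ x.2 ξ)
  let Φ : Elt M → DirectSum fun ξ : V => reduced M (cyclicSpace M S ξ.1) := fun x => ⟨c x, hc x⟩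
  have hΦ : Function.Bijective Φ := by
    constructor
    · intro x y hxy
      refine Subtype.ext (hV.ext_of_forall fun ξ hξ k hk => ?_)
      have h1 := congrFun (congrArg Subtype.val hxy) ⟨ξ, hξ⟩
      exact congrArg (fun z : Elt (reduced M (cyclicSpace M S ξ)) => (z.1 ⟨k, hk⟩ : H)) h1
    · intro t
      obtain ⟨C, hC⟩ := memℓp_infty_iff.1 t.2
      obtain ⟨x, hx, -, hxt⟩ := hV.exists_sum hS (fun ξ => extendOp _ (t.1 ξ).1)
        (fun ξ => extendOp_mem _ (fun y hy k hk => cyclicSpace_invariant_commutant hy hk)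
          (t.1 ξ).2) (le_max_right C 0) fun ξ => (norm_extendOp_le _ _).trans
            ((hC ⟨ξ, rfl⟩).trans (le_max_left _ _))
      refine ⟨⟨x, hx⟩, Subtype.ext (funext fun ξ => Subtype.ext (ContinuousLinearMap.ext
        fun k => Subtype.ext ?_))⟩
      exact (hxt ξ k k.2).trans (extendOp_apply_coe _ _ _)
  exact ⟨{ Equiv.ofBijective Φ hΦ with
    map_mul' := fun x y => rfl
    map_add' := fun x y => rfl
    map_smul' := fun c x => rfl
    map_star' := fun x => Subtype.ext (funext fun ξ => Subtype.ext
      (star_restrictOp _ x.1 (hinv _ x.2 ξ) (hinv _ (star_mem x.2) ξ)).symm) }⟩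

end IsCyclicDecomposition

/-! ### Upper bound for the σ-strong density of the unit ball -/

variable {H : Type u} [NormedAddCommGroup H] [InnerProductSpace ℂ H] [CompleteSpace H]
  {M : VonNeumannAlgebra H} {S : Set (H →L[ℂ] H)} {V : Set H}

variable (M) in
theorem dense_sStrong_iff (D : Set (Elt M)) : @Dense _ (sStrong M) D ↔
    ∀ x : Elt M, ∀ F : Finset (SqSum H), ∀ ε > 0, ∃ d ∈ D, ∀ ζ ∈ F,
      dist (amplify d.1 ζ) (amplify x.1 ζ) < ε := by
  rw [sStrong_eq]
  exact dense_iInf_induced_iff (fun ζ (x : Elt M) => amplify x.1 ζ) D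

variable (M) in
theorem dense_sStrong_unitBall_iff (D : Set (UnitBall M)) :
    @Dense _ (TopologicalSpace.induced Subtype.val (sStrong M)) D ↔
    ∀ x : UnitBall M, ∀ F : Finset (SqSum H), ∀ ε > 0, ∃ d ∈ D, ∀ ζ ∈ F,
      dist (amplify d.1.1 ζ) (amplify x.1.1 ζ) < ε := by
  have : TopologicalSpace.induced Subtype.val (sStrong M) = ⨅ ζ : SqSum H,
      TopologicalSpace.induced (fun x : UnitBall M => amplify x.1.1 ζ) inferInstance := by
    rw [sStrong_eq, induced_iInf]
    exact iInf_congr fun ζ => induced_compose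
  rw [this]
  exact dense_iInf_induced_iff (fun ζ (x : UnitBall M) => amplify x.1.1 ζ) D

/-- On bounded sets the σ-strong topology can be tested on a total set. For these vectors `y` and
`n` drop out: ‖z y w ξ‖ ≤ ‖y‖ ‖z w ξ‖ for `z ∈ M`, leaving only conditions at the vectors `w ξ`. -/
theorem IsCyclicDecomposition.span_single_eq_top (hV : IsCyclicDecomposition M S V) (ζ : SqSum H) :
    ζ ∈ closure (Submodule.span ℂ {v : SqSum H | ∃ n : ℕ, ∃ ξ ∈ V, ∃ y ∈ M.commutant,
      ∃ w ∈ words S, v = lp.single 2 n (y (w ξ))} : Set (SqSum H)) := by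
  by_contra hζ
  obtain ⟨f, hf, hfζ⟩ := exists_dual_vanishing hζ
  refine hfζ ?_
  obtain ⟨η, rfl⟩ := (InnerProductSpace.toDual ℂ (SqSum H)).surjective f
  suffices h : η = 0 by simp [h]
  refine lp.ext (funext fun n => hV.total _ fun ξ hξ k hk => ?_)
  have := map_mem_of_mem_closure_span (U := (⊥ : Submodule ℂ ℂ)) (innerSL ℂ (η n)) (by simp) (by
    rintro _ ⟨y, hy, w, hw, rfl⟩
    have h1 := hf _ ⟨n, ξ, hξ, y, hy, w, hw, rfl⟩
    rwa [InnerProductSpace.toDual_apply_apply, lp.inner_single_right] at h1) hk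
  rw [← inner_conj_symm, ← innerSL_apply_apply, (Submodule.mem_bot ℂ).1 this, map_zero]

theorem sDensBall_le (hS : Generates M S) {κ : Cardinal.{u}} (hκ : ℵ₀ ≤ κ) (hSκ : #S ≤ κ) :
    sDensBall M ≤ κ := by
  classical
  obtain ⟨V, hV⟩ := hS.exists_isCyclicDecomposition
  obtain ⟨Λ, rfl⟩ : ∃ Λ : Type u, #Λ = κ := ⟨κ.out, mk_out κ⟩
  have : Infinite Λ := infinite_iff.2 hκ
  obtain ⟨G, hG, hGF⟩ := exists_small_set_of_functions (Λ := Λ) (hV.mk_le_two_power hS hκ hSκ)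
  have hW := mk_words_le_of_mk_le hκ hSκ
  -- Approximants for a single block, all indexed by the same set Λ.
  have hd : ∀ ξ : V, ∃ d : Λ → UnitBall M, ∀ x : UnitBall M, ∀ F : Finset (words S), ∀ ε > 0, ∃ l,
      ∀ w ∈ F, dist ((d l).1.1 (w.1 ξ.1)) (x.1.1 (w.1 ξ.1)) < ε := by
    intro ξ
    let T : Set H := Set.range fun w : words S => w.1 ξ.1
    have hT : ∀ w ∈ words S, ∀ t ∈ T, w t ∈ T := by
      rintro w hw _ ⟨w', rfl⟩
      exact ⟨⟨w * w', mul_mem hw w'.2⟩, rfl⟩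
    obtain ⟨D, hD, hTD⟩ := exists_dense_subset_span T
    obtain ⟨s, hs, hsF⟩ := exists_approx_of_maps (J := words S) (X := UnitBall M)
      (fun w x => x.1.1 (w.1 ξ.1)) ((↑) : D → H) (fun w x => by
        rw [Subtype.range_coe]
        refine hTD ?_
        rw [← Submodule.topologicalClosure_coe]
        exact hS.span_invariant hT x.1.2
          (Submodule.le_topologicalClosure _ (Submodule.subset_span ⟨w, rfl⟩))) hκ hW
      (hD.trans (max_le hκ (mk_range_le.trans hW)))
    have : Nonempty s := by
      obtain ⟨y, hy, -⟩ := hsF ⟨0, by simp⟩ ∅ 1 one_pos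
      exact ⟨⟨y, hy⟩⟩
    obtain ⟨e⟩ := hs
    refine ⟨fun l => (Function.invFun e l).1, fun x F ε hε => ?_⟩
    obtain ⟨y, hy, hyF⟩ := hsF x F ε hε
    refine ⟨e ⟨y, hy⟩, ?_⟩
    beta_reduce
    rwa [Function.leftInverse_invFun e.injective]
  choose d hd using hd
  -- Each choice of one approximant per block glues to an element of the unit ball. There may be
  -- more than κ choices in all, but those in `G` suffice: a basic neighbourhood involves finitely
  -- many blocks.
  have hx : ∀ g : V → Λ, ∃ x : UnitBall M, ∀ ξ : V, ∀ k ∈ cyclicSpace M S ξ.1,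
      x.1.1 k = (d ξ (g ξ)).1.1 k := by
    intro g
    obtain ⟨x, hx, hx1, hxk⟩ := hV.exists_sum hS (fun ξ => (d ξ (g ξ)).1.1)
      (fun ξ => (d ξ (g ξ)).1.2) zero_le_one fun ξ => (d ξ (g ξ)).2
    exact ⟨⟨⟨x, hx⟩, hx1⟩, hxk⟩
  choose x hx using hx
  have hD : @Dense _ (TopologicalSpace.induced Subtype.val (sStrong M)) (x '' G) := by
    rw [dense_sStrong_unitBall_iff]
    intro a F ε hε
    have h1 : ∀ ζ : SqSum H, ∃ s : Finset (V × words S), ∃ δ > 0, ∀ z : Elt M, ‖z‖ ≤ 2 →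
        (∀ p ∈ s, ‖z.1 (p.2.1 p.1.1)‖ < δ) → ‖amplify z.1 ζ‖ < ε := by
      intro ζ
      obtain ⟨s, δ, hδ, hs⟩ := exists_finset_bound (F := SqSum H) (hV.span_single_eq_top ζ)
        two_pos hε
      have hp : ∀ t : {v : SqSum H | ∃ n : ℕ, ∃ ξ ∈ V, ∃ y ∈ M.commutant,
          ∃ w ∈ words S, v = lp.single 2 n (y (w ξ))}, ∃ (p : V × words S), ∃ C ≥ 0,
          ∀ z : Elt M, ‖amplify z.1 t‖ ≤ C * ‖z.1 (p.2.1 p.1.1)‖ := by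
        rintro ⟨_, n, ξ, hξ, y, hy, w, hw, rfl⟩
        refine ⟨⟨⟨ξ, hξ⟩, ⟨w, hw⟩⟩, ‖y‖, norm_nonneg y, fun z => ?_⟩
        rw [amplify_single, lp.norm_single (by norm_num), commutant_comm_apply z.2 hy]
        exact y.le_opNorm _
      choose p C hC hp using hp
      have hsum : 0 ≤ ∑ t ∈ s, C t := Finset.sum_nonneg fun t _ => hC t
      -- The sum dominates each constant `C t`, and the 1 keeps the denominator positive.
      refine ⟨s.image p, δ / (1 + ∑ t ∈ s, C t), by positivity, fun z hz hzs => ?_⟩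
      refine hs (amplify z.1 : SqSum H →ₗ[ℂ] SqSum H) (fun e =>
        (norm_amplify_apply_le z.1 e).trans (by gcongr; exact hz)) fun t ht => ?_
      have h2 := hzs _ (Finset.mem_image_of_mem p ht)
      rw [lt_div_iff₀ (by positivity)] at h2
      have h3 : C t ≤ ∑ t ∈ s, C t := Finset.single_le_sum (fun t _ => hC t) ht
      refine (hp t z).trans_lt (lt_of_le_of_lt ?_ h2)
      rw [mul_comm]
      gcongr
      linarith
    choose s δ hδ hs using h1
    obtain ⟨δ₀, hδ₀, hδF⟩ : ∃ δ₀ > 0, ∀ ζ ∈ F, δ₀ ≤ δ ζ := by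
      by_cases hF : F.Nonempty
      · obtain ⟨ζ, hζ, h⟩ := F.exists_min_image δ hF
        exact ⟨δ ζ, hδ ζ, h⟩
      · exact ⟨1, one_pos, fun ζ hζ => (hF ⟨ζ, hζ⟩).elim⟩
    let P := F.biUnion s
    choose g hg using fun ξ : V => hd ξ a (P.image Prod.snd) δ₀ hδ₀
    obtain ⟨h, hhG, hh⟩ := hGF (P.image Prod.fst) g
    refine ⟨x h, ⟨h, hhG, rfl⟩, fun ζ hζ => ?_⟩
    have h2 := hs ζ ((x h).1 - a.1)
      ((norm_sub_le _ _).trans (by linarith [(x h).2, a.2])) fun p hp => by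
        have hpP : p ∈ P := Finset.mem_biUnion.2 ⟨ζ, hζ, hp⟩
        have h3 := hg p.1 p.2 (Finset.mem_image_of_mem _ hpP)
        rw [← hh p.1 (Finset.mem_image_of_mem _ hpP),
          ← hx h p.1 _ (word_mem_cyclicSpace p.2.2), dist_eq_norm] at h3
        exact h3.trans_le (hδF ζ hζ)
    have h4 : ((x h).1 - a.1).1 = (x h).1.1 - a.1.1 := rfl
    rw [h4, amplify_sub] at h2
    rw [dist_eq_norm]
    exact h2
  exact (densityChar_le hD).trans (mk_image_le.trans hG)

/-! ### Lower bounds for the σ-strong densities -/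

section Lower

variable (M)

theorem generates_of_dense_sStrong {D : Set (Elt M)} (hD : @Dense _ (sStrong M) D) :
    Generates M (Subtype.val '' D) := by
  refine ⟨?_, fun N hN x hx => mem_of_forall_approx N fun h k h' k' ε hε => ?_⟩
  · rintro _ ⟨x, -, rfl⟩
    exact x.2
  · classical
    have hb : 0 < ε / (1 + ‖h‖ + ‖h'‖) := by positivity
    obtain ⟨d, hd, hdF⟩ := (dense_sStrong_iff M D).1 hD ⟨x, hx⟩
      {lp.single 2 0 k, lp.single 2 0 k'} _ hb
    have key : ∀ v k : H, ‖v‖ ≤ 1 + ‖h‖ + ‖h'‖ →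
        dist (amplify d.1 (lp.single 2 0 k)) (amplify x (lp.single 2 0 k)) <
          ε / (1 + ‖h‖ + ‖h'‖) → ‖⟪v, (d.1 - x) k⟫_ℂ‖ < ε := by
      intro v k hv hk
      rw [dist_eq_norm, amplify_single, amplify_single, ← lp.single_sub,
        lp.norm_single (by norm_num), lt_div_iff₀ (by positivity)] at hk
      refine (norm_inner_le_norm v _).trans_lt (lt_of_le_of_lt ?_ hk)
      rw [mul_comm, sub_apply]
      gcongr
    refine ⟨d.1, hN ⟨d, hd, rfl⟩, key h k ?_ (hdF _ (by simp)), key h' k' ?_ (hdF _ (by simp))⟩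
    · linarith [norm_nonneg h']
    · linarith [norm_nonneg h]

theorem gen_le_sDens : gen M ≤ sDens M := by
  obtain ⟨D, hD, hDs⟩ := exists_dense_mk_eq_densityChar (Elt M) (sStrong M)
  rw [sDens, ← hDs, ← mk_image_eq Subtype.val_injective]
  refine (generates_of_dense_sStrong M hD).gen_le ?_
  rw [Cardinal.one_le_iff_ne_zero, mk_ne_zero_iff]
  obtain ⟨d, hd, -⟩ := (dense_sStrong_iff M D).1 hD 0 ∅ 1 one_pos
  exact ⟨⟨d.1, d, hd, rfl⟩⟩

omit [CompleteSpace H] in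
-- For every N the vectors (n/N)h with n < N are ‖h‖/N-separated, so `D` has at least N elements.
-- Scalars of modulus at most 1 are enough, which makes this usable in the unit ball.
theorem aleph0_le_mk_of_approx_scalars {h : H} (h0 : h ≠ 0) {D : Set (H →L[ℂ] H)}
    (hD : ∀ c : ℂ, ‖c‖ ≤ 1 → ∀ ε > 0, ∃ d ∈ D, dist (c • h) (d h) < ε) : ℵ₀ ≤ #D := by
  rw [Cardinal.aleph0_le]
  intro N
  have hh : 0 < ‖h‖ := norm_pos_iff.2 h0
  have hN : ∀ m : ULift.{u} (Fin N), 0 < (N : ℝ) := fun m => by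
    exact_mod_cast (Nat.zero_le _).trans_lt m.down.2
  have key := mk_le_of_separated (ι := ULift.{u} (Fin N)) (X := H) (δ := ‖h‖ / N)
    (fun n => ((n.down : ℕ) / (N : ℂ)) • h) (fun m n hmn => by
      change _ ≤ dist _ _
      rw [dist_eq_norm, ← sub_smul, ← sub_div, norm_smul, norm_div, Complex.norm_natCast]
      have h2 : ((m.down : ℕ) : ℤ) - (n.down : ℕ) ≠ 0 := by
        intro h3
        exact hmn (ULift.ext _ _ (Fin.ext (by omega)))
      have h4 := Int.one_le_abs h2
      have h5 : (((m.down : ℕ) : ℂ) - (n.down : ℕ)) =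
          ((((m.down : ℕ) : ℤ) - (n.down : ℕ) : ℤ) : ℂ) := by push_cast; rfl
      rw [h5, Complex.norm_intCast, div_mul_eq_mul_div]
      have h6 : (1 : ℝ) ≤ |((((m.down : ℕ) : ℤ) - (n.down : ℕ) : ℤ) : ℝ)| := by exact_mod_cast h4
      have := hN m
      gcongr
      nlinarith) ((fun x : H →L[ℂ] H => x h) '' D) fun n => by
      obtain ⟨d, hd, hdh⟩ := hD ((n.down : ℕ) / (N : ℂ)) (by
        rw [norm_div, Complex.norm_natCast, Complex.norm_natCast, div_le_one (hN n)]
        exact_mod_cast n.down.2.le) (‖h‖ / N / 2) (by have := hN n; positivity)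
      exact ⟨d h, ⟨d, hd, rfl⟩, hdh⟩
  rw [mk_uLift, mk_fin, lift_natCast] at key
  exact key.trans mk_image_le

theorem aleph0_le_sDens [Nontrivial H] : ℵ₀ ≤ sDens M := by
  obtain ⟨D, hD, hDs⟩ := exists_dense_mk_eq_densityChar (Elt M) (sStrong M)
  rw [sDens, ← hDs]
  obtain ⟨h, h0⟩ := exists_ne (0 : H)
  refine (aleph0_le_mk_of_approx_scalars h0 (D := Subtype.val '' D)
    fun c _ ε hε => ?_).trans mk_image_le
  obtain ⟨d, hd, hdF⟩ := (dense_sStrong_iff M D).1 hD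
    ⟨c • 1, smul_mem' _ (one_mem M)⟩ {lp.single 2 0 h} ε hε
  refine ⟨d.1, ⟨d, hd, rfl⟩, ?_⟩
  have h3 := hdF _ (Finset.mem_singleton_self _)
  rwa [dist_eq_norm, amplify_single, amplify_single, ← lp.single_sub,
    lp.norm_single (by norm_num), ← dist_eq_norm, dist_comm] at h3

theorem aleph0_le_sDensBall [Nontrivial H] : ℵ₀ ≤ sDensBall M := by
  obtain ⟨D, hD, hDs⟩ := exists_dense_mk_eq_densityChar (UnitBall M)
    (TopologicalSpace.induced Subtype.val (sStrong M))
  rw [sDensBall, ← hDs]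
  obtain ⟨h, h0⟩ := exists_ne (0 : H)
  refine (aleph0_le_mk_of_approx_scalars h0 (D := (fun x : UnitBall M => x.1.1) '' D)
    fun c hc ε hε => ?_).trans mk_image_le
  obtain ⟨d, hd, hdF⟩ := (dense_sStrong_unitBall_iff M D).1 hD
    ⟨⟨c • 1, smul_mem' _ (one_mem M)⟩, by
      change ‖c • (1 : H →L[ℂ] H)‖ ≤ 1
      rwa [norm_smul, norm_one, mul_one]⟩ {lp.single 2 0 h} ε hε
  refine ⟨d.1.1, ⟨d, hd, rfl⟩, ?_⟩
  have h3 := hdF _ (Finset.mem_singleton_self _)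
  rwa [dist_eq_norm, amplify_single, amplify_single, ← lp.single_sub,
    lp.norm_single (by norm_num), ← dist_eq_norm, dist_comm] at h3

theorem sDens_le_mul_sDensBall : sDens M ≤ ℵ₀ * sDensBall M := by
  obtain ⟨D, hD, hDs⟩ := exists_dense_mk_eq_densityChar (UnitBall M)
    (TopologicalSpace.induced Subtype.val (sStrong M))
  let E : Set (Elt M) := Set.range fun p : ULift.{u} ℕ × D => ((p.1.down : ℂ) + 1) • p.2.1.1
  have hE : @Dense _ (sStrong M) E := by
    rw [dense_sStrong_iff]
    intro x F ε hε
    obtain ⟨n, hn⟩ := exists_nat_ge ‖x‖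
    have hc : ((n : ℂ) + 1) ≠ 0 := by exact_mod_cast n.succ_ne_zero
    have hcn : ‖(n : ℂ) + 1‖ = (n : ℝ) + 1 := by
      have : ((n : ℂ) + 1) = ((n + 1 : ℕ) : ℂ) := by push_cast; rfl
      rw [this, Complex.norm_natCast]
      push_cast
      rfl
    obtain ⟨d, hd, hdF⟩ := (dense_sStrong_unitBall_iff M D).1 hD
      ⟨((n : ℂ) + 1)⁻¹ • x, by
        rw [norm_smul, norm_inv, hcn, inv_mul_le_iff₀ (by positivity)]
        linarith⟩ F (ε / (n + 1)) (by positivity)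
    refine ⟨((n : ℂ) + 1) • d.1, ⟨⟨⟨n⟩, ⟨d, hd⟩⟩, rfl⟩, fun ζ hζ => ?_⟩
    have h1 := hdF ζ hζ
    have h2 : amplify x.1 ζ = ((n : ℂ) + 1) • amplify (((n : ℂ) + 1)⁻¹ • x.1) ζ := by
      rw [amplify_smul, smul_apply, smul_smul, mul_inv_cancel₀ hc, one_smul]
    have h3 : amplify (((n : ℂ) + 1) • d.1).1 ζ = ((n : ℂ) + 1) • amplify d.1.1 ζ := by
      change amplify (((n : ℂ) + 1) • d.1.1) ζ = _
      rw [amplify_smul, smul_apply]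
    rw [h2, h3, dist_smul₀, hcn]
    rw [lt_div_iff₀ (by positivity), mul_comm] at h1
    exact h1
  refine (densityChar_le hE).trans (mk_range_le.trans ?_)
  rw [mk_prod, mk_uLift, mk_nat, lift_aleph0, lift_aleph0, lift_id, hDs, sDensBall]

/-- Since density need not decrease on subspaces, the ball is not compared directly with `M` from
above: the bound by ℵ₀·gen(M) closes the cycle of inequalities. -/
theorem sDens_eq [Nontrivial H] : ℵ₀ * gen M = sDens M ∧ sDens M = sDensBall M := by
  obtain ⟨S, hS, hSg⟩ := exists_generates_mk_le_gen M
  have hg0 : gen M ≠ 0 := Cardinal.one_le_iff_ne_zero.1 (one_le_gen M)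
  have h1 : ℵ₀ ≤ ℵ₀ * gen M := le_mul_of_one_le_right' (one_le_gen M)
  have h2 : gen M ≤ ℵ₀ * gen M := le_mul_of_one_le_left' one_le_aleph0
  have h3 : sDensBall M ≤ ℵ₀ * gen M := sDensBall_le hS h1 (hSg.trans h2)
  have h4 : ℵ₀ * gen M ≤ sDens M :=
    (mul_le_mul' (aleph0_le_sDens M) (gen_le_sDens M)).trans (mul_eq_self (aleph0_le_sDens M)).le
  have h5 : sDens M ≤ ℵ₀ * sDensBall M := sDens_le_mul_sDensBall M
  rw [aleph0_mul_eq (aleph0_le_sDensBall M)] at h5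
  exact ⟨h4.antisymm (h5.trans h3), h5.antisymm (h3.trans h4)⟩

end Lower

/-! ### Corners of minimal projections -/

variable {H : Type u} [NormedAddCommGroup H] [InnerProductSpace ℂ H] [CompleteSpace H]
  {M : VonNeumannAlgebra H}

theorem posPart_mem {b : H →L[ℂ] H} (hb : b ∈ M) : b⁺ ∈ M := by
  refine mem_of_forall_commutant M fun y hy => ?_
  have h : Commute b y := commutant_comm hb hy
  exact (h.cfcₙ_real _).symm.eq

/-- The projection onto the closed range of an element of `M`. -/
theorem exists_range_projection {b : H →L[ℂ] H} (hb : b ∈ M) :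
    ∃ q ∈ M, IsStarProjection q ∧ q * b = b ∧ (∀ c : H →L[ℂ] H, c * b = 0 → c * q = 0) := by
  let K : Submodule ℂ H := (Submodule.span ℂ (Set.range b)).topologicalClosure
  have hbK : ∀ h, b h ∈ K := fun h =>
    Submodule.le_topologicalClosure _ (Submodule.subset_span ⟨h, rfl⟩)
  refine ⟨K.starProjection, starProjection_mem K fun y hy k hk => ?_,
    isStarProjection_starProjection, ?_, fun c hc => ?_⟩
  · refine map_mem_of_mem_closure_span y (Submodule.isClosed_topologicalClosure _) ?_ hk
    rintro _ ⟨h, rfl⟩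
    rw [← commutant_comm_apply hb hy]
    exact hbK _
  · exact ContinuousLinearMap.ext fun h => Submodule.starProjection_eq_self_iff.2 (hbK h)
  · refine ContinuousLinearMap.ext fun h => ?_
    refine (Submodule.mem_bot ℂ).1 (map_mem_of_mem_closure_span c (U := ⊥) (by simp) ?_
      (K.starProjection_apply_mem h))
    rintro _ ⟨h, rfl⟩
    exact congrArg (fun z : H →L[ℂ] H => z h) hc

/-- As b⁺b⁻ = 0, one has (b⁺)² = b⁺b, whence (b⁺c)*(b⁺c) = c*b⁺bc = 0. -/
theorem posPart_mul_eq_zero {b c : H →L[ℂ] H} (hb : IsSelfAdjoint b) (hbc : b * c = 0) :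
    b⁺ * c = 0 := by
  have h1 : b⁺ * b = b⁺ * b⁺ := by
    have h := congrArg (b⁺ * ·) (CFC.posPart_sub_negPart b hb)
    simp only [mul_sub, CFC.posPart_mul_negPart, sub_zero] at h
    exact h.symm
  have h2 : star (b⁺) = b⁺ := (CFC.posPart_nonneg b).isSelfAdjoint
  rw [← CStarRing.star_mul_self_eq_zero_iff, star_mul, h2, mul_assoc, ← mul_assoc (b⁺), ← h1,
    mul_assoc, hbc, mul_zero, mul_zero]

/-- A nonzero projection that majorizes no other nonzero projection of `M`. -/
def IsMinimalProjection (M : VonNeumannAlgebra H) (p : H →L[ℂ] H) : Prop :=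
  ∀ q ∈ M, IsStarProjection q → p * q = q → q = 0 ∨ q = p

/-- The range projection of b⁺ lies under `p`, so it is 0 or `p`. In the second case b⁻b⁺ = 0 gives
b⁻p = 0, while b⁻(1 - p) = 0 already. -/
theorem IsMinimalProjection.posPart_eq_zero_or {p b : H →L[ℂ] H} (hmin : IsMinimalProjection M p)
    (hb : b ∈ M) (hbs : IsSelfAdjoint b) (hbp : b * (1 - p) = 0) (hp : IsStarProjection p) :
    b⁺ = 0 ∨ b⁻ = 0 := by
  have h1 : b⁺ * (1 - p) = 0 := posPart_mul_eq_zero hbs hbp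
  have h2 : b⁻ * (1 - p) = 0 := by
    rw [← CFC.posPart_neg]
    exact posPart_mul_eq_zero hbs.neg (by rw [neg_mul, hbp, neg_zero])
  obtain ⟨q, hqM, hq, hqb, hqc⟩ := exists_range_projection (posPart_mem hb)
  have h3 : (1 - p) * b⁺ = 0 := by
    have := congrArg star h1
    rwa [star_mul, star_sub, star_one, hp.isSelfAdjoint.star_eq,
      (CFC.posPart_nonneg b).isSelfAdjoint.star_eq, star_zero] at this
  have h4 := hqc _ h3
  rw [sub_mul, one_mul, sub_eq_zero] at h4
  rcases hmin q hqM hq h4.symm with h | h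
  · left
    rw [← hqb, h, zero_mul]
  · right
    have h5 := hqc _ (CFC.negPart_mul_posPart b)
    rw [h] at h5
    rw [mul_sub, mul_one, h5, sub_zero] at h2
    exact h2

theorem inner_projection_apply {p : H →L[ℂ] H} (hp : IsStarProjection p) (h : H) :
    ⟪p h, h⟫_ℂ = (‖p h‖ : ℂ) ^ 2 := by
  have h1 : p (p h) = p h := congrArg (fun z : H →L[ℂ] H => z h) hp.isIdempotentElem.eq
  calc ⟪p h, h⟫_ℂ = ⟪p (p h), h⟫_ℂ := by rw [h1]
    _ = ⟪p h, p h⟫_ℂ := by rw [← inner_star_right, hp.isSelfAdjoint.star_eq]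
    _ = (‖p h‖ : ℂ) ^ 2 := inner_self_eq_norm_sq_to_K _

/-- Applied to a - tp, the previous dichotomy says that a ≤ tp or a ≥ tp for each real t. A t
strictly between two values of ⟪a h, h⟫ / ‖p h‖² would violate both, so this ratio is a constant c,
and polarization gives a = cp. -/
theorem IsMinimalProjection.exists_eq_smul_of_isSelfAdjoint {p a : H →L[ℂ] H}
    (hmin : IsMinimalProjection M p) (hpM : p ∈ M) (hp : IsStarProjection p) (ha : a ∈ M)
    (has : IsSelfAdjoint a) (hap : a * p = a) : ∃ c : ℂ, a = c • p := by
  have hpa : p * a = a := by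
    have := congrArg star hap
    rwa [star_mul, hp.isSelfAdjoint.star_eq, has.star_eq] at this
  have hdich : ∀ t : ℝ, (∀ h, (⟪a h, h⟫_ℂ).re ≤ t * ‖p h‖ ^ 2) ∨
      ∀ h, t * ‖p h‖ ^ 2 ≤ (⟪a h, h⟫_ℂ).re := by
    intro t
    have hbs : IsSelfAdjoint (a - (t : ℂ) • p) := by
      rw [isSelfAdjoint_iff, star_sub, star_smul, has.star_eq, hp.isSelfAdjoint.star_eq]
      simp
    have hform : ∀ h, (⟪(a - (t : ℂ) • p) h, h⟫_ℂ).re = (⟪a h, h⟫_ℂ).re - t * ‖p h‖ ^ 2 := by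
      intro h
      rw [sub_apply, smul_apply, inner_sub_left, inner_smul_left, inner_projection_apply hp,
        Complex.sub_re,
        Complex.conj_ofReal]
      norm_cast
    have h0 := hmin.posPart_eq_zero_or (sub_mem ha (smul_mem' (t : ℂ) hpM)) hbs (by
      rw [mul_sub, mul_one, sub_mul, hap, smul_mul_assoc, hp.isIdempotentElem.eq, sub_self]) hp
    rcases h0 with h0 | h0
    · left
      intro h
      rw [CFC.posPart_eq_zero_iff _ hbs, ← neg_nonneg,
        ContinuousLinearMap.nonneg_iff_isPositive] at h0
      have h1 := h0.re_inner_nonneg_left h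
      have h2 := hform h
      rw [neg_apply, inner_neg_left] at h1
      simp only [RCLike.re_to_complex, Complex.neg_re] at h1
      linarith
    · right
      intro h
      rw [CFC.negPart_eq_zero_iff _ hbs, ContinuousLinearMap.nonneg_iff_isPositive] at h0
      have h1 := h0.re_inner_nonneg_left h
      have h2 := hform h
      simp only [RCLike.re_to_complex] at h1
      linarith
  by_cases hp0 : p = 0
  · exact ⟨0, by rw [← hap, hp0]; simp⟩
  obtain ⟨v, hv⟩ : ∃ v, p v ≠ 0 := by
    by_contra! h
    exact hp0 (ContinuousLinearMap.ext h)
  have hv2 : 0 < ‖p v‖ ^ 2 := by positivity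
  let c : ℝ := (⟪a v, v⟫_ℂ).re / ‖p v‖ ^ 2
  have hc : (⟪a v, v⟫_ℂ).re = c * ‖p v‖ ^ 2 := (div_mul_cancel₀ _ hv2.ne').symm
  have hform : ∀ h, (⟪a h, h⟫_ℂ).re = c * ‖p h‖ ^ 2 := by
    intro h
    by_cases hh : p h = 0
    · have : a h = 0 := by
        rw [← hap]
        change a (p h) = 0
        rw [hh, map_zero]
      rw [this, hh]
      simp
    have hh2 : 0 < ‖p h‖ ^ 2 := by positivity
    rcases lt_trichotomy (⟪a h, h⟫_ℂ).re (c * ‖p h‖ ^ 2) with hlt | heq | hgt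
    · rw [← div_lt_iff₀ hh2] at hlt
      obtain ⟨t, ht1, ht2⟩ := exists_between hlt
      rw [div_lt_iff₀ hh2] at ht1
      rcases hdich t with h1 | h1
      · have := h1 v
        rw [hc] at this
        nlinarith
      · exact absurd (h1 h) (not_le.2 ht1)
    · exact heq
    · rw [← lt_div_iff₀ hh2] at hgt
      obtain ⟨t, ht1, ht2⟩ := exists_between hgt
      rw [lt_div_iff₀ hh2] at ht2
      rcases hdich t with h1 | h1
      · exact absurd (h1 h) (not_le.2 ht2)
      · have := h1 v
        rw [hc] at this
        nlinarith
  refine ⟨c, ?_⟩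
  rw [← sub_eq_zero]
  have hz : ∀ h, ⟪(a - (c : ℂ) • p) h, h⟫_ℂ = 0 := by
    intro h
    have h2 : ⟪a h, h⟫_ℂ = ((⟪a h, h⟫_ℂ).re : ℂ) := by
      rw [eq_comm, ← Complex.conj_eq_iff_re, inner_conj_symm, ← inner_star_right, has.star_eq]
    rw [sub_apply, smul_apply, inner_sub_left, inner_smul_left, inner_projection_apply hp,
      h2, hform h,
      Complex.conj_ofReal]
    push_cast
    ring
  have := (inner_map_self_eq_zero ((a - (c : ℂ) • p : H →L[ℂ] H) : H →ₗ[ℂ] H)).1 hz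
  exact ContinuousLinearMap.coe_injective this

theorem IsMinimalProjection.exists_eq_smul {p : H →L[ℂ] H} (hmin : IsMinimalProjection M p)
    (hpM : p ∈ M) (hp : IsStarProjection p) {x : H →L[ℂ] H} (hx : x ∈ M) :
    ∃ c : ℂ, p * x * p = c • p := by
  have hpp := hp.isIdempotentElem.eq
  have key : ∀ y ∈ M, IsSelfAdjoint y → ∃ c : ℂ, p * y * p = c • p := by
    intro y hy hys
    refine hmin.exists_eq_smul_of_isSelfAdjoint hpM hp (mul_mem (mul_mem hpM hy) hpM) ?_ ?_
    · rw [isSelfAdjoint_iff, star_mul, star_mul, hp.isSelfAdjoint.star_eq, hys.star_eq, mul_assoc]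
    · rw [mul_assoc, hpp]
  obtain ⟨c, hc⟩ := key (x + star x) (add_mem hx (star_mem hx)) (IsSelfAdjoint.add_star_self x)
  obtain ⟨d, hd⟩ := key (Complex.I • (x - star x))
    (smul_mem' _ (sub_mem hx (star_mem hx))) (by
      rw [isSelfAdjoint_iff, star_smul, star_sub, star_star]
      simp [sub_eq_add_neg, add_comm])
  refine ⟨(1 / 2 : ℂ) * (c - Complex.I * d), ?_⟩
  have h1 : x = (1 / 2 : ℂ) • ((x + star x) - Complex.I • (Complex.I • (x - star x))) := by
    rw [smul_smul, Complex.I_mul_I]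
    module
  conv_lhs => rw [h1]
  rw [mul_smul_comm, smul_mul_assoc, mul_sub, sub_mul, hc, mul_smul_comm Complex.I,
    smul_mul_assoc Complex.I, hd, smul_smul, ← sub_smul, smul_smul]

/-! ### The case of finite decomposability number -/

variable {H : Type u} [NormedAddCommGroup H] [InnerProductSpace ℂ H] [CompleteSpace H]
  {M : VonNeumannAlgebra H}

/-- A finite family of minimal projections of `M` with sum `1`. -/
structure IsMinimalFamily (M : VonNeumannAlgebra H) {n : ℕ} (e : Fin n → H →L[ℂ] H) : Prop where
  mem : ∀ i, e i ∈ M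
  proj : ∀ i, IsStarProjection (e i)
  ne_zero : ∀ i, e i ≠ 0
  ortho : ∀ i j, i ≠ j → e i * e j = 0
  sum_eq : ∑ i, e i = 1
  minimal : ∀ i, IsMinimalProjection M (e i)

theorem exists_isOrthoFamily_mk_eq_dec (h : dec M < ℵ₀) :
    ∃ P, IsOrthoFamily M P ∧ #P = dec M := by
  obtain ⟨n, hn⟩ := lt_aleph0.1 h
  by_contra! hne
  have hlt : ∀ P : {P : Set (H →L[ℂ] H) // IsOrthoFamily M P}, #P.1 < n := fun P =>
    hn ▸ lt_of_le_of_ne P.2.mk_le_dec (hne P.1 P.2)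
  have h0 : IsOrthoFamily M ∅ := ⟨by simp, by simp⟩
  cases n with
  | zero => simpa using hlt ⟨∅, h0⟩
  | succ m =>
    have h1 : dec M ≤ m := by
      refine ciSup_le' fun P => ?_
      have h2 := hlt P
      obtain ⟨k, hk⟩ := lt_aleph0.1 (h2.trans natCast_lt_aleph0)
      rw [hk] at h2 ⊢
      exact_mod_cast Nat.lt_succ_iff.1 (by exact_mod_cast h2)
    rw [hn] at h1
    exact absurd (by exact_mod_cast h1 : m + 1 ≤ m) (by omega)

/-- A family of maximal size works. If its sum were not 1, the complement could be added; if some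
member were not minimal, it could be split in two. -/
theorem exists_isMinimalFamily (h : dec M < ℵ₀) :
    ∃ (n : ℕ) (e : Fin n → H →L[ℂ] H), IsMinimalFamily M e ∧ (n : Cardinal.{u}) = dec M := by
  classical
  obtain ⟨P, hP, hPd⟩ := exists_isOrthoFamily_mk_eq_dec h
  have hfin : Finite P := lt_aleph0_iff_finite.1 (hPd ▸ h)
  have : Fintype P := Fintype.ofFinite P
  let e : Fin (Fintype.card P) → H →L[ℂ] H := fun i => (Fintype.equivFin P).symm i
  have hmem : ∀ i, e i ∈ M := fun i => (hP.1 _ ((Fintype.equivFin P).symm i).2).1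
  have hproj : ∀ i, IsStarProjection (e i) :=
    fun i => (hP.1 _ ((Fintype.equivFin P).symm i).2).2.1
  have hne : ∀ i, e i ≠ 0 := fun i => (hP.1 _ ((Fintype.equivFin P).symm i).2).2.2
  have hortho : ∀ i j, i ≠ j → e i * e j = 0 := fun i j hij =>
    hP.2 ((Fintype.equivFin P).symm i).2 ((Fintype.equivFin P).symm j).2
      fun h => hij ((Fintype.equivFin P).symm.injective (Subtype.ext h))
  have hcard : ((Fintype.card P : ℕ) : Cardinal.{u}) = dec M := by rw [← hPd, mk_fintype]
  -- The index type `Option` provides one projection too many.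
  have hmax : ∀ p : Option (ULift.{u} (Fin (Fintype.card P))) → H →L[ℂ] H, (∀ i, p i ∈ M) →
      (∀ i, IsStarProjection (p i)) → (∀ i, p i ≠ 0) → (∀ i j, i ≠ j → p i * p j = 0) → False := by
    intro p h1 h2 h3 h4
    have h5 := mk_le_dec p h1 h2 h3 h4
    rw [mk_option, mk_uLift, mk_fin, lift_natCast, ← hcard] at h5
    exact absurd (by exact_mod_cast h5 : Fintype.card P + 1 ≤ Fintype.card P) (by omega)
  refine ⟨_, e, ⟨hmem, hproj, hne, hortho, ?_, fun i q hqM hq hqe => ?_⟩, hcard⟩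
  · by_contra hsum
    have hsumM : ∑ i, e i ∈ M := sum_mem fun i _ => hmem i
    have h1 : ∀ j, (∑ i, e i) * e j = e j := fun j => by
      rw [Finset.sum_mul, Finset.sum_eq_single j (fun i _ hij => hortho i j hij) (by simp),
        (hproj j).isIdempotentElem.eq]
    have h2 : ∀ j, e j * ∑ i, e i = e j := fun j => by
      rw [Finset.mul_sum, Finset.sum_eq_single j (fun i _ hij => hortho j i hij.symm) (by simp),
        (hproj j).isIdempotentElem.eq]
    have h3 : IsStarProjection (∑ i, e i) := by
      refine ⟨?_, ?_⟩
      · rw [IsIdempotentElem, Finset.mul_sum]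
        exact Finset.sum_congr rfl fun j _ => h1 j
      · rw [isSelfAdjoint_iff, star_sum]
        exact Finset.sum_congr rfl fun j _ => (hproj j).isSelfAdjoint.star_eq
    refine hmax (fun o => o.elim (1 - ∑ i, e i) fun i => e i.down) ?_ ?_ ?_ ?_
    · rintro (_ | i)
      · exact sub_mem (one_mem M) hsumM
      · exact hmem _
    · rintro (_ | i)
      · exact h3.one_sub
      · exact hproj _
    · rintro (_ | i)
      · exact fun h => hsum (sub_eq_zero.1 h).symm
      · exact hne _
    · rintro (_ | i) (_ | j) hij
      · exact (hij rfl).elim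
      · change (1 - ∑ i, e i) * e j.down = 0
        rw [sub_mul, one_mul, h1, sub_self]
      · change e i.down * (1 - ∑ i, e i) = 0
        rw [mul_sub, mul_one, h2, sub_self]
      · exact hortho _ _ fun h => hij (congrArg some (ULift.ext _ _ h))
  · by_contra! hcon
    have hqe' : q * e i = q := by
      have := congrArg star hqe
      rwa [star_mul, (hproj i).isSelfAdjoint.star_eq, hq.isSelfAdjoint.star_eq] at this
    have hqj : ∀ j, i ≠ j → q * e j = 0 := fun j hij => by
      rw [← hqe', mul_assoc, hortho i j hij, mul_zero]
    have hjq : ∀ j, i ≠ j → e j * q = 0 := fun j hij => by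
      rw [← hqe, ← mul_assoc, hortho j i hij.symm, zero_mul]
    let f : Fin (Fintype.card P) → H →L[ℂ] H := fun j => if j = i then q else e j
    have hfi : f i = q := if_pos rfl
    have hfj : ∀ j, j ≠ i → f j = e j := fun j hj => if_neg hj
    refine hmax (fun o => o.elim (e i - q) fun j => f j.down) ?_ ?_ ?_ ?_
    · rintro (_ | ⟨⟨j⟩⟩)
      · exact sub_mem (hmem i) hqM
      · change f j ∈ M
        by_cases hj : j = i
        · rw [hj, hfi]
          exact hqM
        · rw [hfj j hj]
          exact hmem j
    · rintro (_ | ⟨⟨j⟩⟩)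
      · change IsStarProjection (e i - q)
        refine ⟨?_, (hproj i).isSelfAdjoint.sub hq.isSelfAdjoint⟩
        rw [IsIdempotentElem, mul_sub, sub_mul, sub_mul, hqe, hqe', hq.isIdempotentElem.eq,
          (hproj i).isIdempotentElem.eq, sub_self, sub_zero]
      · change IsStarProjection (f j)
        by_cases hj : j = i
        · rw [hj, hfi]
          exact hq
        · rw [hfj j hj]
          exact hproj j
    · rintro (_ | ⟨⟨j⟩⟩)
      · exact fun h => hcon.2 (sub_eq_zero.1 h).symm
      · change f j ≠ 0
        by_cases hj : j = i
        · rw [hj, hfi]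
          exact hcon.1
        · rw [hfj j hj]
          exact hne j
    · rintro (_ | ⟨⟨j⟩⟩) (_ | ⟨⟨k⟩⟩) hjk
      · exact (hjk rfl).elim
      · change (e i - q) * f k = 0
        by_cases hk : k = i
        · rw [hk, hfi, sub_mul, hqe, hq.isIdempotentElem.eq, sub_self]
        · rw [hfj k hk, sub_mul, hortho i k (Ne.symm hk), hqj k (Ne.symm hk), sub_self]
      · change f j * (e i - q) = 0
        by_cases hj : j = i
        · rw [hj, hfi, mul_sub, hqe', hq.isIdempotentElem.eq, sub_self]
        · rw [hfj j hj, mul_sub, hortho j i hj, hjq j (Ne.symm hj), sub_self]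
      · change f j * f k = 0
        have hjk' : j ≠ k := fun h => hjk (by rw [h])
        by_cases hj : j = i
        · have hk : k ≠ i := fun h => hjk' (hj.trans h.symm)
          rw [hj, hfi, hfj k hk, hqj k (Ne.symm hk)]
        · by_cases hk : k = i
          · rw [hk, hfi, hfj j hj, hjq j (Ne.symm hj)]
          · rw [hfj j hj, hfj k hk, hortho j k hjk']

namespace IsMinimalFamily

variable {n : ℕ} {e : Fin n → H →L[ℂ] H}

theorem mul_self (he : IsMinimalFamily M e) (i : Fin n) : e i * e i = e i :=
  (he.proj i).isIdempotentElem.eq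

theorem star_eq (he : IsMinimalFamily M e) (i : Fin n) : star (e i) = e i :=
  (he.proj i).isSelfAdjoint.star_eq

theorem corner (he : IsMinimalFamily M e) (i : Fin n) {x : H →L[ℂ] H} (hx : x ∈ M) :
    ∃ c : ℂ, e i * x * e i = c • e i :=
  (he.minimal i).exists_eq_smul (he.mem i) (he.proj i) hx

/-- `u` belongs to the block `eᵢ M eₖ`. -/
def IsBlock (M : VonNeumannAlgebra H) (e : Fin n → H →L[ℂ] H) (i k : Fin n) (u : H →L[ℂ] H) :
    Prop :=
  u ∈ M ∧ e i * u = u ∧ u * e k = u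

theorem isBlock (he : IsMinimalFamily M e) (i k : Fin n) {x : H →L[ℂ] H} (hx : x ∈ M) :
    IsBlock M e i k (e i * x * e k) := by
  refine ⟨mul_mem (mul_mem (he.mem i) hx) (he.mem k), ?_, ?_⟩
  · rw [← mul_assoc, ← mul_assoc, he.mul_self]
  · rw [mul_assoc, he.mul_self]

theorem isBlock_self (he : IsMinimalFamily M e) (i : Fin n) : IsBlock M e i i (e i) :=
  ⟨he.mem i, he.mul_self i, he.mul_self i⟩

theorem IsBlock.star (he : IsMinimalFamily M e) {i k : Fin n}
    {u : H →L[ℂ] H} (hu : IsBlock M e i k u) : IsBlock M e k i (star u) := by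
  refine ⟨star_mem hu.1, ?_, ?_⟩
  · rw [← he.star_eq, ← star_mul, hu.2.2]
  · rw [← he.star_eq, ← star_mul, hu.2.1]

theorem IsBlock.mul {i j k : Fin n} {u v : H →L[ℂ] H} (hu : IsBlock M e i j u)
    (hv : IsBlock M e j k v) : IsBlock M e i k (u * v) :=
  ⟨mul_mem hu.1 hv.1, by rw [← mul_assoc, hu.2.1], by rw [mul_assoc, hv.2.2]⟩

theorem exists_smul (he : IsMinimalFamily M e) {i : Fin n} {u : H →L[ℂ] H}
    (hu : IsBlock M e i i u) : ∃ c : ℂ, u = c • e i := by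
  obtain ⟨c, hc⟩ := he.corner i hu.1
  rw [hu.2.1, hu.2.2] at hc
  exact ⟨c, hc⟩

theorem exists_mul_star (he : IsMinimalFamily M e) {i k : Fin n} {u : H →L[ℂ] H}
    (hu : IsBlock M e i k u) (hu0 : u ≠ 0) : ∃ c : ℂ, c ≠ 0 ∧ u * star u = c • e i := by
  obtain ⟨c, hc⟩ := he.exists_smul (hu.mul (IsBlock.star he hu))
  refine ⟨c, fun h => hu0 ?_, hc⟩
  rw [h, zero_smul] at hc
  exact (CStarRing.mul_star_self_eq_zero_iff u).1 hc

theorem exists_star_mul (he : IsMinimalFamily M e) {i k : Fin n} {u : H →L[ℂ] H}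
    (hu : IsBlock M e i k u) (hu0 : u ≠ 0) : ∃ c : ℂ, c ≠ 0 ∧ star u * u = c • e k := by
  have := he.exists_mul_star (IsBlock.star he hu) (star_ne_zero.2 hu0)
  rwa [star_star] at this

/-- Blocks are at most one-dimensional: with uu* = c eᵢ, c ≠ 0, and u*v = d eₖ, one gets cv = uu*v =
du. -/
theorem block_eq_smul (he : IsMinimalFamily M e) {i k : Fin n} {u v : H →L[ℂ] H}
    (hu : IsBlock M e i k u) (hu0 : u ≠ 0) (hv : IsBlock M e i k v) : ∃ c : ℂ, v = c • u := by
  obtain ⟨c, hc, hcu⟩ := he.exists_mul_star hu hu0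
  obtain ⟨d, hd⟩ := he.exists_smul ((IsBlock.star he hu).mul hv)
  refine ⟨c⁻¹ * d, ?_⟩
  have h1 : c • v = d • u := by
    rw [← hv.2.1, ← smul_mul_assoc, ← hcu, mul_assoc, hd, mul_smul_comm, hu.2.2]
  rw [mul_smul, ← h1, smul_smul, inv_mul_cancel₀ hc, one_smul]

/-- Two indices are linked if the block between them is nonzero. -/
def Linked (M : VonNeumannAlgebra H) (e : Fin n → H →L[ℂ] H) (i k : Fin n) : Prop :=
  ∃ u, IsBlock M e i k u ∧ u ≠ 0

theorem linked_equivalence (he : IsMinimalFamily M e) : Equivalence (Linked M e) where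
  refl i := ⟨e i, he.isBlock_self i, he.ne_zero i⟩
  symm := fun ⟨u, hu, hu0⟩ => ⟨star u, IsBlock.star he hu, star_ne_zero.2 hu0⟩
  trans := by
    rintro i j k ⟨u, hu, hu0⟩ ⟨v, hv, hv0⟩
    refine ⟨u * v, hu.mul hv, fun h => hv0 ?_⟩
    obtain ⟨c, hc, hcu⟩ := he.exists_star_mul hu hu0
    have h1 : c • v = 0 := by
      rw [← hv.2.1, ← smul_mul_assoc, ← hcu, mul_assoc, h, mul_zero]
    exact (smul_eq_zero.1 h1).resolve_left hc

theorem eq_sum (he : IsMinimalFamily M e) (x : H →L[ℂ] H) : x = ∑ i, ∑ k, e i * x * e k := by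
  simp_rw [← Finset.mul_sum, he.sum_eq, mul_one, ← Finset.sum_mul, he.sum_eq, one_mul]

/-- Linked indices form the matrix summands of `M`. Choosing a representative `r i` of each class
and a nonzero `u i` in the block from `r i` to `i`, the vectors `u i (ξ (r i))` span one column of
each summand: an invariant space of dimension at most n. -/
theorem repDensity_le (he : IsMinimalFamily M e) : repDensity M ≤ n := by
  classical
  let s : Setoid (Fin n) := ⟨Linked M e, he.linked_equivalence⟩
  let r : Fin n → Fin n := fun i => (Quotient.mk s i).out
  have hr : ∀ i, Linked M e i (r i) := fun i =>
    he.linked_equivalence.symm (Quotient.exact (Quotient.out_eq (Quotient.mk s i)))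
  have hrr : ∀ i k, Linked M e i (r k) → r i = r k := by
    intro i k h
    have : Linked M e i k := he.linked_equivalence.trans h (he.linked_equivalence.symm (hr k))
    exact congrArg Quotient.out (Quotient.sound this : Quotient.mk s i = Quotient.mk s k)
  choose u hu hu0 using hr
  have hξ : ∀ j, ∃ ξ, e j ξ = ξ ∧ ξ ≠ 0 := by
    intro j
    by_contra! h
    refine he.ne_zero j (ContinuousLinearMap.ext fun v => h _ ?_)
    exact congrArg (fun z : H →L[ℂ] H => z v) (he.mul_self j)
  choose ξ hξ hξ0 using hξ
  let K : Submodule ℂ H := Submodule.span ℂ (Set.range fun i => u i (ξ (r i)))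
  have : FiniteDimensional ℂ K := FiniteDimensional.span_of_finite ℂ (Set.finite_range _)
  have : CompleteSpace K := FiniteDimensional.complete ℂ K
  have hinv : ∀ x ∈ M, ∀ k ∈ K, x k ∈ K := by
    intro x hx k hk
    have hle : K ≤ K.comap (x : H →ₗ[ℂ] H) := by
      refine Submodule.span_le.2 ?_
      rintro _ ⟨i, rfl⟩
      change x (u i (ξ (r i))) ∈ K
      have h1 : x (u i (ξ (r i))) = ∑ k, (e k * (x * u i) * e (r i)) (ξ (r i)) := by
        have h2 : ∑ k, e k * (x * u i) * e (r i) = x * u i := by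
          simp_rw [← Finset.sum_mul, he.sum_eq, one_mul, mul_assoc, (hu i).2.2]
        rw [← sum_apply, h2]
        rfl
      rw [h1]
      refine Submodule.sum_mem _ fun k _ => ?_
      have hb : IsBlock M e k (r i) (e k * (x * u i) * e (r i)) :=
        he.isBlock k (r i) (mul_mem hx (hu i).1)
      by_cases h0 : e k * (x * u i) * e (r i) = 0
      · rw [h0]
        exact K.zero_mem
      · have hrk := hrr k i ⟨_, hb, h0⟩
        rw [← hrk] at hb ⊢
        obtain ⟨c, hc⟩ := he.block_eq_smul (hu k) (hu0 k) hb
        rw [hc]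
        exact K.smul_mem c (Submodule.subset_span ⟨k, rfl⟩)
    exact hle hk
  have hfaith : ∀ x ∈ M, (∀ k ∈ K, x k = 0) → x = 0 := by
    intro x hx hxK
    have h1 : ∀ i, x * u i = 0 := by
      intro i
      have h2 : x (u i (ξ (r i))) = 0 := hxK _ (Submodule.subset_span ⟨i, rfl⟩)
      -- This is a scalar multiple of `e (r i)` that kills the nonzero vector `ξ (r i)`, so it is
      -- zero and `x * u i = 0`.
      have hb : IsBlock M e (r i) (r i) (star (x * u i) * (x * u i)) := by
        refine ⟨mul_mem (star_mem (mul_mem hx (hu i).1)) (mul_mem hx (hu i).1), ?_, ?_⟩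
        · rw [← he.star_eq, ← mul_assoc, ← star_mul, mul_assoc, (hu i).2.2]
        · rw [mul_assoc, mul_assoc, (hu i).2.2]
      obtain ⟨c, hc⟩ := he.exists_smul hb
      have h3 : c • ξ (r i) = 0 := by
        have h4 := congrArg (fun z : H →L[ℂ] H => z (ξ (r i))) hc
        change star (x * u i) (x (u i (ξ (r i)))) = c • e (r i) (ξ (r i)) at h4
        rw [h2, map_zero, hξ] at h4
        exact h4.symm
      rw [(smul_eq_zero.1 h3).resolve_right (hξ0 _), zero_smul] at hc
      exact (CStarRing.star_mul_self_eq_zero_iff _).1 hc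
    have h5 : ∀ i, x * e i = 0 := by
      intro i
      obtain ⟨c, hc, hcu⟩ := he.exists_mul_star (hu i) (hu0 i)
      have h6 : c • (x * e i) = 0 := by
        rw [← mul_smul_comm, ← hcu, ← mul_assoc, h1, zero_mul]
      exact (smul_eq_zero.1 h6).resolve_left hc
    rw [← mul_one x, ← he.sum_eq, Finset.mul_sum]
    exact Finset.sum_eq_zero fun i _ => h5 i
  refine (repDensity_le_hilbertDim M K hinv hfaith).trans ((hilbertDim_le_rank K).trans ?_)
  refine (rank_span_le _).trans ?_
  have h1 := mk_range_le_lift (f := fun i => u i (ξ (r i)))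
  rwa [lift_uzero, mk_fin, lift_natCast] at h1

/-- The generator is a + ib with self-adjoint a and b. Here a = ∑ i eᵢ has distinct coefficients, so
commuting with it forces commuting with every eᵢ; b contains a spanning element of each block above
the diagonal, recovered as eᵢ b eₖ. -/
theorem gen_eq_one (he : IsMinimalFamily M e) : gen M = 1 := by
  classical
  have hw : ∀ i k, ∃ w, IsBlock M e i k w ∧ (w = 0 → ∀ v, IsBlock M e i k v → v = 0) := by
    intro i k
    by_cases h : Linked M e i k
    · obtain ⟨u, hu, hu0⟩ := h
      exact ⟨u, hu, fun h => (hu0 h).elim⟩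
    · refine ⟨0, ⟨zero_mem M, by simp, by simp⟩, fun _ v hv => ?_⟩
      by_contra hv0
      exact h ⟨v, hv, hv0⟩
  choose w hw hw0 using hw
  let a : H →L[ℂ] H := ∑ i : Fin n, ((i : ℕ) : ℂ) • e i
  let b : H →L[ℂ] H := ∑ i, ∑ k, if i < k then w i k + star (w i k) else 0
  have haM : a ∈ M := sum_mem fun i _ => smul_mem' _ (he.mem i)
  have hbM : b ∈ M := sum_mem fun i _ => sum_mem fun k _ => by
    split_ifs
    · exact add_mem (hw i k).1 (star_mem (hw i k).1)
    · exact zero_mem M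
  have has : star a = a := by
    simp only [a, star_sum, star_smul, he.star_eq]
    simp
  have hbs : star b = b := by
    simp only [b, star_sum]
    refine Finset.sum_congr rfl fun i _ => Finset.sum_congr rfl fun k _ => ?_
    split_ifs
    · rw [star_add, star_star, add_comm]
    · exact star_zero _
  have hea : ∀ i, e i * a = ((i : ℕ) : ℂ) • e i := fun i => by
    simp only [a, Finset.mul_sum, mul_smul_comm]
    rw [Finset.sum_eq_single i (fun j _ hj => by rw [he.ortho i j hj.symm, smul_zero]) (by simp),
      he.mul_self]
  have hae : ∀ i, a * e i = ((i : ℕ) : ℂ) • e i := fun i => by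
    simp only [a, Finset.sum_mul, smul_mul_assoc]
    rw [Finset.sum_eq_single i (fun j _ hj => by rw [he.ortho j i hj, smul_zero]) (by simp),
      he.mul_self]
  have hblock : ∀ p q i k v, IsBlock M e p q v → ¬ (i = p ∧ k = q) → e i * v * e k = 0 := by
    intro p q i k v hv hne
    rw [← hv.2.1, ← hv.2.2]
    by_cases hip : i = p
    · have hkq : q ≠ k := fun h => hne ⟨hip, h.symm⟩
      simp only [mul_assoc, he.ortho q k hkq, mul_zero]
    · simp only [← mul_assoc, he.ortho i p hip, zero_mul]
  have hebe : ∀ i k, i < k → e i * b * e k = w i k := by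
    intro i k hik
    simp only [b, Finset.mul_sum, Finset.sum_mul]
    rw [Finset.sum_eq_single i, Finset.sum_eq_single k]
    · rw [if_pos hik, mul_add, add_mul, hblock k i i k _ (IsBlock.star he (hw i k))
        (fun h => hik.ne h.1), add_zero, (hw i k).2.1, (hw i k).2.2]
    · intro q _ hq
      split_ifs with hiq
      · rw [mul_add, add_mul, hblock i q i k _ (hw i q) (fun h => hq h.2.symm),
          hblock q i i k _ (IsBlock.star he (hw i q)) (fun h => hiq.ne h.1), add_zero]
      · rw [mul_zero, zero_mul]
    · simp
    · intro p _ hp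
      refine Finset.sum_eq_zero fun q _ => ?_
      split_ifs with hpq
      · rw [mul_add, add_mul, hblock p q i k _ (hw p q) (fun h => hp h.1.symm),
          hblock q p i k _ (IsBlock.star he (hw p q)) (fun h => ?_), add_zero]
        rw [h.1, h.2] at hik
        exact lt_asymm hik hpq
      · rw [mul_zero, zero_mul]
    · simp
  let x : H →L[ℂ] H := a + Complex.I • b
  have hsx : star x = a - Complex.I • b := by
    simp only [x, star_add, star_smul, has, hbs]
    simp [sub_eq_add_neg]
  have key : ∀ y, x * y = y * x → star x * y = y * star x →
      (∀ i, e i * y = y * e i) ∧ ∀ i k, i < k → w i k * y = y * w i k := by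
    intro y hy hy'
    have hya : a * y = y * a := by
      have h2 : a = (1 / 2 : ℂ) • (x + star x) := by
        rw [hsx]
        simp only [x]
        module
      rw [h2, smul_mul_assoc, mul_smul_comm, add_mul, mul_add, hy, hy']
    have hyb : b * y = y * b := by
      have h2 : b = (-Complex.I / 2 : ℂ) • (x - star x) := by
        rw [hsx]
        have : a + Complex.I • b - (a - Complex.I • b) = (2 * Complex.I) • b := by module
        simp only [x]
        rw [this, smul_smul]
        have : -Complex.I / 2 * (2 * Complex.I) = 1 := by
          linear_combination -Complex.I_mul_I
        rw [this, one_smul]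
      rw [h2, smul_mul_assoc, mul_smul_comm, sub_mul, mul_sub, hy, hy']
    have hoff : ∀ i k, i ≠ k → e i * y * e k = 0 := by
      intro i k hik
      have h1 : e i * (a * y) * e k = ((i : ℕ) : ℂ) • (e i * y * e k) := by
        rw [← mul_assoc, hea, smul_mul_assoc, smul_mul_assoc]
      have h2 : e i * (y * a) * e k = ((k : ℕ) : ℂ) • (e i * y * e k) := by
        rw [mul_assoc, mul_assoc y, hae, mul_smul_comm, mul_smul_comm, mul_assoc]
      rw [hya, h2, ← sub_eq_zero, ← sub_smul, smul_eq_zero] at h1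
      refine h1.resolve_left fun h => hik ?_
      rw [sub_eq_zero] at h
      exact Fin.ext (by exact_mod_cast h.symm)
    have hye : ∀ k, e k * y = y * e k := by
      intro k
      have h1 : e k * y = e k * y * e k := by
        conv_lhs => rw [← mul_one (e k * y), ← he.sum_eq, Finset.mul_sum]
        exact Finset.sum_eq_single k (fun i _ hi => hoff k i hi.symm) (by simp)
      have h2 : y * e k = e k * y * e k := by
        conv_lhs => rw [← one_mul (y * e k), ← he.sum_eq, Finset.sum_mul]
        simp_rw [← mul_assoc]
        exact Finset.sum_eq_single k (fun i _ hi => hoff i k hi) (by simp)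
      rw [h1, h2]
    refine ⟨hye, fun i k hik => ?_⟩
    rw [← hebe i k hik, mul_assoc, hye, ← mul_assoc, mul_assoc (e i), hyb, ← mul_assoc, hye]
    simp only [mul_assoc]
  have hgen : Generates M {x} := by
    refine generates_of_forall_mem_commutant
      (Set.singleton_subset_iff.2 (add_mem haM (smul_mem' _ hbM))) fun y hy hy' => ?_
    have h1 := hy x rfl
    have h2 := hy' x rfl
    obtain ⟨hye, hyw⟩ := key y h1 h2
    -- Blocks below the diagonal are adjoints of blocks above it, so they are handled through `star
    -- y`.
    obtain ⟨-, hyw'⟩ := key (star y) (by simpa using (congrArg star h2).symm)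
      (by simpa using (congrArg star h1).symm)
    rw [VonNeumannAlgebra.mem_commutant_iff]
    intro m hm
    have hmik : ∀ i k, (e i * m * e k) * y = y * (e i * m * e k) := by
      have hsmul : ∀ i k v, IsBlock M e i k v → ∃ c : ℂ, v = c • w i k := by
        intro i k v hv
        by_cases h0 : w i k = 0
        · exact ⟨0, by rw [hw0 i k h0 v hv, zero_smul]⟩
        · exact he.block_eq_smul (hw i k) h0 hv
      intro i k
      rcases lt_trichotomy i k with hik | rfl | hik
      · obtain ⟨c, hc⟩ := hsmul i k _ (he.isBlock i k hm)
        rw [hc, smul_mul_assoc, mul_smul_comm, hyw i k hik]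
      · obtain ⟨c, hc⟩ := he.corner i hm
        rw [hc, smul_mul_assoc, mul_smul_comm, hye]
      · obtain ⟨c, hc⟩ := hsmul k i _ (IsBlock.star he (he.isBlock i k hm))
        have h3 : star (e i * m * e k) * star y = star y * star (e i * m * e k) := by
          rw [hc, smul_mul_assoc, mul_smul_comm, hyw' k i hik]
        rw [← star_mul, ← star_mul] at h3
        exact (star_injective h3).symm
    rw [he.eq_sum m]
    simp only [Finset.sum_mul, Finset.mul_sum, hmik]
  refine le_antisymm ?_ (one_le_gen M)
  have := hgen.gen_le (by rw [mk_singleton])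
  rwa [mk_singleton] at this

end IsMinimalFamily

/-! ### Representation density, generators and decomposability -/

section Relations

variable {H : Type u} [NormedAddCommGroup H] [InnerProductSpace ℂ H] [CompleteSpace H]
variable (M : VonNeumannAlgebra H)

theorem dec_center_le : dec (center M) ≤ dec M :=
  ciSup_le' fun P => IsOrthoFamily.mk_le_dec (M := M)
    ⟨fun p hp => ⟨(P.2.1 p hp).1.1, (P.2.1 p hp).2⟩, P.2.2⟩

theorem one_le_dec [Nontrivial H] : 1 ≤ dec M := by
  have := mk_le_dec (M := M) (fun _ : PUnit.{u + 1} => 1) (fun _ => one_mem M)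
    (fun _ => .one _) (fun _ => one_ne_zero) fun i j h => (h (Subsingleton.elim i j)).elim
  rwa [mk_punit] at this

/-- A nonzero projection fixes a unit vector. -/
theorem exists_norm_eq_one_of_isStarProjection {p : H →L[ℂ] H} (hp : IsStarProjection p)
    (hp0 : p ≠ 0) : ∃ v, ‖v‖ = 1 ∧ p v = v := by
  obtain ⟨w, hw⟩ : ∃ w, p w ≠ 0 := by
    by_contra! h
    exact hp0 (ContinuousLinearMap.ext h)
  refine ⟨((‖p w‖ : ℂ)⁻¹) • p w, ?_, ?_⟩
  · rw [norm_smul, norm_inv, Complex.norm_real, norm_norm,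
      inv_mul_cancel₀ (norm_ne_zero_iff.2 hw)]
  · rw [map_smul, ← mul_apply_eq_comp, hp.isIdempotentElem.eq]

theorem inner_eq_zero_of_mul_eq_zero {p q : H →L[ℂ] H} (hp : IsStarProjection p)
    (hpq : p * q = 0) {v w : H} (hv : p v = v) : ⟪v, q w⟫_ℂ = 0 := by
  rw [← hv, ← hp.isSelfAdjoint.star_eq, star_inner_left, ← mul_apply_eq_comp, hpq]
  simp

theorem mk_le_hilbertDim_of_isStarProjection {ι : Type u} (p : ι → H →L[ℂ] H)
    (hp : ∀ i, IsStarProjection (p i)) (hp0 : ∀ i, p i ≠ 0)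
    (hpp : ∀ i j, i ≠ j → p i * p j = 0) : #ι ≤ hilbertDim H := by
  choose v hv hpv using fun i => exists_norm_eq_one_of_isStarProjection (hp i) (hp0 i)
  refine mk_orthonormal_le_hilbertDim (v := v) ⟨hv, fun i j hij => ?_⟩
  change ⟪v i, v j⟫_ℂ = 0
  rw [← hpv j]
  exact inner_eq_zero_of_mul_eq_zero (hp i) (hpp i j hij) (hpv i)

theorem dec_le_repDensity : dec M ≤ repDensity M := by
  obtain ⟨K, _, _, _, π, hπ, hK⟩ := exists_rep_hilbertDim_eq M
  rw [← hK]
  refine ciSup_le' fun P => ?_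
  let e : P.1 → Elt M := fun p => ⟨p.1, (P.2.1 p.1 p.2).1⟩
  have he : ∀ p, IsStarProjection (e p) := fun p =>
    ⟨Subtype.ext (P.2.1 p.1 p.2).2.1.isIdempotentElem.eq,
      Subtype.ext (P.2.1 p.1 p.2).2.1.isSelfAdjoint.star_eq⟩
  refine mk_le_hilbertDim_of_isStarProjection (fun p => π (e p)) (fun p => (he p).map π)
    (fun p h => ?_) fun p q hpq => ?_
  · exact (P.2.1 p.1 p.2).2.2 (congrArg Subtype.val (hπ.injective (h.trans (map_zero π).symm)))
  · rw [← map_mul, show e p * e q = 0 from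
      Subtype.ext (P.2.2 p.2 q.2 fun h => hpq (Subtype.ext h)), map_zero]

theorem one_le_repDensity [Nontrivial H] : 1 ≤ repDensity M :=
  (one_le_dec M).trans (dec_le_repDensity M)

theorem densPredual_le_of_dense_span (L : Set (Predual M))
    (hL : ∀ φ : Predual M, φ ∈ closure (Submodule.span ℂ L : Set (Predual M))) :
    densPredual M ≤ max ℵ₀ #L := by
  obtain ⟨D, hD, hLD⟩ := exists_dense_subset_span L
  exact (densityChar_le (s := D) fun φ => hLD (hL φ)).trans hD

section Representation

variable {M} {K : Type u} [NormedAddCommGroup K] [InnerProductSpace ℂ K] [CompleteSpace K]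
  {π : Elt M →⋆ₐ[ℂ] (K →L[ℂ] K)}

omit [CompleteSpace K] in
theorem continuous_inner_apply_sigmaWeak (h k : K) :
    @Continuous _ _ (sigmaWeak K) _ fun y : K →L[ℂ] K => ⟪h, y k⟫_ℂ := by
  have h1 : (fun y : K →L[ℂ] K => ⟪h, y k⟫_ℂ) = fun y =>
      ⟪(lp.single 2 0 h : SqSum K), amplify y (lp.single 2 0 k)⟫_ℂ := by
    ext y
    rw [amplify_single, lp.inner_single_left, lp.single_apply_self]
  rw [h1]
  exact continuous_iInf_dom (i := ((lp.single 2 0 h : SqSum K), (lp.single 2 0 k : SqSum K)))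
    continuous_induced_dom

/-- The matrix coefficient `x ↦ ⟪h, π(x) k⟫` of a normal representation. -/
noncomputable def IsFaithfulNormalRep.coeff (hπ : IsFaithfulNormalRep M π) (h k : K) :
    Predual M :=
  Predual.mk
    { toFun := fun x => ⟪h, π x k⟫_ℂ
      map_add' := fun x y => by rw [map_add, add_apply, inner_add_right]
      map_smul' := fun c x => by
        rw [map_smul, smul_apply, inner_smul_right, RingHom.id_apply, smul_eq_mul] }
    (@Continuous.comp _ _ _ (sWeak M) (sigmaWeak K) _ _ _
      (continuous_inner_apply_sigmaWeak h k) hπ.normal)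

end Representation

/-- The matrix coefficients against a Hilbert basis of a minimal faithful normal representation
separate points, hence have dense span. -/
theorem exists_dense_span_mk_le_repDensity : ∃ L : Set (Predual M),
    (∀ φ : Predual M, φ ∈ closure (Submodule.span ℂ L : Set (Predual M))) ∧
      #L ≤ repDensity M * repDensity M := by
  obtain ⟨K, _, _, _, π, hπ, hK⟩ := exists_rep_hilbertDim_eq M
  obtain ⟨ι, b, hι⟩ := exists_hilbertBasis_mk_eq K
  refine ⟨Set.range fun p : ι × ι => hπ.coeff (b p.1) (b p.2), ?_, ?_⟩
  · refine span_dense_of_separating M _ fun x hx => hπ.injective ?_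
    rw [map_zero]
    have h1 : ∀ j k, ⟪b j, π x (b k)⟫_ℂ = 0 := fun j k => hx _ ⟨(j, k), rfl⟩
    refine ContinuousLinearMap.ext_on (Submodule.dense_iff_topologicalClosure_eq_top.2
      b.dense_span) ?_
    rintro _ ⟨k, rfl⟩
    refine b.repr.injective (lp.ext (funext fun j => ?_))
    rw [b.repr_apply_apply, h1, b.repr_apply_apply, zero_apply, inner_zero_right]
  · rw [← hK, ← hι, mul_def]
    exact mk_range_le

theorem gen_le_aleph0_mul_gen : gen M ≤ ℵ₀ * gen M :=
  le_mul_left aleph0_ne_zero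

theorem aleph0_le_aleph0_mul_gen : ℵ₀ ≤ ℵ₀ * gen M :=
  le_mul_right (Cardinal.one_le_iff_ne_zero.1 (one_le_gen M))

variable [Nontrivial H]

theorem aleph0_mul_repDensity_eq : ℵ₀ * repDensity M = max ℵ₀ (repDensity M) :=
  mul_eq_max_of_aleph0_le_left le_rfl (Cardinal.one_le_iff_ne_zero.1 (one_le_repDensity M))

theorem max_aleph0_repDensity_mul_self_le :
    max ℵ₀ (repDensity M * repDensity M) ≤ ℵ₀ * repDensity M := by
  refine max_le ?_ ?_
  · exact (aleph0_mul_repDensity_eq M).symm ▸ le_max_left _ _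
  · have h1 : ℵ₀ ≤ ℵ₀ * repDensity M := (aleph0_mul_repDensity_eq M).symm ▸ le_max_left _ _
    have h2 : repDensity M ≤ ℵ₀ * repDensity M :=
      (aleph0_mul_repDensity_eq M).symm ▸ le_max_right _ _
    exact (mul_le_mul' h2 h2).trans (mul_eq_self h1).le

theorem densPredual_le : densPredual M ≤ ℵ₀ * repDensity M := by
  obtain ⟨L, hL, hLr⟩ := exists_dense_span_mk_le_repDensity M
  exact (densPredual_le_of_dense_span M L hL).trans
    ((max_le_max le_rfl hLr).trans (max_aleph0_repDensity_mul_self_le M))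

theorem gen_le_aleph0_mul_repDensity : gen M ≤ ℵ₀ * repDensity M := by
  obtain ⟨L, hL, hLr⟩ := exists_dense_span_mk_le_repDensity M
  exact (gen_le_of_dense_span M L hL).trans
    ((max_le_max le_rfl hLr).trans (max_aleph0_repDensity_mul_self_le M))

theorem repDensity_le_dec_center_mul : repDensity M ≤ dec (center M) * (ℵ₀ * gen M) := by
  obtain ⟨S, hS, hSg⟩ := exists_generates_mk_le_gen M
  obtain ⟨V, hV⟩ := hS.exists_isCyclicDecomposition
  exact (hV.repDensity_le hS (aleph0_le_aleph0_mul_gen M)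
    (hSg.trans (gen_le_aleph0_mul_gen M))).trans (mul_le_mul_left (hV.mk_le_dec_center hS) _)

theorem repDensity_le_two_power : repDensity M ≤ 2 ^ (ℵ₀ * gen M) := by
  obtain ⟨S, hS, hSg⟩ := exists_generates_mk_le_gen M
  obtain ⟨V, hV⟩ := hS.exists_isCyclicDecomposition
  have hκ := aleph0_le_aleph0_mul_gen M
  have hSκ := hSg.trans (gen_le_aleph0_mul_gen M)
  refine (hV.repDensity_le hS hκ hSκ).trans ?_
  refine (mul_le_mul' (hV.mk_le_two_power hS hκ hSκ) (cantor _).le).trans ?_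
  exact (mul_eq_self (hκ.trans (cantor _).le)).le

/-- The general bounds carry a factor ℵ₀, which is absorbed if `dec M` is infinite. The finite case
needs exact values and rests on minimal projections. -/
theorem gen_mul_dec : gen M * dec M = repDensity M := by
  rcases lt_or_ge (dec M) ℵ₀ with h | h
  · obtain ⟨n, e, he, hn⟩ := exists_isMinimalFamily h
    rw [he.gen_eq_one, one_mul]
    exact (dec_le_repDensity M).antisymm (he.repDensity_le.trans hn.le)
  · have h1 : ℵ₀ ≤ repDensity M := h.trans (dec_le_repDensity M)
    refine le_antisymm ?_ ?_
    · have h2 := gen_le_aleph0_mul_repDensity M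
      rw [aleph0_mul_eq h1] at h2
      exact (mul_le_mul' h2 (dec_le_repDensity M)).trans (mul_eq_self h1).le
    · refine (repDensity_le_dec_center_mul M).trans
        ((mul_le_mul_left (dec_center_le M) _).trans ?_)
      rw [← mul_assoc, mul_aleph0_eq h, mul_comm]

end Relations

/-! ### The density character of the predual -/

section DensPredual

variable {H : Type u} [NormedAddCommGroup H] [InnerProductSpace ℂ H] [CompleteSpace H]
variable (M : VonNeumannAlgebra H)

/-- Choose a unit vector in the range of each projection. The difference of two of the resulting
vector functionals takes the value 1 at one of the projections, so they are 1-separated. -/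
theorem dec_le_densPredual : dec M ≤ densPredual M := by
  obtain ⟨D, hD, hDc⟩ := exists_dense_mk_eq_densityChar (Predual M) inferInstance
  refine ciSup_le' fun P => ?_
  choose v hv hpv using fun p : P.1 =>
    exists_norm_eq_one_of_isStarProjection (P.2.1 p.1 p.2).2.1 (P.2.1 p.1 p.2).2.2
  refine (mk_le_of_separated (δ := 1) (fun p : P.1 => coeffFun M (v p) (v p)) ?_ D ?_).trans hDc.le
  · intro p q hpq
    let e : Elt M := ⟨p.1, (P.2.1 p.1 p.2).1⟩
    have he : ‖e‖ ≤ 1 := (P.2.1 p.1 p.2).2.1.norm_le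
    have h1 : (coeffFun M (v p) (v p) - coeffFun M (v q) (v q)).1 e = 1 := by
      change (coeffFun M (v p) (v p)).1 e - (coeffFun M (v q) (v q)).1 e = 1
      rw [coeffFun_apply, coeffFun_apply, hpv, inner_self_eq_norm_sq_to_K, hv,
        inner_eq_zero_of_mul_eq_zero (P.2.1 q.1 q.2).2.1
          (P.2.2 q.2 p.2 fun h => hpq (Subtype.ext h.symm)) (hpv q)]
      simp
    have h2 := Predual.norm_apply_le (coeffFun M (v p) (v p) - coeffFun M (v q) (v q)) e
    rw [h1, norm_one] at h2
    rw [dist_eq_norm]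
    exact h2.trans (mul_le_of_le_one_right (norm_nonneg _) he)
  · intro p
    obtain ⟨d, hd, h⟩ := hD.exists_dist_lt (coeffFun M (v p) (v p)) (half_pos one_pos)
    exact ⟨d, hd, h⟩

theorem densPredual_le_mk : densPredual M ≤ #(Predual M) :=
  (densityChar_le (s := Set.univ) dense_univ).trans mk_univ.le

variable [Nontrivial H]

theorem nontrivial_predual : Nontrivial (Predual M) := by
  obtain ⟨v, hv⟩ := exists_ne (0 : H)
  refine ⟨coeffFun M v v, 0, fun h => hv (inner_self_eq_zero (𝕜 := ℂ).1 ?_)⟩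
  have h1 : (coeffFun M v v).1 1 = (0 : Predual M).1 1 := by rw [h]
  rwa [coeffFun_apply] at h1

theorem continuum_le_mk_predual : 𝔠 ≤ #(Predual M) := by
  have := nontrivial_predual M
  have h : Cardinal.lift.{u} #ℂ ≤ Cardinal.lift.{0} #(Predual M) := by
    obtain ⟨φ, hφ⟩ := exists_ne (0 : Predual M)
    exact lift_mk_le'.2 ⟨⟨fun c => c • φ, smul_left_injective ℂ hφ⟩⟩
  simpa using h

theorem aleph0_le_densPredual : ℵ₀ ≤ densPredual M := by
  obtain ⟨D, hD, hDc⟩ := exists_dense_mk_eq_densityChar (Predual M) inferInstance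
  rw [densPredual, ← hDc]
  by_contra! h
  have hfin : D.Finite := lt_aleph0_iff_set_finite.1 h
  have huniv : D = Set.univ := by rw [← hfin.isClosed.closure_eq, hD.closure_eq]
  rw [huniv, mk_univ] at h
  exact absurd ((aleph0_le_continuum.trans (continuum_le_mk_predual M)).trans_lt h) (lt_irrefl _)

theorem gen_le_densPredual : gen M ≤ densPredual M := by
  obtain ⟨D, hD, hDc⟩ := exists_dense_mk_eq_densityChar (Predual M) inferInstance
  refine (gen_le_of_dense_span M D fun φ => closure_mono Submodule.subset_span (hD φ)).trans ?_
  rw [hDc]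
  exact max_le (aleph0_le_densPredual M) le_rfl

theorem aleph0_mul_repDensity : ℵ₀ * repDensity M = densPredual M := by
  refine le_antisymm ?_ (densPredual_le M)
  have h := aleph0_le_densPredual M
  refine (mul_le_mul' h ?_).trans (mul_eq_self h).le
  rw [← gen_mul_dec]
  exact (mul_le_mul' (gen_le_densPredual M) (dec_le_densPredual M)).trans (mul_eq_self h).le

end DensPredual

/-! ### The cardinality of the predual -/

section Cardinality

theorem mk_le_power_aleph0_of_dense {X : Type u} [MetricSpace X] {D : Set X} (hD : Dense D) :
    #X ≤ #D ^ (ℵ₀ : Cardinal.{u}) := by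
  choose s hs hsx using fun x => mem_closure_iff_seq_limit.1 (hD x)
  have h : #X ≤ #(ULift.{u} ℕ → D) :=
    mk_le_of_injective (f := fun x n => (⟨s x n.down, hs x n.down⟩ : D)) fun x y hxy =>
      tendsto_nhds_unique (hsx x) ((hsx y).congr fun n =>
        (congrArg Subtype.val (congrFun hxy ⟨n⟩)).symm)
  rwa [← power_def, mk_uLift, mk_nat, lift_aleph0] at h

/-- If a series `∑ 16⁻ⁿ aₙ` with bounded coefficients sums to zero, then its first nonzero
coefficient is small. -/
theorem norm_le_of_hasSum_zero {a : ℕ → ℂ} {C : ℝ} (ha : ∀ m, ‖a m‖ ≤ C)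
    (h : HasSum (fun m => (16⁻¹ : ℂ) ^ m * a m) 0) {n : ℕ} (hn : ∀ m < n, a m = 0) :
    ‖a n‖ ≤ C / 15 := by
  have h1 := (hasSum_nat_add_iff' (n + 1)).2 h
  rw [Finset.sum_range_succ, Finset.sum_eq_zero fun m hm => by
    rw [hn m (Finset.mem_range.1 hm), mul_zero], zero_add, zero_sub] at h1
  -- The tail beyond n is at most 16⁻⁽ⁿ⁺¹⁾·C·16/15 = 16⁻ⁿ·C/15.
  have h2 : HasSum (fun m : ℕ => (16⁻¹ : ℝ) ^ (n + 1) * C * 16⁻¹ ^ m)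
      ((16⁻¹ : ℝ) ^ (n + 1) * C * (1 - 16⁻¹)⁻¹) :=
    (hasSum_geometric_of_lt_one (by norm_num) (by norm_num)).mul_left _
  have h3 := tsum_of_norm_bounded (f := fun m => (16⁻¹ : ℂ) ^ (m + (n + 1)) * a (m + (n + 1))) h2
    fun m => by
      rw [norm_mul, norm_pow, norm_inv, RCLike.norm_ofNat, pow_add]
      calc _ ≤ (16⁻¹ : ℝ) ^ m * 16⁻¹ ^ (n + 1) * C :=
            mul_le_mul_of_nonneg_left (ha _) (by positivity)
        _ = _ := by ring
  rw [h1.tsum_eq, norm_neg, norm_mul, norm_pow, norm_inv, RCLike.norm_ofNat] at h3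
  have h4 : (0 : ℝ) < 16⁻¹ ^ n := by positivity
  refine le_of_mul_le_mul_left (h3.trans_eq ?_) h4
  rw [pow_succ]
  ring

variable {H : Type u} [NormedAddCommGroup H] [InnerProductSpace ℂ H]

/-- The sequence `4⁻ⁿ hₙ` for a bounded sequence `h`. -/
noncomputable def geomSeq (h : ℕ → H) (hh : ∀ n, ‖h n‖ ≤ 1) : SqSum H :=
  ⟨fun n => (4⁻¹ : ℂ) ^ n • h n, memℓp_gen (by
    refine Summable.of_nonneg_of_le (fun n => by positivity) (fun n => ?_)
      (summable_geometric_of_lt_one (r := (4⁻¹ : ℝ)) (by norm_num) (by norm_num))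
    rw [norm_smul, norm_pow, norm_inv, RCLike.norm_ofNat, ENNReal.toReal_ofNat]
    have h1 : (4⁻¹ : ℝ) ^ n * ‖h n‖ ≤ 4⁻¹ ^ n := mul_le_of_le_one_right (by positivity) (hh n)
    have h2 : (4⁻¹ : ℝ) ^ n ≤ 1 := pow_le_one₀ (by norm_num) (by norm_num)
    have h3 : (0 : ℝ) ≤ (4⁻¹ : ℝ) ^ n * ‖h n‖ := by positivity
    rw [Real.rpow_ofNat]
    nlinarith)⟩

variable [CompleteSpace H] (M : VonNeumannAlgebra H)

theorem hasSum_vecFun_geomSeq (h k : ℕ → H) (hh : ∀ n, ‖h n‖ ≤ 1) (hk : ∀ n, ‖k n‖ ≤ 1)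
    (x : Elt M) : HasSum (fun n => (16⁻¹ : ℂ) ^ n * (coeffFun M (h n) (k n)).1 x)
      ((vecFun M (geomSeq h hh) (geomSeq k hk)).1 x) := by
  rw [vecFun_apply]
  convert! lp.hasSum_inner (𝕜 := ℂ) (geomSeq h hh) (amplify x.1 (geomSeq k hk)) using 2 with n
  change _ = ⟪(4⁻¹ : ℂ) ^ n • h n, x.1 ((4⁻¹ : ℂ) ^ n • k n)⟫_ℂ
  rw [coeffFun_apply, map_smul, inner_smul_left, inner_smul_right, ← mul_assoc, map_pow, map_inv₀,
    Complex.conj_ofNat, ← mul_pow]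
  norm_num

/-- The functionals `x ↦ ⟪h, x k⟫` with `h` and `k` in the unit ball. -/
def ballCoeff : Set (Predual M) :=
  (fun p : H × H => coeffFun M p.1 p.2) '' {p | ‖p.1‖ ≤ 1 ∧ ‖p.2‖ ≤ 1}

theorem norm_le_one_of_mem_ballCoeff {φ : Predual M} (hφ : φ ∈ ballCoeff M) : ‖φ‖ ≤ 1 := by
  obtain ⟨p, hp, rfl⟩ := hφ
  exact (norm_coeffFun_le M _ _).trans (mul_le_one₀ hp.1 (norm_nonneg _) hp.2)

/-- A sequence (φₙ) in `T` is coded by ∑ 16⁻ⁿφₙ, which is normal since the weight splits as 4⁻ⁿ on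
each of the two vectors. At the first index where two sequences with the same code differ, their
terms would be within 2/15 < 1/2. -/
theorem mk_power_aleph0_le_of_separated {T : Set (Predual M)} (hT : T ⊆ ballCoeff M)
    (hsep : T.Pairwise fun φ ψ => 1 / 2 ≤ dist φ ψ) :
    #T ^ (ℵ₀ : Cardinal.{u}) ≤ #(Predual M) := by
  choose p hp hpφ using fun φ : T => hT φ.2
  let Φ : (ULift.{u} ℕ → T) → Predual M := fun s =>
    vecFun M (geomSeq (fun n => (p (s ⟨n⟩)).1) fun n => (hp _).1)
      (geomSeq (fun n => (p (s ⟨n⟩)).2) fun n => (hp _).2)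
  have hΦ : ∀ s x, HasSum (fun n => (16⁻¹ : ℂ) ^ n * (s ⟨n⟩).1.1 x) ((Φ s).1 x) := by
    intro s x
    have := hasSum_vecFun_geomSeq M (fun n => (p (s ⟨n⟩)).1) (fun n => (p (s ⟨n⟩)).2)
      (fun n => (hp _).1) (fun n => (hp _).2) x
    simp_rw [show ∀ φ, coeffFun M (p φ).1 (p φ).2 = φ.1 from hpφ] at this
    exact this
  have hinj : Function.Injective Φ := by
    intro s t hst
    by_contra hne
    have hex : ∃ n, s ⟨n⟩ ≠ t ⟨n⟩ := by
      by_contra! h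
      exact hne (funext fun n => h n.down)
    classical
    let n := Nat.find hex
    have hlt : ∀ m < n, s ⟨m⟩ = t ⟨m⟩ := fun m hm => not_not.1 (Nat.find_min hex hm)
    have h1 : ‖((s ⟨n⟩).1 - (t ⟨n⟩).1 : Predual M)‖ ≤ 2 / 15 := by
      refine ContinuousLinearMap.opNorm_le_bound _ (by norm_num) fun x => ?_
      have h2 := (hΦ s x).sub (hΦ t x)
      rw [hst, sub_self] at h2
      simp_rw [← mul_sub] at h2
      refine (norm_le_of_hasSum_zero (C := 2 * ‖x‖) (fun m => ?_) h2 fun m hm => ?_).trans_eq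
        (by ring)
      · have hb : ∀ r : T, ‖r.1.1 x‖ ≤ ‖x‖ := fun r =>
          (Predual.norm_apply_le r.1 x).trans (mul_le_of_le_one_left (norm_nonneg _)
            (norm_le_one_of_mem_ballCoeff M (hT r.2)))
        exact (norm_sub_le _ _).trans ((add_le_add (hb _) (hb _)).trans_eq (two_mul _).symm)
      · rw [hlt m hm, sub_self]
    have h3 : 1 / 2 ≤ dist (s ⟨n⟩).1 (t ⟨n⟩).1 :=
      hsep (s ⟨n⟩).2 (t ⟨n⟩).2 fun h => Nat.find_spec hex (Subtype.ext h)
    rw [dist_eq_norm] at h3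
    linarith [h3.trans h1]
  have := mk_le_of_injective hinj
  rwa [← power_def, mk_uLift, mk_nat, lift_aleph0] at this

/-- If a maximal separated set vanishes at `x`, every vector functional of the unit ball is within
1/2 of it, so ‖x‖ ≤ ‖x‖/2 and x = 0. The set thus separates points and its span is dense. -/
theorem exists_separated_dense_span : ∃ T ⊆ ballCoeff M,
    (T.Pairwise fun φ ψ => 1 / 2 ≤ dist φ ψ) ∧
      ∀ φ : Predual M, φ ∈ closure (Submodule.span ℂ T : Set (Predual M)) := by
  obtain ⟨T, hT⟩ := zorn_subset
    {T : Set (Predual M) | T ⊆ ballCoeff M ∧ T.Pairwise fun φ ψ => 1 / 2 ≤ dist φ ψ}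
    fun c hc hchain => ⟨⋃₀ c, ⟨Set.sUnion_subset fun t ht => (hc ht).1,
      (Set.pairwise_sUnion hchain.directedOn).2 fun t ht => (hc ht).2⟩,
      fun t ht => Set.subset_sUnion_of_mem ht⟩
  refine ⟨T, hT.prop.1, hT.prop.2, span_dense_of_separating M T fun x hx => ?_⟩
  have h1 : ∀ h k : H, ‖h‖ ≤ 1 → ‖k‖ ≤ 1 → ‖⟪h, x.1 k⟫_ℂ‖ ≤ 1 / 2 * ‖x‖ := by
    intro h k hh hk
    obtain ⟨ψ, hψ, hd⟩ : ∃ ψ ∈ T, dist (coeffFun M h k) ψ ≤ 1 / 2 := by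
      by_contra! hcon
      have hins := hT.le_of_ge (y := insert (coeffFun M h k) T)
        ⟨Set.insert_subset ⟨(h, k), ⟨hh, hk⟩, rfl⟩ hT.prop.1,
          hT.prop.2.insert fun ψ hψ _ => ⟨(hcon ψ hψ).le, by
            rw [dist_comm]; exact (hcon ψ hψ).le⟩⟩ (Set.subset_insert _ _)
      have := hcon _ (hins (Set.mem_insert _ _))
      rw [dist_self] at this
      linarith
    have h2 := Predual.norm_apply_le (coeffFun M h k - ψ) x
    have h3 : (coeffFun M h k - ψ).1 x = ⟪h, x.1 k⟫_ℂ - ψ.1 x := by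
      rw [← coeffFun_apply]; rfl
    rw [h3, hx ψ hψ, sub_zero, ← dist_eq_norm] at h2
    exact h2.trans (mul_le_mul_of_nonneg_right hd (norm_nonneg _))
  have h2 : ‖x‖ ≤ 1 / 2 * ‖x‖ := by
    refine ContinuousLinearMap.opNorm_le_bound _ (by positivity) fun k => ?_
    change ‖x.1 k‖ ≤ 1 / 2 * ‖x‖ * ‖k‖
    by_cases hk : k = 0
    · simp [hk]
    by_cases hxk : x.1 k = 0
    · rw [hxk, norm_zero]
      positivity
    have hk' := norm_pos_iff.2 hk
    have hxk' := norm_pos_iff.2 hxk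
    have hunit : ∀ v : H, ‖((‖v‖ : ℂ)⁻¹ • v)‖ ≤ 1 := fun v => by
      rw [norm_smul, norm_inv, Complex.norm_real, norm_norm]
      exact inv_mul_le_one
    have h3 := h1 _ _ (hunit (x.1 k)) (hunit k)
    rw [map_smul, inner_smul_left, inner_smul_right, inner_self_eq_norm_sq_to_K, norm_mul,
      norm_mul, norm_pow, RCLike.norm_conj, norm_inv, norm_inv] at h3
    simp only [Complex.norm_real, Complex.coe_algebraMap, norm_norm] at h3
    have h4 : ‖x.1 k‖⁻¹ * (‖k‖⁻¹ * ‖x.1 k‖ ^ 2) = ‖x.1 k‖ / ‖k‖ := by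
      field_simp
    rw [h4, div_le_iff₀ hk'] at h3
    exact h3
  exact norm_le_zero_iff.1 (by linarith)

theorem aleph0_mul_power_aleph0 (c : Cardinal.{u}) :
    (ℵ₀ * c) ^ (ℵ₀ : Cardinal.{u}) = 𝔠 * c ^ ℵ₀ := by
  rw [mul_power, aleph0_power_aleph0]

variable [Nontrivial H]

theorem mk_predual : #(Predual M) = 𝔠 * repDensity M ^ (ℵ₀ : Cardinal.{u}) := by
  have hinf := aleph0_le_continuum.trans (continuum_le_mk_predual M)
  refine le_antisymm ?_ ?_
  · obtain ⟨D, hD, hDc⟩ := exists_dense_mk_eq_densityChar (Predual M) inferInstance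
    refine (mk_le_power_aleph0_of_dense hD).trans_eq ?_
    rw [hDc, ← aleph0_mul_power_aleph0, aleph0_mul_repDensity, densPredual]
  · obtain ⟨T, hT, hsep, hspan⟩ := exists_separated_dense_span M
    have h1 : repDensity M ≤ ℵ₀ * #T := by
      refine (le_mul_left aleph0_ne_zero).trans ((aleph0_mul_repDensity M).le.trans
        ((densPredual_le_of_dense_span M T hspan).trans ?_))
      -- `T` is nonempty because the predual is nonzero; hence ℵ₀·|T| is infinite.
      refine max_le (le_mul_right (mk_set_ne_zero_iff.2 ?_)) (le_mul_left aleph0_ne_zero)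
      have := nontrivial_predual M
      obtain ⟨φ, hφ⟩ := exists_ne (0 : Predual M)
      by_contra! hT
      have := hspan φ
      rw [hT, Submodule.span_empty, Submodule.bot_coe, closure_singleton] at this
      exact hφ this
    have h2 : repDensity M ^ (ℵ₀ : Cardinal.{u}) ≤ #(Predual M) := by
      refine (power_le_power_right h1).trans ?_
      rw [aleph0_mul_power_aleph0]
      exact (mul_le_mul' (continuum_le_mk_predual M)
        (mk_power_aleph0_le_of_separated M hT hsep)).trans (mul_eq_self hinf).le
    exact (mul_le_mul' (continuum_le_mk_predual M) h2).trans (mul_eq_self hinf).le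

theorem continuum_mul_repDensity_power_le :
    𝔠 * repDensity M ^ (ℵ₀ : Cardinal.{u}) ≤ 𝔠 ^ gen M := by
  have hκ := aleph0_le_aleph0_mul_gen M
  have h1 : (𝔠 : Cardinal.{u}) ^ gen M = 2 ^ (ℵ₀ * gen M) := by
    rw [← two_power_aleph0, ← power_mul]
  have h2 : repDensity M ^ (ℵ₀ : Cardinal.{u}) ≤ 2 ^ (ℵ₀ * gen M) := by
    refine (power_le_power_right (repDensity_le_two_power M)).trans ?_
    rw [← power_mul, mul_aleph0_eq hκ]
  have h3 : 𝔠 ≤ (2 : Cardinal.{u}) ^ (ℵ₀ * gen M) := by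
    rw [← two_power_aleph0]
    exact power_le_power_left two_ne_zero hκ
  rw [h1]
  exact (mul_le_mul' h3 h2).trans (mul_eq_self (hκ.trans (cantor _).le)).le

end Cardinality

end VNSize

/-! ### The theorem -/

theorem theorem2p1 (H : Type u) [NormedAddCommGroup H] [InnerProductSpace ℂ H] [CompleteSpace H]
    [Nontrivial H] (M : VonNeumannAlgebra H) :
    -- decomposition as a direct sum of nonzero von Neumann algebras
    (∃ (I : Type u) (E : I → Type u) (_ : ∀ i, NormedAddCommGroup (E i))
        (_ : ∀ i, InnerProductSpace ℂ (E i)) (_ : ∀ i, CompleteSpace (E i))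
        (N : ∀ i, VonNeumannAlgebra (E i)),
      (∀ i, Nontrivial (E i)) ∧
      Nonempty (VNSize.Elt M ≃⋆ₐ[ℂ] VNSize.DirectSum N) ∧
      #I ≤ VNSize.dec (VNSize.center M) ∧
      ∀ i, VNSize.repDensity (N i) ≤ ℵ₀ * VNSize.gen M) ∧
    VNSize.dec (VNSize.center M) ≤ VNSize.dec M ∧
    ℵ₀ * VNSize.gen M = VNSize.sDens M ∧
    VNSize.sDens M = VNSize.sDensBall M ∧
    -- relations between the invariants
    VNSize.gen M * VNSize.dec M = VNSize.repDensity M ∧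
    VNSize.repDensity M ≤ ℵ₀ * VNSize.repDensity M ∧
    ℵ₀ * VNSize.repDensity M = VNSize.densPredual M ∧
    VNSize.densPredual M ≤ #(VNSize.Predual M) ∧
    #(VNSize.Predual M) = 𝔠 * VNSize.repDensity M ^ ℵ₀ ∧
    𝔠 * VNSize.repDensity M ^ ℵ₀ ≤ 𝔠 ^ VNSize.gen M ∧
    -- the two invariants `gen` and `dec` determine the others
    (∀ (K : Type u) [NormedAddCommGroup K] [InnerProductSpace ℂ K] [CompleteSpace K]
        [Nontrivial K] (N : VonNeumannAlgebra K),
      VNSize.gen N = VNSize.gen M → VNSize.dec N = VNSize.dec M →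
        VNSize.sDens N = VNSize.sDens M ∧ VNSize.repDensity N = VNSize.repDensity M ∧
        VNSize.densPredual N = VNSize.densPredual M ∧
        #(VNSize.Predual N) = #(VNSize.Predual M)) := by
  refine ⟨?_, VNSize.dec_center_le M, (VNSize.sDens_eq M).1, (VNSize.sDens_eq M).2,
    VNSize.gen_mul_dec M, le_mul_left aleph0_ne_zero, VNSize.aleph0_mul_repDensity M,
    VNSize.densPredual_le_mk M, VNSize.mk_predual M, VNSize.continuum_mul_repDensity_power_le M,
    fun K _ _ _ _ N hg hd => ?_⟩
  · obtain ⟨S, hS, hSg⟩ := VNSize.exists_generates_mk_le_gen M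
    obtain ⟨V, hV⟩ := hS.exists_isCyclicDecomposition
    refine ⟨V, fun ξ => VNSize.cyclicSpace M S ξ.1, inferInstance, inferInstance, inferInstance,
      fun ξ => VNSize.reduced M (VNSize.cyclicSpace M S ξ.1), fun ξ => ?_,
      hV.nonempty_starAlgEquiv hS, hV.mk_le_dec_center hS, fun ξ =>
        VNSize.IsCyclicDecomposition.repDensity_reduced_le hS
          (VNSize.aleph0_le_aleph0_mul_gen M) (hSg.trans (VNSize.gen_le_aleph0_mul_gen M)) ξ.1⟩
    exact ⟨⟨⟨ξ.1, VNSize.self_mem_cyclicSpace ξ.1⟩, 0, fun h =>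
      hV.ne_zero _ ξ.2 (congrArg Subtype.val h)⟩⟩
  · have hr : VNSize.repDensity N = VNSize.repDensity M := by
      rw [← VNSize.gen_mul_dec, ← VNSize.gen_mul_dec, hg, hd]
    refine ⟨?_, hr, ?_, ?_⟩
    · rw [← (VNSize.sDens_eq N).1, ← (VNSize.sDens_eq M).1, hg]
    · rw [← VNSize.aleph0_mul_repDensity, ← VNSize.aleph0_mul_repDensity, hr]
    · rw [VNSize.mk_predual, VNSize.mk_predual, hr]
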